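/- Let $t,s,k_1,k_2,k_3\in\mathbb{C}$ be arbitrary with $t\neq 0,1$. Let $M_0=T^*(\mathbb{P}^1\setminus\{0,1,t,\infty\})=\{(x,p)\in\mathbb{C}^2:\ x\neq 0,1,t\}$, $\omega=dx\wedge dp$ and $$f(x,p)=x(x-1)(x-t)p^2-s^2x-\frac{k_1^2t}{x}+\frac{k_2^2(t-1)}{x-1}-\frac{k_3^2t(t-1)}{x-t}.$$ With $y=x(x-1)(x-t)p$ the fibre $f=b$ is the curve $y^2=Q_b(x)$ without its points over $x=0,1,t,\infty$, where $Q_b(x)=x(x-1)(x-t)(b+s^2x)+k_1^2t(x-1)(x-t)-k_2^2(t-1)x(x-t)+k_3^2t(t-1)x(x-1)$. *The surface $M$.* At a puncture $a\in\{0,1,t,\infty\}$ let $\xi=x,\ x-1,\ x-t,\ 1/x$, let $\eta$ be the dual fibre coordinate ($p\,dx=\eta\,d\xi$), and let $\kappa=k_1,k_2,k_3,s$, respectively. At the points over $a$ of the completed fibre $f=b$ the function $\xi\eta$ takes the values $v$ with $v^2=\kappa^2$. The complex surface $M\supset M_0$ is obtained by adding these missing points for all $b\in B=\mathbb{C}$,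 that is, by adding over each $a$ one copy of $B$ for every square root $v$ of $\kappa^2$; in the degenerate case $\kappa=0$ the single value of $b$ at which the surface of completed fibres is singular at $x=a$ is omitted from this copy. The functions $f$ and the form $\omega$ extend to $M$. Let $M^{reg}\subset M$ be the set of all points $m$ with $df(m)\neq0$ whose fibre $y^2=Q_{f(m)}(x)$ is irreducible and reduced, i.e. $Q_{f(m)}$ is not the square of a polynomial. (Only finitely many fibres are excluded by the last condition, and none unless $s=\pm k_1\pm k_2\pm k_3$ for some choice of signs.) *$P$ and $N$.* Let $P_0\subset M_0^3$ be the set of all triples of points $(x_i,p_i)$, $i=1,2,3$, with pairwise different $x_1,x_2,x_3$ such that $$f(x_1,p_1)=f(x_2,p_2)=f(x_3,p_3),$$ $$\frac{x_1(x_1-1)(x_1-t)}{(x_1-x_2)(x_1-x_3)}p_1+\frac{x_2(x_2-1)(x_2-t)}{(x_2-x_1)(x_2-x_3)}p_2-\frac{x_3(x_3-1)(x_3-t)}{(x_3-x_1)(x_3-x_2)}p_3-s=0,$$ and let $P=\overline{P_0}\cap (M^{reg})^3$, the closure being taken in $M^3$. Let $N\subset M$ be the added curve over $x=\infty$ with $v=s$,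 i.e. the points at infinity of the fibres near which $p\sim -s/x$ if $s\ne0$. **Theorem.** The tuple $((M,\omega),N,P)$ is a semi-classical multiplication kernel. That is, $M$ is a complex manifold with holomorphic symplectic form $\omega$; $N\subset (M,\omega)$ and $P\subset (M,-\omega)\times(M,-\omega)\times(M,\omega)$ are Lagrangian submanifolds (embedded, complex); and 1. the three projections $\pi_i:P\to M$ are submersions; 2. $P$ is symmetric with respect to interchanging the first two components of $M^3$; 3. the correspondence $M\times M\to M$ given by $P$ is associative: for all $m_1,m_2,m_3,m_4\in M$ there is $m$ with $(m_1,m_2,m),(m,m_3,m_4)\in P$ if and only if there is $m$ with $(m_2,m_3,m),(m_1,m,m_4)\in P$; 4. $\pi_2\times\pi_3$ embeds $\pi_1^{-1}(N)\cap P$ into $M\times M$, with image an open dense subset of the diagonal. Moreover $P$ encodes an addition law on the fibres: for every $b$ such that the fibre over $b$ is irreducible and reduced and meets $N$, in a point $o$ say, there is a commutative group structure on $\{m\in M^{reg}: f(m)=b\}$ with zero $o$ such that for $u,v,w$ in this set $(u,v,w)\in P$ if and only if $u+v=w$. -/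

import Mathlib

open scoped Manifold ContDiff

noncomputable section

/-! ### Complex symplectic manifolds and semi-classical multiplication kernels -/

section General

variable {E : Type*} [NormedAddCommGroup E] [NormedSpace ℂ E]
  {H : Type*} [TopologicalSpace H] (I : ModelWithCorners ℂ E H)
  (X : Type*) [TopologicalSpace X] [ChartedSpace H X]

/-- A (not necessarily continuous or alternating) field of bilinear forms on the tangent spaces
of a complex manifold `X`. -/
abbrev BilinField : Type _ :=
  ∀ x : X, TangentSpace I x →L[ℂ] TangentSpace I x →L[ℂ] ℂ

variable {X}

/-- `φ`, defined on the open set `V ⊆ ℂ^d`, is a local holomorphic parametrization of the subset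
`P` of `X`: a holomorphic immersion, and a homeomorphism of `V` onto an open subset of `P`. -/
structure IsLocalParam (P : Set X) (d : ℕ) (V : Set (Fin d → ℂ)) (φ : (Fin d → ℂ) → X) :
    Prop where
  isOpen : IsOpen V
  holomorphic : MDifferentiableOn 𝓘(ℂ, Fin d → ℂ) I φ V
  immersion : ∀ v ∈ V, Function.Injective (mfderiv 𝓘(ℂ, Fin d → ℂ) I φ v)
  embedding : Topology.IsEmbedding (V.domRestrict φ)
  image : ∃ U : Set X, IsOpen U ∧ φ '' V = P ∩ U

/-- `P` is a Lagrangian submanifold of `X` with respect to `Ω`: an embedded complex submanifold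
of half the dimension of `X` on which `Ω` vanishes identically. -/
def IsLagrangian (Ω : BilinField I X) (P : Set X) : Prop :=
  ∃ d : ℕ, 2 * d = Module.finrank ℂ E ∧ ∀ z ∈ P, ∃ V φ, IsLocalParam I P d V φ ∧ z ∈ φ '' V ∧
    ∀ v ∈ V, ∀ a b : TangentSpace 𝓘(ℂ, Fin d → ℂ) v,
      Ω (φ v) (mfderiv 𝓘(ℂ, Fin d → ℂ) I φ v a) (mfderiv 𝓘(ℂ, Fin d → ℂ) I φ v b) = 0

/-- The restriction to the submanifold `P ⊆ X` of the holomorphic map `g : X → Y` is a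
submersion. -/
def IsSubmersionOn {E' : Type*} [NormedAddCommGroup E'] [NormedSpace ℂ E']
    {H' : Type*} [TopologicalSpace H'] (J : ModelWithCorners ℂ E' H')
    {Y : Type*} [TopologicalSpace Y] [ChartedSpace H' Y] (P : Set X) (g : X → Y) : Prop :=
  ∀ z ∈ P, ∃ d V φ, IsLocalParam I P d V φ ∧ ∃ v ∈ V, φ v = z ∧
    MDifferentiableAt 𝓘(ℂ, Fin d → ℂ) J (g ∘ φ) v ∧
    Function.Surjective (mfderiv 𝓘(ℂ, Fin d → ℂ) J (g ∘ φ) v)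

end General

section Kernel

variable {E : Type*} [NormedAddCommGroup E] [NormedSpace ℂ E]
  {M : Type*} [TopologicalSpace M] [ChartedSpace E M]

/-- The expression of `Ω` in the preferred chart at `x`, a function on (the target of the chart
in) `E` with values in the bilinear forms on `E`. -/
def localForm (Ω : BilinField 𝓘(ℂ, E) M) (x : M) (z : E) : E →L[ℂ] E →L[ℂ] ℂ :=
  let B : E →L[ℂ] E →L[ℂ] ℂ := Ω ((extChartAt 𝓘(ℂ, E) x).symm z)
  let L : E →L[ℂ] E := mfderiv 𝓘(ℂ, E) 𝓘(ℂ, E) (extChartAt 𝓘(ℂ, E) x).symm z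
  B.bilinearComp L L

/-- `M` is a complex manifold (Hausdorff, second countable, with holomorphic transition maps) and
`Ω` is a holomorphic symplectic form on it: alternating, nondegenerate, holomorphic, closed. -/
structure IsSymplectic (Ω : BilinField 𝓘(ℂ, E) M) : Prop where
  finiteDimensional : FiniteDimensional ℂ E
  t2 : T2Space M
  secondCountable : SecondCountableTopology M
  isManifold : IsManifold 𝓘(ℂ, E) ω M
  alternating : ∀ (m : M) (u : TangentSpace 𝓘(ℂ, E) m), Ω m u u = 0
  nondegenerate : ∀ (m : M) (u : TangentSpace 𝓘(ℂ, E) m),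
    (∀ w : TangentSpace 𝓘(ℂ, E) m, Ω m u w = 0) → u = 0
  holomorphic : ∀ x : M,
    DifferentiableOn ℂ (localForm Ω x) (extChartAt 𝓘(ℂ, E) x).target
  closed : ∀ x : M, ∀ z ∈ (extChartAt 𝓘(ℂ, E) x).target, ∀ u v w : E,
    fderiv ℂ (localForm Ω x) z u v w + fderiv ℂ (localForm Ω x) z v w u +
      fderiv ℂ (localForm Ω x) z w u v = 0

/-- The form `-Ω ⊕ -Ω ⊕ Ω` on `M × M × M`. -/
def tripleForm (Ω : BilinField 𝓘(ℂ, E) M) :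
    BilinField (𝓘(ℂ, E).prod (𝓘(ℂ, E).prod 𝓘(ℂ, E))) (M × M × M) := fun z =>
  let p₁ : E × E × E →L[ℂ] E := ContinuousLinearMap.fst ℂ E (E × E)
  let p₂ : E × E × E →L[ℂ] E :=
    (ContinuousLinearMap.fst ℂ E E).comp (ContinuousLinearMap.snd ℂ E (E × E))
  let p₃ : E × E × E →L[ℂ] E :=
    (ContinuousLinearMap.snd ℂ E E).comp (ContinuousLinearMap.snd ℂ E (E × E))
  let Ω' : M → E →L[ℂ] E →L[ℂ] ℂ := Ω
  let r : E × E × E →L[ℂ] E × E × E →L[ℂ] ℂ :=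
    -(Ω' z.1).bilinearComp p₁ p₁ - (Ω' z.2.1).bilinearComp p₂ p₂ + (Ω' z.2.2).bilinearComp p₃ p₃
  r

/-- `((M, Ω), N, P)` is a semi-classical multiplication kernel. -/
structure IsSemiclassicalKernel (Ω : BilinField 𝓘(ℂ, E) M) (N : Set M) (P : Set (M × M × M)) :
    Prop where
  symplectic : IsSymplectic Ω
  lagrangian_N : IsLagrangian 𝓘(ℂ, E) Ω N
  lagrangian_P : IsLagrangian (𝓘(ℂ, E).prod (𝓘(ℂ, E).prod 𝓘(ℂ, E))) (tripleForm Ω) P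
  /- the three projections of `P` to `M` are submersions -/
  submersion₁ : IsSubmersionOn (𝓘(ℂ, E).prod (𝓘(ℂ, E).prod 𝓘(ℂ, E))) 𝓘(ℂ, E) P (fun z => z.1)
  submersion₂ : IsSubmersionOn (𝓘(ℂ, E).prod (𝓘(ℂ, E).prod 𝓘(ℂ, E))) 𝓘(ℂ, E) P (fun z => z.2.1)
  submersion₃ : IsSubmersionOn (𝓘(ℂ, E).prod (𝓘(ℂ, E).prod 𝓘(ℂ, E))) 𝓘(ℂ, E) P (fun z => z.2.2)
  symm : ∀ m₁ m₂ m₃ : M, (m₁, m₂, m₃) ∈ P → (m₂, m₁, m₃) ∈ P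
  /- `(m₁ m₂) m₃ = m₁ (m₂ m₃)` for the correspondence `P : M × M → M` -/
  assoc : ∀ m₁ m₂ m₃ m₄ : M,
    (∃ m, (m₁, m₂, m) ∈ P ∧ (m, m₃, m₄) ∈ P) ↔ (∃ m, (m₂, m₃, m) ∈ P ∧ (m₁, m, m₄) ∈ P)
  /- `π₂ × π₃` embeds `π₁⁻¹(N) ∩ P` onto an open dense subset of the diagonal -/
  unit_embedding : Topology.IsEmbedding (fun z : {z : M × M × M // z ∈ P ∧ z.1 ∈ N} => z.1.2)
  unit_open : ∃ U : Set (M × M), IsOpen U ∧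
    Set.range (fun z : {z : M × M × M // z ∈ P ∧ z.1 ∈ N} => z.1.2) = U ∩ Set.diagonal M
  unit_dense : Set.diagonal M ⊆
    closure (Set.range (fun z : {z : M × M × M // z ∈ P ∧ z.1 ∈ N} => z.1.2))

end Kernel

/-! ### The fibration -/

/-- The parameters. -/
structure FourPointData where
  t : ℂ
  s : ℂ
  k₁ : ℂ
  k₂ : ℂ
  k₃ : ℂ
  t_ne_zero : t ≠ 0
  t_ne_one : t ≠ 1

/-- The four punctures `0, 1, t, ∞` of the projective line. -/
inductive Puncture
  | zero
  | one
  | t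
  | infty

namespace FourPointData

variable (D : FourPointData)

/-- The cotangent bundle of the projective line without `0, 1, t, ∞`, in the coordinates
`(x, p)`. -/
def base : Set (ℂ × ℂ) := {z | z.1 ≠ 0 ∧ z.1 ≠ 1 ∧ z.1 ≠ D.t}

/-- The function `f (x, p)`. -/
def f₀ (x p : ℂ) : ℂ :=
  x * (x - 1) * (x - D.t) * p ^ 2 - D.s ^ 2 * x - D.k₁ ^ 2 * D.t / x
    + D.k₂ ^ 2 * (D.t - 1) / (x - 1) - D.k₃ ^ 2 * D.t * (D.t - 1) / (x - D.t)

/-- In terms of `y = x (x - 1) (x - t) p` the fibre `f = b` is the curve `y² = quartic b x`. -/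
def quartic (b x : ℂ) : ℂ :=
  x * (x - 1) * (x - D.t) * (b + D.s ^ 2 * x) + D.k₁ ^ 2 * D.t * (x - 1) * (x - D.t)
    - D.k₂ ^ 2 * (D.t - 1) * x * (x - D.t) + D.k₃ ^ 2 * D.t * (D.t - 1) * x * (x - 1)

/-- The fibre `y² = quartic b x` is reducible (or non-reduced): the quartic is the square of a
quadratic polynomial. -/
def IsReducible (b : ℂ) : Prop := ∃ c₀ c₁ c₂ : ℂ, ∀ x, D.quartic b x = (c₂ * x ^ 2 + c₁ * x + c₀) ^ 2

/-! #### Local coordinates at the punctures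

At each puncture let `ξ` be the coordinate `x`, `x - 1`, `x - t`, `1 / x` vanishing there, and `η`
the dual fibre coordinate, so that `p dx = η dξ`. The function `f` then is
`C (ξ) ((ξ η)² - κ²) / ξ + g (ξ)` with `C` and `g` regular near `ξ = 0` and `C (0) ≠ 0`. So
`v = ξ η` tends to a square root of `κ²` at the missing points of each fibre: over each puncture
there are two of them if `κ ≠ 0`, and one, a branch point of `x`, if `κ = 0`. -/

/-- `(x, p) ↦ (ξ, η)` -/
def toLocal : Puncture → ℂ × ℂ → ℂ × ℂ
  | .zero, z => z
  | .one, z => (z.1 - 1, z.2)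
  | .t, z => (z.1 - D.t, z.2)
  | .infty, z => (z.1⁻¹, -z.1 ^ 2 * z.2)

/-- `(ξ, η) ↦ (x, p)` -/
def ofLocal : Puncture → ℂ × ℂ → ℂ × ℂ
  | .zero, z => z
  | .one, z => (1 + z.1, z.2)
  | .t, z => (D.t + z.1, z.2)
  | .infty, z => (z.1⁻¹, -z.1 ^ 2 * z.2)

/-- The function `C (ξ)`; outside `ξ = 0` it vanishes exactly at the other punctures. -/
def C : Puncture → ℂ → ℂ
  | .zero, ξ => (ξ - 1) * (ξ - D.t)
  | .one, ξ => (1 + ξ) * (1 + ξ - D.t)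
  | .t, ξ => (D.t + ξ) * (D.t + ξ - 1)
  | .infty, ξ => (1 - ξ) * (1 - D.t * ξ)

/-- The exponent `κ` of a puncture. -/
def κ : Puncture → ℂ
  | .zero => D.k₁
  | .one => D.k₂
  | .t => D.k₃
  | .infty => D.s

/-- The value `g (0)`. -/
def β : Puncture → ℂ
  | .zero => -D.k₁ ^ 2 * (1 + D.t) - D.k₂ ^ 2 * (D.t - 1) + D.k₃ ^ 2 * (D.t - 1)
  | .one => D.k₂ ^ 2 * (2 - D.t) - D.s ^ 2 - D.k₁ ^ 2 * D.t + D.k₃ ^ 2 * D.t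
  | .t => D.k₃ ^ 2 * (2 * D.t - 1) - D.s ^ 2 * D.t - D.k₁ ^ 2 + D.k₂ ^ 2
  | .infty => -D.s ^ 2 * (1 + D.t)

end FourPointData

/-- The points of the partial compactification `M`: the points `(x, p)` of the cotangent bundle,
and over each puncture the missing points of the fibres `f = b`. A missing point is given by `b`
and the value `v` of `ξ η` there, so that we add one copy of the affine line with coordinate `b`
for each root `v` of `v² = κ²`. In the degenerate case `κ = 0` the value `b = g (0)` is left out:
there the surface obtained by completing the fibres has a singular point. -/
inductive HitchinSurface (D : FourPointData) : Type
  | interior (z : ℂ × ℂ) (hz : z ∈ D.base)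
  | added (a : Puncture) (v b : ℂ) (hv : v ^ 2 = D.κ a ^ 2) (hs : v ≠ 0 ∨ b ≠ D.β a)

namespace FourPointData

variable (D : FourPointData)

/-! #### The complex structure

Besides the chart `(x, p)` there are charts around the added points:
* if `v ≠ 0`: the coordinates `(ξ, q)` with `η = v / ξ + q`, in which `dξ ∧ dη = dξ ∧ dq` and
  `f = C (ξ) q (2 v + ξ q) + g (ξ)`;
* if `v = 0`: the coordinates `(r, A)` with `ξ = A r²`, `η = 1 / r`, `A ≠ 0`, in which
  `dξ ∧ dη = dr ∧ dA` and `f = C (A r²) A + g (A r²)`.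
-/

lemma C_ne_zero (a : Puncture) : D.C a 0 ≠ 0 := by
  have h0 := D.t_ne_zero
  have h1 : D.t - 1 ≠ 0 := sub_ne_zero.2 D.t_ne_one
  have h2 : 1 - D.t ≠ 0 := sub_ne_zero.2 D.t_ne_one.symm
  cases a <;> simp [C, h0, h1, h2]

lemma continuous_C (a : Puncture) : Continuous (D.C a) := by
  cases a
  · exact (by fun_prop : Continuous fun ξ : ℂ => (ξ - 1) * (ξ - D.t))
  · exact (by fun_prop : Continuous fun ξ : ℂ => (1 + ξ) * (1 + ξ - D.t))
  · exact (by fun_prop : Continuous fun ξ : ℂ => (D.t + ξ) * (D.t + ξ - 1))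
  · exact (by fun_prop : Continuous fun ξ : ℂ => (1 - ξ) * (1 - D.t * ξ))

lemma isOpen_base : IsOpen D.base :=
  ((isOpen_ne_fun continuous_fst continuous_const).inter
    ((isOpen_ne_fun continuous_fst continuous_const).inter
      (isOpen_ne_fun continuous_fst continuous_const)))

/-- The part of the `(ξ, η)`-plane which corresponds to the cotangent bundle. -/
def localBase (a : Puncture) : Set (ℂ × ℂ) := {z | z.1 ≠ 0 ∧ D.C a z.1 ≠ 0}

lemma toLocal_mem {a : Puncture} {z : ℂ × ℂ} (hz : z ∈ D.base) :
    D.toLocal a z ∈ D.localBase a := by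
  obtain ⟨h0, h1, h2⟩ := hz
  have h1' := sub_ne_zero.2 h1
  have h2' := sub_ne_zero.2 h2
  cases a
  · exact ⟨h0, mul_ne_zero h1' h2'⟩
  · refine ⟨h1', mul_ne_zero ?_ ?_⟩ <;> simpa [toLocal]
  · refine ⟨h2', mul_ne_zero ?_ ?_⟩ <;> simpa [toLocal]
  · refine ⟨inv_ne_zero h0, mul_ne_zero ?_ ?_⟩
    · simp only [toLocal]
      intro h
      apply h1'
      field_simp at h
      simpa using h
    · simp only [toLocal]
      intro h
      apply h2'
      field_simp at h
      simpa using h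

lemma ofLocal_mem {a : Puncture} {z : ℂ × ℂ} (hz : z ∈ D.localBase a) :
    D.ofLocal a z ∈ D.base := by
  obtain ⟨h0, h⟩ := hz
  cases a
  · obtain ⟨h1, h2⟩ := mul_ne_zero_iff.1 h
    exact ⟨h0, sub_ne_zero.1 h1, sub_ne_zero.1 h2⟩
  · obtain ⟨h1, h2⟩ := mul_ne_zero_iff.1 h
    exact ⟨h1, by simpa [ofLocal] using h0, sub_ne_zero.1 h2⟩
  · obtain ⟨h1, h2⟩ := mul_ne_zero_iff.1 h
    exact ⟨h1, sub_ne_zero.1 h2, by simpa [ofLocal] using h0⟩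
  · obtain ⟨h1, h2⟩ := mul_ne_zero_iff.1 h
    refine ⟨inv_ne_zero h0, ?_, ?_⟩
    · simp only [ofLocal]
      intro h
      rw [inv_eq_one] at h
      exact h1 (by rw [h]; ring)
    · simp only [ofLocal]
      intro h
      apply h2
      rw [← h]
      field_simp
      ring

lemma toLocal_ofLocal {a : Puncture} {z : ℂ × ℂ} (hz : z ∈ D.localBase a) :
    D.toLocal a (D.ofLocal a z) = z := by
  have h0 := hz.1
  cases a <;> refine Prod.ext ?_ ?_ <;> simp [toLocal, ofLocal]
  field_simp

lemma ofLocal_toLocal {a : Puncture} {z : ℂ × ℂ} (hz : z ∈ D.base) :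
    D.ofLocal a (D.toLocal a z) = z := by
  have h0 := hz.1
  cases a <;> refine Prod.ext ?_ ?_ <;> simp [toLocal, ofLocal]
  field_simp

lemma continuousOn_toLocal (a : Puncture) : ContinuousOn (D.toLocal a) D.base := by
  cases a
  · exact continuousOn_id
  · exact (by fun_prop : Continuous fun z : ℂ × ℂ => (z.1 - 1, z.2)).continuousOn
  · exact (by fun_prop : Continuous fun z : ℂ × ℂ => (z.1 - D.t, z.2)).continuousOn
  · exact (continuousOn_fst.inv₀ fun z hz => hz.1).prodMk (by fun_prop)

lemma continuousOn_ofLocal (a : Puncture) : ContinuousOn (D.ofLocal a) (D.localBase a) := by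
  cases a
  · exact continuousOn_id
  · exact (by fun_prop : Continuous fun z : ℂ × ℂ => (1 + z.1, z.2)).continuousOn
  · exact (by fun_prop : Continuous fun z : ℂ × ℂ => (D.t + z.1, z.2)).continuousOn
  · exact (continuousOn_fst.inv₀ fun z hz => hz.1).prodMk (by fun_prop)

/-- The charts: `(x, p)`, the charts `(ξ, q)` at a puncture, the charts `(r, A)` at a puncture. -/
inductive ChartIndex
  | main
  | pole (a : Puncture) (v : ℂ) (hv : v ^ 2 = D.κ a ^ 2) (hv0 : v ≠ 0)
  | branch (a : Puncture) (hκ : D.κ a = 0)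

variable {D}

/-- The image of a chart. -/
def chartTarget : D.ChartIndex → Set (ℂ × ℂ)
  | .main => D.base
  | .pole a _ _ _ => {z | D.C a z.1 ≠ 0}
  | .branch a _ => {z | z.2 ≠ 0 ∧ D.C a (z.2 * z.1 ^ 2) ≠ 0}

/-- The part of the image of a chart which corresponds to points of the cotangent bundle. -/
def innerTarget : D.ChartIndex → Set (ℂ × ℂ)
  | .main => D.base
  | .pole a _ _ _ => {z | z.1 ≠ 0 ∧ D.C a z.1 ≠ 0}
  | .branch a _ => {z | z.1 ≠ 0 ∧ z.2 ≠ 0 ∧ D.C a (z.2 * z.1 ^ 2) ≠ 0}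

/-- The coordinates `(x, p)` as functions of the coordinates of a chart. -/
def innerInv : D.ChartIndex → ℂ × ℂ → ℂ × ℂ
  | .main, z => z
  | .pole a v _ _, z => D.ofLocal a (z.1, v / z.1 + z.2)
  | .branch a _, z => D.ofLocal a (z.2 * z.1 ^ 2, z.1⁻¹)

/-- The points `(x, p)` which lie in the domain of a chart. -/
def innerSource : D.ChartIndex → Set (ℂ × ℂ)
  | .main => D.base
  | .pole _ _ _ _ => D.base
  | .branch a _ => {z | z ∈ D.base ∧ (D.toLocal a z).2 ≠ 0}

/-- The coordinates of a chart as functions of `(x, p)`. -/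
def innerMap : D.ChartIndex → ℂ × ℂ → ℂ × ℂ
  | .main, z => z
  | .pole a v _ _, z => ((D.toLocal a z).1, (D.toLocal a z).2 - v / (D.toLocal a z).1)
  | .branch a _, z => ((D.toLocal a z).2⁻¹, (D.toLocal a z).1 * (D.toLocal a z).2 ^ 2)

lemma innerSource_subset (i : D.ChartIndex) : innerSource i ⊆ D.base := by
  cases i
  · exact subset_rfl
  · exact subset_rfl
  · exact fun z hz => hz.1

lemma innerTarget_subset (i : D.ChartIndex) : innerTarget i ⊆ chartTarget i := by
  cases i
  · exact subset_rfl
  · exact fun z hz => hz.2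
  · exact fun z hz => hz.2

lemma innerMap_mem {i : D.ChartIndex} {z : ℂ × ℂ} (hz : z ∈ innerSource i) :
    innerMap i z ∈ innerTarget i := by
  cases i with
  | main => exact hz
  | pole a v hv hv0 => exact D.toLocal_mem hz
  | branch a hκ =>
    obtain ⟨h1, h2⟩ := D.toLocal_mem (a := a) hz.1
    have h3 := hz.2
    refine ⟨inv_ne_zero h3, mul_ne_zero h1 (pow_ne_zero _ h3), ?_⟩
    simp only [innerMap]
    convert h2 using 2
    field_simp

lemma innerInv_mem {i : D.ChartIndex} {z : ℂ × ℂ} (hz : z ∈ innerTarget i) :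
    innerInv i z ∈ innerSource i := by
  cases i with
  | main => exact hz
  | pole a v hv hv0 => exact D.ofLocal_mem (z := (z.1, v / z.1 + z.2)) hz
  | branch a hκ =>
    have h : (z.2 * z.1 ^ 2, z.1⁻¹) ∈ D.localBase a :=
      ⟨mul_ne_zero hz.2.1 (pow_ne_zero _ hz.1), hz.2.2⟩
    refine ⟨D.ofLocal_mem h, ?_⟩
    simp only [innerInv]
    rw [D.toLocal_ofLocal h]
    exact inv_ne_zero hz.1

lemma innerInv_innerMap {i : D.ChartIndex} {z : ℂ × ℂ} (hz : z ∈ innerSource i) :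
    innerInv i (innerMap i z) = z := by
  cases i with
  | main => rfl
  | pole a v hv hv0 =>
    simp only [innerInv, innerMap, add_sub_cancel, Prod.mk.eta]
    exact D.ofLocal_toLocal hz
  | branch a hκ =>
    have h3 := hz.2
    simp only [innerInv, innerMap, inv_inv]
    have : (D.toLocal a z).1 * (D.toLocal a z).2 ^ 2 * (D.toLocal a z).2⁻¹ ^ 2
        = (D.toLocal a z).1 := by field_simp
    rw [this]
    exact D.ofLocal_toLocal hz.1

lemma innerMap_innerInv {i : D.ChartIndex} {z : ℂ × ℂ} (hz : z ∈ innerTarget i) :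
    innerMap i (innerInv i z) = z := by
  cases i with
  | main => rfl
  | pole a v hv hv0 =>
    simp only [innerInv, innerMap]
    rw [D.toLocal_ofLocal (z := (z.1, v / z.1 + z.2)) hz]
    simp
  | branch a hκ =>
    have h : (z.2 * z.1 ^ 2, z.1⁻¹) ∈ D.localBase a :=
      ⟨mul_ne_zero hz.2.1 (pow_ne_zero _ hz.1), hz.2.2⟩
    have h1 := hz.1
    simp only [innerInv, innerMap]
    rw [D.toLocal_ofLocal h]
    refine Prod.ext (by simp) ?_
    simp only
    field_simp

lemma isOpen_chartTarget (i : D.ChartIndex) : IsOpen (chartTarget i) := by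
  cases i with
  | main => exact D.isOpen_base
  | pole a v hv hv0 =>
    exact isOpen_ne_fun ((D.continuous_C a).comp continuous_fst) continuous_const
  | branch a hκ =>
    exact (isOpen_ne_fun continuous_snd continuous_const).inter
      (isOpen_ne_fun ((D.continuous_C a).comp (by fun_prop)) continuous_const)

lemma isOpen_innerTarget (i : D.ChartIndex) : IsOpen (innerTarget i) := by
  cases i with
  | main => exact D.isOpen_base
  | pole a v hv hv0 =>
    exact (isOpen_ne_fun continuous_fst continuous_const).inter
      (isOpen_chartTarget (.pole a v hv hv0))
  | branch a hκ =>
    exact (isOpen_ne_fun continuous_fst continuous_const).inter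
      (isOpen_chartTarget (.branch a hκ))

lemma isOpen_innerSource (i : D.ChartIndex) : IsOpen (innerSource i) := by
  cases i with
  | main => exact D.isOpen_base
  | pole a v hv hv0 => exact D.isOpen_base
  | branch a hκ =>
    exact (D.continuousOn_toLocal a).snd.isOpen_inter_preimage D.isOpen_base isOpen_ne

lemma continuousOn_innerInv (i : D.ChartIndex) : ContinuousOn (innerInv i) (innerTarget i) := by
  cases i with
  | main => exact continuousOn_id
  | pole a v hv hv0 =>
    refine (D.continuousOn_ofLocal a).comp (f := fun z : ℂ × ℂ => (z.1, v / z.1 + z.2)) ?_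
      (fun z hz => hz)
    exact continuousOn_fst.prodMk
      ((continuousOn_const.div continuousOn_fst fun z hz => hz.1).add continuousOn_snd)
  | branch a hκ =>
    refine (D.continuousOn_ofLocal a).comp
      (f := fun z : ℂ × ℂ => (z.2 * z.1 ^ 2, z.1⁻¹)) ?_
      (fun z hz => ⟨mul_ne_zero hz.2.1 (pow_ne_zero _ hz.1), hz.2.2⟩)
    exact ContinuousOn.prodMk (by fun_prop) (continuousOn_fst.inv₀ fun z hz => hz.1)

lemma continuousOn_innerMap (i : D.ChartIndex) : ContinuousOn (innerMap i) (innerSource i) := by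
  cases i with
  | main => exact continuousOn_id
  | pole a v hv hv0 =>
    have h := D.continuousOn_toLocal a
    exact h.fst.prodMk
      (h.snd.sub (continuousOn_const.div h.fst fun z hz => (D.toLocal_mem hz).1))
  | branch a hκ =>
    have h := (D.continuousOn_toLocal a).mono (innerSource_subset (.branch a hκ))
    exact (h.snd.inv₀ fun z hz => hz.2).prodMk (h.fst.mul (h.snd.pow 2))

/-- The domain of a chart. -/
def chartSource : D.ChartIndex → Set (HitchinSurface D)
  | i, .interior z _ => z ∈ innerSource i
  | .main, .added _ _ _ _ _ => False
  | .pole a v _ _, .added a' v' _ _ _ => a' = a ∧ v' = v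
  | .branch a _, .added a' _ _ _ _ => a' = a

/-- The coordinates of a point in a chart. At an added point `b = f` equals
`2 v C (0) q + g (0)`, respectively `C (0) A + g (0)`. -/
def chartMap : D.ChartIndex → HitchinSurface D → ℂ × ℂ
  | i, .interior z _ => innerMap i z
  | .main, .added _ _ _ _ _ => 0
  | .pole a v _ _, .added _ _ b _ _ => (0, (b - D.β a) / (2 * v * D.C a 0))
  | .branch a _, .added _ _ b _ _ => (0, (b - D.β a) / D.C a 0)

instance : Nonempty (HitchinSurface D) := by
  refine ⟨.interior (((‖D.t‖ + 2 : ℝ) : ℂ), 0) ⟨?_, ?_, ?_⟩⟩ <;> intro h <;>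
    have h' := congrArg norm h <;>
    simp only [Complex.norm_real, Real.norm_eq_abs, norm_zero, norm_one] at h' <;>
    rw [abs_of_nonneg (by positivity)] at h' <;> linarith [norm_nonneg D.t]

open Classical in
/-- The point with given coordinates in a chart. -/
def chartInv (i : D.ChartIndex) (z : ℂ × ℂ) : HitchinSurface D :=
  if h : z ∈ innerTarget i then
    .interior (innerInv i z) (innerSource_subset i (innerInv_mem h))
  else match i with
    | .main => Classical.arbitrary _
    | .pole a v hv hv0 => .added a v (2 * v * D.C a 0 * z.2 + D.β a) hv (.inl hv0)
    | .branch a hκ =>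
      if h2 : z.2 ≠ 0 then
        .added a 0 (D.C a 0 * z.2 + D.β a) (by simp [hκ])
          (.inr (by simpa using ⟨D.C_ne_zero a, h2⟩))
      else Classical.arbitrary _

lemma chartInv_inner {i : D.ChartIndex} {z : ℂ × ℂ} (h : z ∈ innerTarget i) :
    chartInv i z = .interior (innerInv i z) (innerSource_subset i (innerInv_mem h)) := by
  unfold chartInv
  rw [dif_pos h]

lemma chartInv_pole {a : Puncture} {v : ℂ} (hv : v ^ 2 = D.κ a ^ 2) (hv0 : v ≠ 0) {z : ℂ × ℂ}
    (h : z.1 = 0) : chartInv (.pole a v hv hv0) z =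
      .added a v (2 * v * D.C a 0 * z.2 + D.β a) hv (.inl hv0) := by
  have h' : z ∉ innerTarget (ChartIndex.pole a v hv hv0) := fun h' => h'.1 h
  unfold chartInv
  rw [dif_neg h']

lemma chartInv_branch {a : Puncture} (hκ : D.κ a = 0) {z : ℂ × ℂ} (h : z.1 = 0) (h2 : z.2 ≠ 0) :
    chartInv (.branch a hκ) z =
      .added a 0 (D.C a 0 * z.2 + D.β a) (by simp [hκ])
        (.inr (by simpa using ⟨D.C_ne_zero a, h2⟩)) := by
  have h' : z ∉ innerTarget (ChartIndex.branch a hκ) := fun h' => h'.1 h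
  unfold chartInv
  rw [dif_neg h']
  simp only [dif_pos h2]

/-- The charts as partial bijections between the surface and `ℂ²`. -/
def chart (i : D.ChartIndex) : PartialEquiv (HitchinSurface D) (ℂ × ℂ) where
  toFun := chartMap i
  invFun := chartInv i
  source := {m | chartSource i m}
  target := chartTarget i
  map_source' := by
    rintro (⟨z, hz⟩ | ⟨a', v', b, hv', hs⟩) hm
    · exact innerTarget_subset i (innerMap_mem (i := i) (by simpa [chartSource] using hm))
    · cases i with
      | main => exact hm.elim
      | pole a v hv hv0 => exact D.C_ne_zero a
      | branch a hκ =>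
        obtain rfl : a' = a := hm
        have hv0 : v' = 0 := by simpa [hκ] using hv'
        have hb : b ≠ D.β a' := hs.resolve_left (not_not.2 hv0)
        refine ⟨div_ne_zero (sub_ne_zero.2 hb) (D.C_ne_zero a'), ?_⟩
        simpa [chartMap] using D.C_ne_zero a'
  map_target' := by
    intro z hz
    by_cases h : z ∈ innerTarget i
    · rw [chartInv_inner h]
      simpa [chartSource] using innerInv_mem h
    · cases i with
      | main => exact (h hz).elim
      | pole a v hv hv0 =>
        rw [chartInv_pole hv hv0 (by_contra fun h1 => h ⟨h1, hz⟩)]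
        exact ⟨rfl, rfl⟩
      | branch a hκ =>
        rw [chartInv_branch hκ (by_contra fun h1 => h ⟨h1, hz⟩) hz.1]
        exact rfl
  left_inv' := by
    rintro (⟨z, hz⟩ | ⟨a', v', b, hv', hs⟩) hm
    · have hm' : z ∈ innerSource i := by simpa [chartSource] using hm
      have h : chartMap i (.interior z hz) = innerMap i z := by simp [chartMap]
      rw [h, chartInv_inner (innerMap_mem hm')]
      simp only [innerInv_innerMap hm']
    · cases i with
      | main => exact hm.elim
      | pole a v hv hv0 =>
        obtain ⟨rfl, rfl⟩ : a' = a ∧ v' = v := hm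
        have hC := D.C_ne_zero a'
        rw [chartInv_pole hv hv0 rfl]
        congr 1
        simp only [chartMap]
        field_simp
        ring
      | branch a hκ =>
        obtain rfl : a' = a := hm
        have hC := D.C_ne_zero a'
        obtain rfl : v' = 0 := by simpa [hκ] using hv'
        have hb : b ≠ D.β a' := hs.resolve_left (not_not.2 rfl)
        rw [chartInv_branch hκ rfl (div_ne_zero (sub_ne_zero.2 hb) hC)]
        congr 1
        simp only [chartMap]
        field_simp
        ring
  right_inv' := by
    intro z hz
    by_cases h : z ∈ innerTarget i
    · rw [chartInv_inner h]
      simpa [chartMap] using innerMap_innerInv h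
    · cases i with
      | main => exact (h hz).elim
      | pole a v hv hv0 =>
        have h1 : z.1 = 0 := by_contra fun h1 => h ⟨h1, hz⟩
        have hC := D.C_ne_zero a
        rw [chartInv_pole hv hv0 h1]
        refine Prod.ext h1.symm ?_
        simp only [chartMap]
        field_simp
        ring
      | branch a hκ =>
        have h1 : z.1 = 0 := by_contra fun h1 => h ⟨h1, hz⟩
        have hC := D.C_ne_zero a
        rw [chartInv_branch hκ h1 hz.1]
        refine Prod.ext h1.symm ?_
        simp only [chartMap]
        field_simp
        ring

/-- A chart around each point. -/
def chartIndexAt : HitchinSurface D → D.ChartIndex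
  | .interior _ _ => .main
  | .added a v _ hv _ =>
    open Classical in
    if h : v = 0 then .branch a (by simpa [h] using hv.symm) else .pole a v hv h

/-- Two different charts overlap only in the cotangent bundle. -/
lemma chart_overlap {i j : D.ChartIndex} (hij : i ≠ j) {z : ℂ × ℂ}
    (hz : z ∈ ((chart i).symm.trans (chart j)).source) :
    z ∈ innerTarget i ∧ innerInv i z ∈ innerSource j := by
  obtain ⟨hz1, hz2⟩ := hz
  change z ∈ chartTarget i at hz1
  change chartSource j (chartInv i z) at hz2
  by_cases h : z ∈ innerTarget i
  · rw [chartInv_inner h] at hz2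
    exact ⟨h, by simpa [chartSource] using hz2⟩
  · exfalso
    cases i with
    | main => exact (h hz1).elim
    | pole a v hv hv0 =>
      rw [chartInv_pole hv hv0 (by_contra fun h1 => h ⟨h1, hz1⟩)] at hz2
      cases j with
      | main => exact hz2
      | pole a' v' hv' hv0' =>
        obtain ⟨rfl, rfl⟩ := hz2
        exact hij rfl
      | branch a' hκ =>
        obtain rfl : a = a' := hz2
        exact hv0 (by simpa [hκ] using hv)
    | branch a hκ =>
      rw [chartInv_branch hκ (by_contra fun h1 => h ⟨h1, hz1⟩) hz1.1] at hz2
      cases j with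
      | main => exact hz2
      | pole a' v' hv' hv0' => exact hv0' hz2.2.symm
      | branch a' hκ' =>
        obtain rfl : a = a' := hz2
        exact hij rfl

lemma chart_overlap_source {i j : D.ChartIndex} (hij : i ≠ j) :
    ((chart i).symm.trans (chart j)).source =
      innerTarget i ∩ innerInv i ⁻¹' innerSource j := by
  ext z
  refine ⟨fun hz => chart_overlap hij hz, fun ⟨h1, h2⟩ => ⟨innerTarget_subset i h1, ?_⟩⟩
  change chartSource j (chartInv i z)
  rw [chartInv_inner h1]
  simpa [chartSource] using h2

/-- The charts define a topology and a complex structure on the surface. -/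
def core : ChartedSpaceCore (ℂ × ℂ) (HitchinSurface D) where
  atlas := Set.range chart
  chartAt m := chart (chartIndexAt m)
  mem_chart_source := by
    rintro (⟨z, hz⟩ | ⟨a, v, b, hv, hs⟩)
    · exact hz
    · change chartSource (chartIndexAt _) _
      by_cases h : v = 0
      · simp [chartIndexAt, h, chartSource]
      · simp [chartIndexAt, h, chartSource]
  chart_mem_atlas m := ⟨_, rfl⟩
  open_source := by
    rintro _ _ ⟨i, rfl⟩ ⟨j, rfl⟩
    by_cases hij : i = j
    · subst hij
      have h : ((chart i).symm.trans (chart i)).source = chartTarget i :=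
        Set.inter_eq_left.2 fun z hz => (chart i).map_target hz
      rw [h]
      exact isOpen_chartTarget i
    · rw [chart_overlap_source hij]
      exact (continuousOn_innerInv i).isOpen_inter_preimage (isOpen_innerTarget i)
        (isOpen_innerSource j)
  continuousOn_toFun := by
    rintro _ _ ⟨i, rfl⟩ ⟨j, rfl⟩
    by_cases hij : i = j
    · subst hij
      exact continuousOn_id.congr fun z hz => (chart i).right_inv hz.1
    · rw [chart_overlap_source hij]
      refine ((continuousOn_innerMap j).comp
        ((continuousOn_innerInv i).mono Set.inter_subset_left) fun z hz => hz.2).congr ?_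
      rintro z ⟨h1, h2⟩
      change chartMap j (chartInv i z) = innerMap j (innerInv i z)
      rw [chartInv_inner h1]
      simp [chartMap]

instance : TopologicalSpace (HitchinSurface D) := core.toTopologicalSpace

instance : ChartedSpace (ℂ × ℂ) (HitchinSurface D) := core.toChartedSpace

variable (D)

/-- The symplectic form. All preferred charts are Darboux charts: on the cotangent bundle the form
is `dx ∧ dp`, and at the added points it is `dξ ∧ dq`, respectively `dr ∧ dA`. (Tangent vectors at
a point are given by their coordinates in the preferred chart at this point.) -/
def Ω : BilinField 𝓘(ℂ, ℂ × ℂ) (HitchinSurface D) := fun _ =>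
  let p₁ : ℂ × ℂ →L[ℂ] ℂ := ContinuousLinearMap.fst ℂ ℂ ℂ
  let p₂ : ℂ × ℂ →L[ℂ] ℂ := ContinuousLinearMap.snd ℂ ℂ ℂ
  let r : ℂ × ℂ →L[ℂ] ℂ × ℂ →L[ℂ] ℂ :=
    (ContinuousLinearMap.mul ℂ ℂ).bilinearComp p₁ p₂
      - (ContinuousLinearMap.mul ℂ ℂ).bilinearComp p₂ p₁
  r

/-- The fibration `M → B = ℂ`: the extension of `f (x, p)`. -/
def f : HitchinSurface D → ℂ
  | .interior z _ => D.f₀ z.1 z.2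
  | .added _ _ b _ _ => b

/-- The points at which the fibre of `f` through them is irreducible and nonsingular. -/
def regular : Set (HitchinSurface D) :=
  {m | mfderiv 𝓘(ℂ, ℂ × ℂ) 𝓘(ℂ, ℂ) D.f m ≠ 0 ∧ ¬ D.IsReducible (D.f m)}

/-- The triples in the cotangent bundle, with pairwise different `x₁, x₂, x₃`, which satisfy the
equations of the multiplication. -/
def equations : Set (HitchinSurface D × HitchinSurface D × HitchinSurface D) :=
  {m | ∃ x₁ p₁ x₂ p₂ x₃ p₃ : ℂ, ∃ h₁ : (x₁, p₁) ∈ D.base, ∃ h₂ : (x₂, p₂) ∈ D.base,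
    ∃ h₃ : (x₃, p₃) ∈ D.base,
    m = (.interior (x₁, p₁) h₁, .interior (x₂, p₂) h₂, .interior (x₃, p₃) h₃) ∧
    x₁ ≠ x₂ ∧ x₁ ≠ x₃ ∧ x₂ ≠ x₃ ∧
    D.f₀ x₁ p₁ = D.f₀ x₂ p₂ ∧ D.f₀ x₂ p₂ = D.f₀ x₃ p₃ ∧
    x₁ * (x₁ - 1) * (x₁ - D.t) / ((x₁ - x₂) * (x₁ - x₃)) * p₁
      + x₂ * (x₂ - 1) * (x₂ - D.t) / ((x₂ - x₁) * (x₂ - x₃)) * p₂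
      - x₃ * (x₃ - 1) * (x₃ - D.t) / ((x₃ - x₁) * (x₃ - x₂)) * p₃ - D.s = 0}

/-- The correspondence `P`: the closure of the locus defined by the equations, restricted to the
nonsingular points of irreducible fibres. -/
def P : Set (HitchinSurface D × HitchinSurface D × HitchinSurface D) :=
  {m ∈ closure D.equations | m.1 ∈ D.regular ∧ m.2.1 ∈ D.regular ∧ m.2.2 ∈ D.regular}

/-- The section `N` at `x = ∞`: the missing points with `v = s`, near which `p ~ -s / x`. -/
def N : Set (HitchinSurface D) := {m | ∃ b hv hs, m = .added .infty D.s b hv hs}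

end FourPointData

/-! The fibres of `f` carry a group law, `P` is its graph, and the graph is Lagrangian because
addition is compatible with `dx ∧ dp`.

Group law. On the quartic curve of a fibre let `o` and `o'` be the points at infinity with `y ~ -s
x²` and `y ~ s x²` (one point if `s = 0`). With `w = s x² - y` the functions `X = 2 s w + a x` and
`Y = 2 s x (X + c) + a w` have poles only at `o`, of order two and three. They identify the
nonsingular points of the curve with those of a Weierstrass cubic with zero `o` (`pt_injective`,
`pt_surjective`). The equation of the multiplication says, by Lagrange's formula, that the quadratic
`q` with the values `y₁, y₂, -y₃` at `x₁, x₂, x₃` has leading coefficient `s`. Then `y - q` has the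
divisor `u + v + w' - 2 o - o'`, where `w'` is the conjugate of the third point `w`. As `w + w' ~ o
+ o'`, this means `u + v = w` (`toPoint_add_iff`).

Isotropy for different `x₁, x₂, x₃`. On the surface `dx ∧ dp = dx ∧ db / (2 y)`. One has `Q_b - q² =
K ∏ (x - xᵢ)`, with `K ≠ 0` because the fibre is irreducible. Differentiating `Q_b (xᵢ) = q (xᵢ)²`
turns the sum of the three forms, up to sign, into the sum of `(xᵢ dc₁ + dc₀) ∧ db / (K ∏ (xᵢ -
xⱼ))`. It vanishes because a linear polynomial has no `x²` coefficient (`lagrange_identity`,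
`isotropic_of_interpolates`).

All other triples are moved into this position by translations. Translation by a local holomorphic
section `σ` of `f` is symplectic: the triple `(m, σ (f m), m + σ (f m))` is isotropic, and its
middle entry depends only on `f`, so that it contributes nothing (`exists_isTranslation`).
Translating by `σ₁`, `σ₂`, `σ₁ + σ₂` preserves `u + v = w`, and only finitely many values of the
sections in a given fibre are bad (`exists_isTranslationTriple`). So near each of its points the
graph is parametrized by `b` and the `x`-coordinates of two translates (`exists_isAddParam`), which
yields the submanifold, the isotropy and the submersions. For holomorphy near the zero of the group
the sum is computed in Jacobian coordinates (`exists_isRep`, `exists_sum`).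

`P` equals the graph (`P_eq_addGraph`). Locally the graph is that of a continuous map, so limits of
solutions of the equations stay in it; only the fibre `b = 0` for `s = 0`, which does not meet `N`,
needs a separate argument (`P_subset_addGraph`). Conversely each point of the graph is moved into
general position within its fibre (`addGraph_subset_closure`). Symmetry, associativity and the unit
are then the axioms of a commutative group. -/

/-! ### Quartics with square leading coefficient and their Weierstrass curves. -/

/-- The coefficients of a quartic `y² = s² x⁴ + a x³ + c x² + d x + e`. -/
structure SquareQuartic where
  s : ℂ
  a : ℂ
  c : ℂ
  d : ℂ
  e : ℂ

namespace SquareQuartic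

variable (q : SquareQuartic)

/-- The polynomial function of the quartic. -/
def eval (x : ℂ) : ℂ := q.s ^ 2 * x ^ 4 + q.a * x ^ 3 + q.c * x ^ 2 + q.d * x + q.e

/-- The quartic is not a square, and the point at infinity with `y ~ -s x²` is nonsingular. -/
structure Good : Prop where
  irred : ¬ ∃ c₀ c₁ c₂ : ℂ, ∀ x, q.eval x = (c₂ * x ^ 2 + c₁ * x + c₀) ^ 2
  infty : q.s ≠ 0 ∨ q.a ≠ 0

/-- The Weierstrass curve of the quartic, with the point at infinity with `y ~ -s x²` as zero. -/
def W : WeierstrassCurve ℂ :=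
  ⟨0, q.c, 2 * q.s * q.d, q.a * q.d - 4 * q.s ^ 2 * q.e, q.e * (q.a ^ 2 - 4 * q.s ^ 2 * q.c)⟩

/-- The equation of the quartic in terms of `w = s x² - y`. -/
def OnCurve (x w : ℂ) : Prop :=
  w ^ 2 = x ^ 2 * (2 * q.s * w + q.a * x + q.c) + q.d * x + q.e

/-- The Weierstrass coordinate `X`. -/
def X (x w : ℂ) : ℂ := 2 * q.s * w + q.a * x

/-- The Weierstrass coordinate `Y`. -/
def Y (x w : ℂ) : ℂ := 2 * q.s * x * (2 * q.s * w + q.a * x + q.c) + q.a * w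

/-- A finite point of the quartic at which it is nonsingular. -/
def Smooth (x w : ℂ) : Prop :=
  w - q.s * x ^ 2 ≠ 0 ∨ 4 * q.s * x * w + 3 * q.a * x ^ 2 + 2 * q.c * x + q.d ≠ 0

/-- The determinant of the linear equations for `w, x` in terms of `X, Y`. -/
def delta (X : ℂ) : ℂ := 4 * q.s ^ 2 * (X + q.c) - q.a ^ 2

/-- The `X`-coordinate of the point at infinity with `y ~ s x²`. -/
def XInf : ℂ := q.a ^ 2 / (4 * q.s ^ 2) - q.c

/-- The `Y`-coordinate of the point at infinity with `y ~ s x²`. -/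
def YInf : ℂ := -q.a * q.XInf / (2 * q.s) - 2 * q.s * q.d

variable {q}

lemma equation_iff (x y : ℂ) : q.W.toAffine.Equation x y ↔
    y ^ 2 + 2 * q.s * q.d * y = x ^ 3 + q.c * x ^ 2 + (q.a * q.d - 4 * q.s ^ 2 * q.e) * x
      + q.e * (q.a ^ 2 - 4 * q.s ^ 2 * q.c) := by
  rw [WeierstrassCurve.Affine.equation_iff]
  simp [W]

lemma nonsingular_iff (x y : ℂ) : q.W.toAffine.Nonsingular x y ↔
    q.W.toAffine.Equation x y ∧
      (3 * x ^ 2 + 2 * q.c * x + (q.a * q.d - 4 * q.s ^ 2 * q.e) ≠ 0 ∨ 2 * y + 2 * q.s * q.d ≠ 0) := by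
  rw [WeierstrassCurve.Affine.nonsingular_iff']
  simp only [W, zero_mul, zero_sub, add_zero, ne_eq, neg_eq_zero]

lemma OnCurve.equation {x w : ℂ} (h : q.OnCurve x w) :
    q.W.toAffine.Equation (q.X x w) (q.Y x w) := by
  rw [equation_iff]
  unfold OnCurve at h
  unfold X Y
  linear_combination (q.a ^ 2 - 4 * q.s ^ 2 * (2 * q.s * w + q.a * x + q.c)) * h

/-- If both numbers vanished, completing the square would give `(s x² + a x / (2 s) - XInf / (2
s))²` for the quartic. They govern the linear equation for `x` over `X = XInf`. -/
lemma Good.finite_of_delta_eq_zero (hq : q.Good) (hs : q.s ≠ 0) :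
    4 * q.s ^ 2 * q.d + 2 * q.a * q.XInf ≠ 0 ∨ q.XInf ^ 2 ≠ 4 * q.s ^ 2 * q.e := by
  by_contra! h
  obtain ⟨h1, h2⟩ := h
  have hX : 4 * q.s ^ 2 * (q.XInf + q.c) = q.a ^ 2 := by unfold XInf; field_simp; ring
  refine hq.irred ⟨-q.XInf / (2 * q.s), q.a / (2 * q.s), q.s, fun x => ?_⟩
  unfold eval
  field_simp
  linear_combination x ^ 2 * hX + x * h1 - h2

/-- For `s = 0` the determinant is the constant `-a²`. The inversion fails only where there is a
second point at infinity. -/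
lemma ne_zero_of_delta (hq : q.Good) {X : ℂ} (h : q.delta X = 0) : q.s ≠ 0 := by
  intro hs
  have := hq.infty.resolve_left (not_not.2 hs)
  simp [delta, hs, this] at h

lemma eq_XInf {X : ℂ} (hs : q.s ≠ 0) (h : q.delta X = 0) : X = q.XInf := by
  unfold delta at h
  unfold XInf
  field_simp
  linear_combination h

lemma delta_XInf (hs : q.s ≠ 0) : q.delta q.XInf = 0 := by
  unfold delta XInf
  field_simp
  ring

/-- Together with `mul_delta_w` this is Cramer's rule for the system `2 s w + a x = X`, `a w + 2 s
(X + c) x = Y`. -/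
lemma mul_delta_x (x w : ℂ) :
    x * q.delta (q.X x w) = 2 * q.s * q.Y x w - q.a * q.X x w := by
  unfold delta X Y; ring

lemma mul_delta_w (x w : ℂ) :
    w * q.delta (q.X x w) = 2 * q.s * (q.X x w + q.c) * q.X x w - q.a * q.Y x w := by
  unfold delta X Y; ring

/-- At a finite point with `X = XInf` the coordinate `x` satisfies a linear equation. -/
lemma OnCurve.linear {x w : ℂ} (h : q.OnCurve x w) (hs : q.s ≠ 0) (hX : q.X x w = q.XInf) :
    x * (4 * q.s ^ 2 * q.d + 2 * q.a * q.XInf) = q.XInf ^ 2 - 4 * q.s ^ 2 * q.e := by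
  have h1 : 4 * q.s ^ 2 * (q.XInf + q.c) = q.a ^ 2 := by unfold XInf; field_simp; ring
  rw [← hX] at h1 ⊢
  unfold OnCurve at h
  unfold X at *
  linear_combination -4 * q.s ^ 2 * h  - x ^ 2 * h1

/-- If the coefficient of `x` vanished, so would the right-hand side of `OnCurve.linear`, and the
quartic would be a square. -/
lemma OnCurve.linear_ne_zero (hq : q.Good) {x w : ℂ} (h : q.OnCurve x w) (hs : q.s ≠ 0)
    (hX : q.X x w = q.XInf) : 4 * q.s ^ 2 * q.d + 2 * q.a * q.XInf ≠ 0 := by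
  intro h0
  have h1 := h.linear hs hX
  rw [h0, mul_zero] at h1
  exact (hq.finite_of_delta_eq_zero hs).elim (· h0) (· (by linear_combination -h1))

/-- Cramer's rule with vanishing determinant leaves a relation between `X` and `Y`. -/
lemma Y_of_eq_XInf {x w : ℂ} (hs : q.s ≠ 0) (hX : q.X x w = q.XInf) :
    2 * q.s * q.Y x w = q.a * q.XInf := by
  have h1 := delta_XInf hs
  rw [← hX] at h1 ⊢
  linear_combination -mul_delta_x x w + x * h1

/-- Where `delta` does not vanish, Cramer's rule recovers `x` and `w`. Over `XInf` the linear
equation determines `x`, and then the value of `X` determines `w`. -/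
theorem OnCurve.ext (hq : q.Good) {x w x' w' : ℂ} (h : q.OnCurve x w) (h' : q.OnCurve x' w')
    (hX : q.X x w = q.X x' w') (hY : q.Y x w = q.Y x' w') : x = x' ∧ w = w' := by
  by_cases hd : q.delta (q.X x w) = 0
  · have hs := ne_zero_of_delta hq hd
    have h0 := eq_XInf hs hd
    have h1 := h.linear hs h0
    have h2 := h'.linear hs (hX ▸ h0)
    have h3 := h.linear_ne_zero hq hs h0
    have hx : x = x' := mul_right_cancel₀ h3 (h1.trans h2.symm)
    refine ⟨hx, ?_⟩
    unfold X at hX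
    subst hx
    exact mul_left_cancel₀ (mul_ne_zero two_ne_zero hs) (add_right_cancel hX)
  · have h1 := mul_delta_x (q := q) x w
    have h2 := mul_delta_x (q := q) x' w'
    have h3 := mul_delta_w (q := q) x w
    have h4 := mul_delta_w (q := q) x' w'
    rw [← hX, ← hY] at h2 h4
    exact ⟨mul_right_cancel₀ hd (h1.trans h2.symm), mul_right_cancel₀ hd (h3.trans h4.symm)⟩

/-- Modulo the equation of the quartic, the partial derivatives of the cubic at the image are
combinations of those of the quartic. -/
theorem OnCurve.smooth_of_nonsingular {x w : ℂ} (h : q.OnCurve x w)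
    (hn : q.W.toAffine.Nonsingular (q.X x w) (q.Y x w)) : q.Smooth x w := by
  rw [nonsingular_iff] at hn
  by_contra hc
  unfold Smooth at hc
  push Not at hc
  obtain ⟨h1, h2⟩ := hc
  unfold OnCurve at h
  refine hn.2.elim (fun hx => hx ?_) (fun hy => hy ?_)
  · unfold X
    linear_combination (q.a + 4 * q.s ^ 2 * x) * h2 +
      4 * q.s * (q.c + 2 * q.s * w + 2 * q.a * x) * h1 + 4 * q.s ^ 2 * h
  · unfold Y
    linear_combination 2 * q.a * h1 + 2 * q.s * h2

/-- Inverting the combinations of `smooth_of_nonsingular` costs a factor `delta`. Where `delta`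
vanishes, `2 Y + 2 s d = 0` would contradict `linear_ne_zero`. -/
theorem OnCurve.nonsingular (hq : q.Good) {x w : ℂ} (h : q.OnCurve x w) (hn : q.Smooth x w) :
    q.W.toAffine.Nonsingular (q.X x w) (q.Y x w) := by
  rw [nonsingular_iff]
  refine ⟨h.equation, ?_⟩
  by_contra! hc
  obtain ⟨h1, h2⟩ := hc
  by_cases hd : q.delta (q.X x w) = 0
  · have hs := ne_zero_of_delta hq hd
    have h0 := eq_XInf hs hd
    have h3 := h.linear_ne_zero hq hs h0
    have h4 := Y_of_eq_XInf hs h0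
    exact h3 (by linear_combination 2 * q.s * h2 - 2 * h4)
  · unfold OnCurve at h
    refine hn.elim (fun hn => hn ?_) (fun hn => hn ?_) <;> refine (mul_eq_zero.1 ?_).resolve_right hd
    · unfold delta X at *
      unfold Y at *
      linear_combination q.s * h1 - (4 * q.s ^ 2 * x + q.a) / 2 * h2 - 4 * q.s ^ 3 * h
    · unfold delta X at *
      unfold Y at *
      linear_combination -q.a * h1 + 2 * q.s * (q.c + 2 * q.s * w + 2 * q.a * x) * h2
        + 4 * q.s ^ 2 * q.a * h

/-- If both partial derivatives vanished here, so would both numbers in `finite_of_delta_eq_zero`.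
-/
lemma nonsingular_infty (hq : q.Good) (hs : q.s ≠ 0) :
    q.W.toAffine.Nonsingular q.XInf q.YInf := by
  have hX : 4 * q.s ^ 2 * (q.XInf + q.c) = q.a ^ 2 := by unfold XInf; field_simp; ring
  have hY : 2 * q.s * q.YInf = -q.a * q.XInf - 4 * q.s ^ 2 * q.d := by
    unfold YInf; field_simp; ring
  have hs2 : (4 * q.s ^ 2 : ℂ) ≠ 0 := by simpa using hs
  rw [nonsingular_iff, equation_iff]
  refine ⟨mul_left_cancel₀ hs2 ?_, ?_⟩
  · linear_combination (2 * q.s * q.YInf - q.a * q.XInf) * hY - (q.XInf ^ 2 - 4 * q.s ^ 2 * q.e) * hX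
  · by_contra! h
    obtain ⟨h1, h2⟩ := h
    have h3 : 4 * q.s ^ 2 * q.d + 2 * q.a * q.XInf = 0 := by
      linear_combination 2 * hY - 2 * q.s * h2
    refine (hq.finite_of_delta_eq_zero hs).elim (· h3) (fun h4 => h4 (mul_left_cancel₀ hs2 ?_))
    linear_combination 4 * q.s ^ 2 * h1 - q.a * h3 - 2 * q.XInf * hX

/-- A finite point over `XInf` has `2 s Y = a XInf`, and this differs from `2 s YInf` by the nonzero
coefficient of the linear equation. -/
lemma OnCurve.ne_infty (hq : q.Good) {x w : ℂ} (h : q.OnCurve x w) (hs : q.s ≠ 0)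
    (hX : q.X x w = q.XInf) : q.Y x w ≠ q.YInf := by
  intro hY
  have h1 := Y_of_eq_XInf hs hX
  have h2 : 2 * q.s * q.YInf = -q.a * q.XInf - 4 * q.s ^ 2 * q.d := by
    unfold YInf; field_simp; ring
  exact h.linear_ne_zero hq hs hX (by rw [hY] at h1; linear_combination h2 - h1)

/-- The inverse of the birational map from the quartic to the Weierstrass curve. -/
theorem onCurve_of_delta_ne_zero {X Y : ℂ} (h : q.W.toAffine.Equation X Y) (hd : q.delta X ≠ 0) :
    let x := (2 * q.s * Y - q.a * X) / q.delta X
    let w := (2 * q.s * (X + q.c) * X - q.a * Y) / q.delta X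
    q.OnCurve x w ∧ q.X x w = X ∧ q.Y x w = Y := by
  intro x w
  have hE := (equation_iff X Y).1 h
  have hx : x * q.delta X = 2 * q.s * Y - q.a * X := div_mul_cancel₀ _ hd
  have hw : w * q.delta X = 2 * q.s * (X + q.c) * X - q.a * Y := div_mul_cancel₀ _ hd
  clear_value x w
  have hX : q.X x w = X := by
    refine mul_right_cancel₀ hd ?_
    unfold SquareQuartic.X
    have : q.delta X = 4 * q.s ^ 2 * (X + q.c) - q.a ^ 2 := rfl
    linear_combination 2 * q.s * hw + q.a * hx - X * this
  refine ⟨mul_right_cancel₀ hd ?_, hX, mul_right_cancel₀ hd ?_⟩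
  · have hX' : 2 * q.s * w + q.a * x = X := hX
    rw [hX']
    have h1 : Y = 2 * q.s * x * (X + q.c) + q.a * w := by
      refine mul_right_cancel₀ hd ?_
      have : q.delta X = 4 * q.s ^ 2 * (X + q.c) - q.a ^ 2 := rfl
      linear_combination -q.a * hw - 2 * q.s * (X + q.c) * hx + Y * this
    have : q.delta X = 4 * q.s ^ 2 * (X + q.c) - q.a ^ 2 := rfl
    rw [this]
    rw [h1, ← hX'] at hE
    rw [← hX']
    linear_combination -hE
  · have hX' : 2 * q.s * w + q.a * x = X := hX
    unfold SquareQuartic.Y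
    rw [hX']
    have : q.delta X = 4 * q.s ^ 2 * (X + q.c) - q.a ^ 2 := rfl
    linear_combination q.a * hw + 2 * q.s * (X + q.c) * hx - Y * this

/-- Every nonsingular affine point of the Weierstrass curve comes from a finite point of the
quartic or from the point at infinity with `y ~ s x²`. -/
theorem exists_of_nonsingular (hq : q.Good) {X Y : ℂ} (h : q.W.toAffine.Nonsingular X Y) :
    (∃ x w, q.OnCurve x w ∧ q.Smooth x w ∧ q.X x w = X ∧ q.Y x w = Y) ∨
      (q.s ≠ 0 ∧ X = q.XInf ∧ Y = q.YInf) := by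
  suffices H : (∃ x w, q.OnCurve x w ∧ q.X x w = X ∧ q.Y x w = Y) ∨
      (q.s ≠ 0 ∧ X = q.XInf ∧ Y = q.YInf) by
    refine H.imp_left ?_
    rintro ⟨x, w, h1, rfl, rfl⟩
    exact ⟨x, w, h1, h1.smooth_of_nonsingular h, rfl, rfl⟩
  have hE := (equation_iff X Y).1 h.1
  by_cases hd : q.delta X = 0
  · have hs := ne_zero_of_delta hq hd
    have hX := eq_XInf hs hd
    subst hX
    have hX : 4 * q.s ^ 2 * (q.XInf + q.c) = q.a ^ 2 := by unfold XInf; field_simp; ring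
    have hY : 2 * q.s * q.YInf = -q.a * q.XInf - 4 * q.s ^ 2 * q.d := by
      unfold YInf; field_simp; ring
    -- Over `XInf` the quadratic equation for `Y` splits: one root is `YInf`, the other belongs to
    -- the finite point.
    have h2 : (2 * q.s * Y - q.a * q.XInf) * (2 * q.s * Y - 2 * q.s * q.YInf) = 0 := by
      rw [hY]
      linear_combination 4 * q.s ^ 2 * hE + (q.XInf ^ 2 - 4 * q.s ^ 2 * q.e) * hX
    by_cases h3 : Y = q.YInf
    · exact .inr ⟨hs, rfl, h3⟩
    left
    have h4 : 2 * q.s * Y - 2 * q.s * q.YInf ≠ 0 := by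
      rw [← mul_sub]
      exact mul_ne_zero (mul_ne_zero two_ne_zero hs) (sub_ne_zero.2 h3)
    have h5 := (mul_eq_zero.1 h2).resolve_right h4
    have h6 : 4 * q.s ^ 2 * q.d + 2 * q.a * q.XInf ≠ 0 := by
      intro h6
      apply h4
      rw [hY]
      linear_combination h5 + h6
    -- Here `x` solves the linear equation of `OnCurve.linear`, and `w` is read off from the
    -- definition of `X`.
    obtain ⟨x, hx⟩ : ∃ x, x * (4 * q.s ^ 2 * q.d + 2 * q.a * q.XInf)
      = q.XInf ^ 2 - 4 * q.s ^ 2 * q.e := ⟨_, div_mul_cancel₀ _ h6⟩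
    obtain ⟨w, hw⟩ : ∃ w, 2 * q.s * w = q.XInf - q.a * x :=
      ⟨_, mul_div_cancel₀ _ (mul_ne_zero two_ne_zero hs)⟩
    have hs2 : (4 * q.s ^ 2 : ℂ) ≠ 0 := by simpa using hs
    refine ⟨x, w, mul_left_cancel₀ hs2 ?_, ?_, ?_⟩
    · linear_combination (2 * q.s * w + q.XInf - q.a * x - 4 * q.s ^ 2 * x ^ 2) * hw - hx
        - x ^ 2 * hX
    · unfold SquareQuartic.X
      linear_combination hw
    · refine mul_left_cancel₀ (mul_ne_zero two_ne_zero hs) ?_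
      unfold SquareQuartic.Y
      linear_combination (4 * q.s ^ 2 * x + q.a) * hw + x * hX - h5
  · exact .inl ⟨_, _, onCurve_of_delta_ne_zero h.1 hd⟩

/-- The point of the Weierstrass curve given by a finite point of the quartic (zero if this point
is singular or does not lie on the quartic). -/
def toPoint (q : SquareQuartic) (x w : ℂ) : q.W.toAffine.Point :=
  WeierstrassCurve.Jacobian.Point.toAffine q.W ![q.X x w, q.Y x w, 1]

lemma toPoint_eq {x w : ℂ} (h : q.W.toAffine.Nonsingular (q.X x w) (q.Y x w)) :
    q.toPoint x w = .some _ _ h :=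
  WeierstrassCurve.Jacobian.Point.toAffine_some (W := q.W)
    ((WeierstrassCurve.Jacobian.nonsingular_some ..).2 h)

/-- The quadratic polynomial `s x² + c₁ x + c₀` meets the quartic in two given points and in a
third point, which is the sum of these points up to the sign of `y`. -/
theorem toPoint_add (hq : q.Good) {x₁ w₁ x₂ w₂ x₃ w₃ c₁ c₀ : ℂ} (h₁ : q.OnCurve x₁ w₁)
    (h₂ : q.OnCurve x₂ w₂) (hs₁ : q.Smooth x₁ w₁) (hs₂ : q.Smooth x₂ w₂) (hx : x₁ ≠ x₂)
    (hc₁ : w₁ = -(c₁ * x₁ + c₀)) (hc₂ : w₂ = -(c₁ * x₂ + c₀)) (hK : q.a - 2 * q.s * c₁ ≠ 0)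
    (hx₃ : (q.a - 2 * q.s * c₁) * (x₁ + x₂ + x₃) = -(q.c - c₁ ^ 2 - 2 * q.s * c₀))
    (hw₃ : w₃ = 2 * q.s * x₃ ^ 2 + c₁ * x₃ + c₀) :
    q.OnCurve x₃ w₃ ∧ q.Smooth x₃ w₃ ∧ q.toPoint x₁ w₁ + q.toPoint x₂ w₂ = q.toPoint x₃ w₃ := by
  have hn₁ := h₁.nonsingular hq hs₁
  have hn₂ := h₂.nonsingular hq hs₂
  -- For `w = -(c₁ x + c₀)` the function `X` is `(a - 2 s c₁) x - 2 s c₀`. So `hK` makes the chord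
  -- formula applicable.
  have hX : q.X x₁ w₁ ≠ q.X x₂ w₂ := by
    intro h
    refine mul_ne_zero hK (sub_ne_zero.2 hx) ?_
    unfold X at h
    rw [hc₁, hc₂] at h
    linear_combination h
  have hxd := sub_ne_zero.2 hx
  -- the other two relations between roots and coefficients
  have e2 : (q.a - 2 * q.s * c₁) * (x₁ * x₂ + x₁ * x₃ + x₂ * x₃) = q.d - 2 * c₁ * c₀ := by
    unfold OnCurve at h₁ h₂
    rw [hc₁] at h₁
    rw [hc₂] at h₂
    refine mul_left_cancel₀ hxd ?_
    linear_combination h₁ - h₂ + (x₁ - x₂) * (x₁ + x₂) * hx₃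
  have e3 : (q.a - 2 * q.s * c₁) * (x₁ * x₂ * x₃) = -(q.e - c₀ ^ 2) := by
    unfold OnCurve at h₁
    rw [hc₁] at h₁
    linear_combination -h₁ - x₁ ^ 2 * hx₃ + x₁ * e2
  have h₃ : q.OnCurve x₃ w₃ := by
    unfold OnCurve
    rw [hw₃]
    linear_combination -x₃ ^ 2 * hx₃ + x₃ * e2 - e3
  -- The quotient of the differences of `Y` and `X` is linear in `x₁ + x₂`, which `hx₃` expresses
  -- through the third root.
  have hsl : q.W.toAffine.slope (q.X x₁ w₁) (q.X x₂ w₂) (q.Y x₁ w₁) (q.Y x₂ w₂) =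
      -2 * q.s * x₃ - c₁ := by
    rw [WeierstrassCurve.Affine.slope_of_X_ne hX, div_eq_iff (sub_ne_zero.2 hX)]
    unfold X Y
    rw [hc₁, hc₂]
    linear_combination 2 * q.s * (x₁ - x₂) * hx₃
  have hadd : q.W.toAffine.addX (q.X x₁ w₁) (q.X x₂ w₂) (-2 * q.s * x₃ - c₁) = q.X x₃ w₃ := by
    simp only [WeierstrassCurve.Affine.addX, W]
    unfold X
    rw [hc₁, hc₂, hw₃]
    linear_combination -hx₃
  have hsum := WeierstrassCurve.Affine.Point.add_some (W := q.W.toAffine) (h₁ := hn₁) (h₂ := hn₂)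
    (fun h => hX h.1)
  have hns := WeierstrassCurve.Affine.nonsingular_add hn₁ hn₂ (fun h => hX h.1)
  have hY : q.W.toAffine.addY (q.X x₁ w₁) (q.X x₂ w₂) (q.Y x₁ w₁) (-2 * q.s * x₃ - c₁) =
      q.Y x₃ w₃ := by
    rw [WeierstrassCurve.Affine.addY, WeierstrassCurve.Affine.negAddY, hadd,
      WeierstrassCurve.Affine.negY]
    simp only [W]
    unfold X Y
    rw [hc₁, hw₃]
    linear_combination 2 * q.s * e2 - 2 * q.s * (x₁ + x₃) * hx₃
  simp only [hsl, hadd, hY] at hns hsum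
  exact ⟨h₃, h₃.smooth_of_nonsingular hns, by rw [toPoint_eq hn₁, toPoint_eq hn₂, hsum, toPoint_eq]⟩

end SquareQuartic

/-! ### The addition law on the quartic and points in general position. -/

namespace SquareQuartic

open WeierstrassCurve Filter

variable {q : SquareQuartic}

lemma smooth_of_ne {x w : ℂ} (h : w ≠ q.s * x ^ 2) : q.Smooth x w := .inl (sub_ne_zero.2 h)

theorem toPoint_inj (hq : q.Good) {x w x' w' : ℂ} (h : q.OnCurve x w) (h' : q.OnCurve x' w')
    (hs : q.Smooth x w) (hs' : q.Smooth x' w') (he : q.toPoint x w = q.toPoint x' w') :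
    x = x' ∧ w = w' := by
  rw [toPoint_eq (h.nonsingular hq hs), toPoint_eq (h'.nonsingular hq hs'),
    Affine.Point.some.injEq] at he
  exact h.ext hq h' he.1 he.2

lemma toPoint_ne_zero (hq : q.Good) {x w : ℂ} (h : q.OnCurve x w) (hs : q.Smooth x w) :
    q.toPoint x w ≠ 0 := by
  rw [toPoint_eq (h.nonsingular hq hs)]
  exact Affine.Point.some_ne_zero _

/-- Three points with different `x` satisfy `u + v = w` if and only if a polynomial
`s x² + c₁ x + c₀` takes the values `y` at `u` and `v`, and `-y` at `w`. -/
theorem toPoint_add_iff (hq : q.Good) {x₁ w₁ x₂ w₂ x₃ w₃ : ℂ} (h₁ : q.OnCurve x₁ w₁)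
    (h₂ : q.OnCurve x₂ w₂) (h₃ : q.OnCurve x₃ w₃) (hs₁ : q.Smooth x₁ w₁) (hs₂ : q.Smooth x₂ w₂)
    (hs₃ : q.Smooth x₃ w₃) (h12 : x₁ ≠ x₂) (h13 : x₁ ≠ x₃) (h23 : x₂ ≠ x₃) :
    q.toPoint x₁ w₁ + q.toPoint x₂ w₂ = q.toPoint x₃ w₃ ↔
      (q.s * x₁ ^ 2 - w₁) / ((x₁ - x₂) * (x₁ - x₃)) + (q.s * x₂ ^ 2 - w₂) / ((x₂ - x₁) * (x₂ - x₃))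
        - (q.s * x₃ ^ 2 - w₃) / ((x₃ - x₁) * (x₃ - x₂)) - q.s = 0 := by
  have d12 := sub_ne_zero.2 h12
  have d13 := sub_ne_zero.2 h13
  have d23 := sub_ne_zero.2 h23
  -- The polynomial `s x² + c₁ x + c₀` is to take the values `y₁` and `y₂`. As `y = s x² - w`, this
  -- means `w = -(c₁ x + c₀)` at both points.
  obtain ⟨c₁, hc⟩ : ∃ c₁, c₁ * (x₁ - x₂) = -(w₁ - w₂) := ⟨_, div_mul_cancel₀ _ d12⟩
  obtain ⟨c₀, hc₁⟩ : ∃ c₀, w₁ = -(c₁ * x₁ + c₀) := ⟨-w₁ - c₁ * x₁, by ring⟩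
  have hc₂ : w₂ = -(c₁ * x₂ + c₀) := by linear_combination hc₁ - hc
  -- The three fractions are Lagrange's formula for the leading coefficient of the quadratic with
  -- values `y₁, y₂, -y₃`. It is `s` exactly if the polynomial through the first two values also has
  -- the third.
  have key : (q.s * x₁ ^ 2 - w₁) / ((x₁ - x₂) * (x₁ - x₃))
      + (q.s * x₂ ^ 2 - w₂) / ((x₂ - x₁) * (x₂ - x₃))
        - (q.s * x₃ ^ 2 - w₃) / ((x₃ - x₁) * (x₃ - x₂)) - q.s
      = (w₃ - (2 * q.s * x₃ ^ 2 + c₁ * x₃ + c₀)) / ((x₃ - x₁) * (x₃ - x₂)) := by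
    rw [hc₁, hc₂, ← neg_sub x₁ x₂, ← neg_sub x₁ x₃, ← neg_sub x₂ x₃]
    field_simp
    ring
  rw [key, div_eq_zero_iff, or_iff_left (mul_ne_zero (sub_ne_zero.2 h13.symm)
    (sub_ne_zero.2 h23.symm)), sub_eq_zero]
  constructor
  · intro h
    by_cases hK : q.a - 2 * q.s * c₁ = 0
    -- In this case `X₁ = X₂`. The two points are then equal, or opposite with sum zero, whereas a
    -- finite point is not zero.
    · exfalso
      have hX : q.X x₁ w₁ = q.X x₂ w₂ := by
        unfold X
        rw [hc₁, hc₂]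
        linear_combination (x₁ - x₂) * hK
      have n₁ := h₁.nonsingular hq hs₁
      have n₂ := h₂.nonsingular hq hs₂
      rcases Affine.Y_eq_of_X_eq n₁.1 n₂.1 hX with hY | hY
      · exact h12 (h₁.ext hq h₂ hX hY).1
      · rw [toPoint_eq n₁, toPoint_eq n₂, Affine.Point.add_of_Y_eq hX hY] at h
        exact toPoint_ne_zero hq h₃ hs₃ h.symm
    · obtain ⟨x, hx⟩ : ∃ x, (q.a - 2 * q.s * c₁) * x = -(q.c - c₁ ^ 2 - 2 * q.s * c₀)
        - (q.a - 2 * q.s * c₁) * (x₁ + x₂) := ⟨_, mul_div_cancel₀ _ hK⟩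
      obtain ⟨e1, e2, e3⟩ := toPoint_add hq (x₃ := x) h₁ h₂ hs₁ hs₂ h12 hc₁ hc₂ hK
        (by linear_combination hx) rfl
      rw [e3] at h
      obtain ⟨rfl, hw⟩ := toPoint_inj hq e1 h₃ e2 hs₃ h
      exact hw.symm
  · intro hw
    -- The quartic minus `(s x² + c₁ x + c₀)²` has degree at most three and vanishes at the three
    -- `xᵢ`. Its divided differences give two of Vieta's relations.
    have hK3 : (q.a - 2 * q.s * c₁) * (x₁ + x₂ + x₃) = -(q.c - c₁ ^ 2 - 2 * q.s * c₀) ∧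
        (q.a - 2 * q.s * c₁) * (x₁ * x₂ + x₁ * x₃ + x₂ * x₃) = q.d - 2 * c₁ * c₀ := by
      have h12' : (q.a - 2 * q.s * c₁) * (x₁ ^ 2 + x₁ * x₂ + x₂ ^ 2)
          + (q.c - c₁ ^ 2 - 2 * q.s * c₀) * (x₁ + x₂) + (q.d - 2 * c₁ * c₀) = 0 := by
        refine mul_left_cancel₀ d12 ?_
        unfold OnCurve at h₁ h₂
        rw [hc₁] at h₁
        rw [hc₂] at h₂
        linear_combination h₂ - h₁
      have h13' : (q.a - 2 * q.s * c₁) * (x₁ ^ 2 + x₁ * x₃ + x₃ ^ 2)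
          + (q.c - c₁ ^ 2 - 2 * q.s * c₀) * (x₁ + x₃) + (q.d - 2 * c₁ * c₀) = 0 := by
        refine mul_left_cancel₀ d13 ?_
        unfold OnCurve at h₁ h₃
        rw [hc₁] at h₁
        rw [hw] at h₃
        linear_combination h₃ - h₁
      have h1 : (q.a - 2 * q.s * c₁) * (x₁ + x₂ + x₃) = -(q.c - c₁ ^ 2 - 2 * q.s * c₀) := by
        refine mul_left_cancel₀ d23 ?_
        linear_combination h12' - h13'
      exact ⟨h1, by linear_combination (x₁ + x₂) * h1 - h12'⟩
    -- Otherwise this difference would have degree at most two and three zeros, and the quartic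
    -- would be a square.
    have hK : q.a - 2 * q.s * c₁ ≠ 0 := by
      intro hK
      obtain ⟨h1, h2⟩ := hK3
      rw [hK, zero_mul] at h1 h2
      refine hq.irred ⟨c₀, c₁, q.s, fun x => ?_⟩
      unfold OnCurve at h₁
      rw [hc₁] at h₁
      unfold eval
      linear_combination (x ^ 3 - x₁ ^ 3) * hK + (x ^ 2 - x₁ ^ 2) * h1 + (x₁ - x) * h2 - h₁
    exact (toPoint_add hq h₁ h₂ hs₁ hs₂ h12 hc₁ hc₂ hK hK3.1 hw).2.2

/-- The point of the Weierstrass curve corresponding to the point at infinity with `y ~ s x²`. -/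
def inftyPoint (q : SquareQuartic) : q.W.toAffine.Point :=
  open Classical in
  if q.s = 0 then 0 else Jacobian.Point.toAffine q.W ![q.XInf, q.YInf, 1]

lemma inftyPoint_eq (hq : q.Good) (hs : q.s ≠ 0) :
    q.inftyPoint = .some _ _ (nonsingular_infty hq hs) := by
  rw [inftyPoint, if_neg hs]
  exact Jacobian.Point.toAffine_some (W := q.W)
    ((Jacobian.nonsingular_some ..).2 (nonsingular_infty hq hs))

/-- This is the involution `y ↦ -y`. -/
lemma OnCurve.conj {x w : ℂ} (h : q.OnCurve x w) : q.OnCurve x (2 * q.s * x ^ 2 - w) := by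
  unfold OnCurve at *
  linear_combination h

/-- The coordinate function minus its value at the point has zeros at the two conjugate points and
poles at the two points at infinity. So the sum is the second point at infinity, which is the zero
if `s = 0`. -/
theorem toPoint_add_conj (hq : q.Good) {x w : ℂ} (h : q.OnCurve x w) (hy : w ≠ q.s * x ^ 2) :
    q.toPoint x w + q.toPoint x (2 * q.s * x ^ 2 - w) = q.inftyPoint := by
  have hn₁ := h.nonsingular hq (smooth_of_ne hy)
  have hn₂ := h.conj.nonsingular hq (smooth_of_ne fun h' => hy (by linear_combination -h'))
  rw [toPoint_eq hn₁, toPoint_eq hn₂]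
  by_cases hs : q.s = 0
  · rw [inftyPoint, if_pos hs, Affine.Point.add_of_Y_eq]
    · simp [X, hs]
    · simp [X, Y, hs, Affine.negY, W]
  have hX : q.X x w ≠ q.X x (2 * q.s * x ^ 2 - w) := by
    intro h'
    unfold X at h'
    exact hy (mul_left_cancel₀ (mul_ne_zero (by norm_num : (4 : ℂ) ≠ 0) hs) (by linear_combination h'))
  have hsl : q.W.toAffine.slope (q.X x w) (q.X x (2 * q.s * x ^ 2 - w)) (q.Y x w)
      (q.Y x (2 * q.s * x ^ 2 - w)) = 2 * q.s * x + q.a / (2 * q.s) := by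
    rw [Affine.slope_of_X_ne hX, div_eq_iff (sub_ne_zero.2 hX)]
    unfold X Y
    field_simp
    ring
  have hadd : q.W.toAffine.addX (q.X x w) (q.X x (2 * q.s * x ^ 2 - w))
      (2 * q.s * x + q.a / (2 * q.s)) = q.XInf := by
    simp only [Affine.addX, W]
    unfold SquareQuartic.X XInf
    field_simp
    ring
  have hY : q.W.toAffine.addY (q.X x w) (q.X x (2 * q.s * x ^ 2 - w)) (q.Y x w)
      (2 * q.s * x + q.a / (2 * q.s)) = q.YInf := by
    rw [Affine.addY, Affine.negAddY, hadd, Affine.negY]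
    simp only [W]
    unfold SquareQuartic.X SquareQuartic.Y YInf XInf
    field_simp
    ring
  rw [inftyPoint_eq hq hs, Affine.Point.add_of_X_ne hX, Affine.Point.some.injEq, hsl]
  exact ⟨hadd, hY⟩

lemma finite_onCurve (x : ℂ) : {w | q.OnCurve x w}.Finite := by
  by_cases h : ∃ w₀, q.OnCurve x w₀
  · obtain ⟨w₀, h₀⟩ := h
    refine (Set.toFinite {w₀, 2 * q.s * x ^ 2 - w₀}).subset fun w (hw : q.OnCurve x w) => ?_
    have : (w - w₀) * (w - (2 * q.s * x ^ 2 - w₀)) = 0 := by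
      unfold OnCurve at *
      linear_combination hw - h₀
    simpa [sub_eq_zero] using this
  · push Not at h
    convert Set.finite_empty
    ext w
    simpa using h w

lemma finite_X_eq (x : ℂ) :
    {P : q.W.toAffine.Point | ∃ y h, P = .some x y h}.Finite := by
  by_cases h : ∃ y, q.W.toAffine.Nonsingular x y
  · obtain ⟨y, hy⟩ := h
    refine (Set.toFinite {.some x y hy, -.some x y hy}).subset ?_
    rintro _ ⟨y', hy', rfl⟩
    rw [Affine.Point.neg_some]
    rcases Affine.Y_eq_of_X_eq hy'.1 hy.1 rfl with rfl | rfl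
    · exact .inl rfl
    · exact .inr rfl
  · push Not at h
    convert Set.finite_empty
    ext P
    simp only [Set.mem_ofPred_eq, Set.mem_empty_iff_false, iff_false]
    rintro ⟨y, hy, -⟩
    exact h y hy

open Polynomial in
-- A nonzero point equal to its negative has `Y = -s d`. Completing the square in the Weierstrass
-- equation makes its `X` a root of the cubic `p`.
lemma finite_twoTorsion : {P : q.W.toAffine.Point | P + P = 0}.Finite := by
  set p : ℂ[X] := Polynomial.X ^ 3 + (C q.c * Polynomial.X ^ 2 + C (q.a * q.d - 4 * q.s ^ 2 * q.e) * Polynomial.X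
    + C (q.e * (q.a ^ 2 - 4 * q.s ^ 2 * q.c) + q.s ^ 2 * q.d ^ 2)) with hp
  have hp0 : p ≠ 0 := by
    refine (monic_X_pow_add ?_).ne_zero
    compute_degree
    norm_num
  refine ((Set.finite_singleton 0).union
    ((p.rootSet_finite ℂ).biUnion fun x _ => finite_X_eq x)).subset ?_
  rintro (_ | ⟨x, y, h⟩) hP
  · exact .inl rfl
  · right
    simp only [Set.mem_iUnion]
    refine ⟨x, ?_, y, h, rfl⟩
    rw [mem_rootSet]
    refine ⟨hp0, ?_⟩
    have hP' : Affine.Point.some x y h = -Affine.Point.some x y h := eq_neg_of_add_eq_zero_left hP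
    rw [Affine.Point.neg_some, Affine.Point.some.injEq] at hP'
    have hy : y = -y - 2 * q.s * q.d := by simpa [Affine.negY, W] using hP'.2
    have he := (equation_iff x y).1 h.1
    simp [hp]
    linear_combination -he + (y + q.s * q.d) / 2 * hy

/-- The solutions are empty or a coset of the 2-torsion. -/
lemma finite_double_eq (R : q.W.toAffine.Point) : {P : q.W.toAffine.Point | P + P = R}.Finite := by
  by_cases h : ∃ P₀ : q.W.toAffine.Point, P₀ + P₀ = R
  · obtain ⟨P₀, rfl⟩ := h
    refine (finite_twoTorsion.preimage (sub_left_injective (b := P₀)).injOn).subset fun P hP => ?_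
    have hP' : P + P = P₀ + P₀ := hP
    change P - P₀ + (P - P₀) = 0
    rw [sub_add_sub_comm, hP', sub_self]
  · push Not at h
    convert Set.finite_empty
    ext P
    simpa using h P

lemma finite_eval_eq_zero (hq : q.Good) : {x | q.eval x = 0}.Finite := by
  open Polynomial in
  set p : ℂ[X] := C (q.s ^ 2) * Polynomial.X ^ 4 + C q.a * Polynomial.X ^ 3
    + C q.c * Polynomial.X ^ 2 + C q.d * Polynomial.X + C q.e with hp
  have hpe : ∀ x, p.eval x = q.eval x := fun x => by simp [hp, SquareQuartic.eval]
  -- The zero polynomial is the square of zero.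
  have hp0 : p ≠ 0 := by
    intro h0
    refine hq.irred ⟨0, 0, 0, fun x => ?_⟩
    rw [← hpe, h0]
    simp
  refine (p.rootSet_finite ℂ).subset fun x hx => ?_
  rw [Polynomial.mem_rootSet]
  exact ⟨hp0, by simpa [hpe] using hx⟩

lemma onCurve_iff {x w : ℂ} : q.OnCurve x w ↔ (q.s * x ^ 2 - w) ^ 2 = q.eval x := by
  unfold OnCurve eval
  constructor <;> intro h <;> linear_combination h

/-- A point of the Weierstrass curve which comes from a finite point of the quartic in general
position: with `y ≠ 0`, with `x` outside of `E`, and at which the birational map to the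
Weierstrass curve can be inverted. -/
structure IsNice (q : SquareQuartic) (E : Set ℂ) (x w : ℂ) : Prop where
  onCurve : q.OnCurve x w
  ne : w ≠ q.s * x ^ 2
  delta : q.delta (q.X x w) ≠ 0
  notMem : x ∉ E

lemma IsNice.smooth {E : Set ℂ} {x w : ℂ} (h : q.IsNice E x w) : q.Smooth x w := smooth_of_ne h.ne

/-- Excluded are zero, the points over `E` and over the zeros of the quartic, and the points with `X
= XInf`. Each of these sets is finite. -/
theorem eventually_isNice (hq : q.Good) {E : Set ℂ} (hE : E.Finite) :
    ∀ᶠ P : q.W.toAffine.Point in cofinite, ∃ x w, q.IsNice E x w ∧ q.toPoint x w = P := by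
  have hE' : (E ∪ {x | q.eval x = 0}).Finite := hE.union (finite_eval_eq_zero hq)
  have h1 : {P : q.W.toAffine.Point | ∃ x ∈ E ∪ {x | q.eval x = 0}, ∃ w, q.OnCurve x w ∧
      q.toPoint x w = P}.Finite := by
    refine (hE'.biUnion fun x _ => (finite_onCurve (q := q) x).image (q.toPoint x)).subset ?_
    rintro _ ⟨x, hx, w, hw, rfl⟩
    exact Set.mem_biUnion hx ⟨w, hw, rfl⟩
  filter_upwards [h1.compl_mem_cofinite, (finite_X_eq q.XInf).compl_mem_cofinite,
    (Set.finite_singleton (0 : q.W.toAffine.Point)).compl_mem_cofinite] with P hP1 hP2 hP3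
  rcases P with _ | ⟨X, Y, h⟩
  · exact (hP3 rfl).elim
  rcases exists_of_nonsingular hq h with ⟨x, w, hc, hs, rfl, rfl⟩ | ⟨_, rfl, rfl⟩
  · have he : q.toPoint x w = .some _ _ h := toPoint_eq h
    have hx : x ∉ E ∪ {x | q.eval x = 0} := fun hx => hP1 ⟨x, hx, w, hc, he⟩
    refine ⟨x, w, ⟨hc, ?_, fun hd => ?_, fun hx' => hx (.inl hx')⟩, he⟩
    · rintro rfl
      refine hx (.inr ?_)
      rw [Set.mem_ofPred_eq, ← onCurve_iff.1 hc]
      ring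
    · have h0 := eq_XInf (ne_zero_of_delta hq hd) hd
      refine hP2 ?_
      rw [Set.mem_ofPred_eq]
      simp only [h0] at h ⊢
      exact ⟨_, h, rfl⟩
  · exact (hP2 ⟨_, h, rfl⟩).elim

/-- This makes the cofinite filter nontrivial, so that conditions excluding finitely many points can
be satisfied together. -/
theorem infinite_point (hq : q.Good) : Infinite q.W.toAffine.Point := by
  have h0 : {x | q.eval x ≠ 0}.Infinite := (finite_eval_eq_zero hq).infinite_compl
  have := h0.to_subtype
  have hw : ∀ x : {x | q.eval x ≠ 0}, ∃ w, q.OnCurve x w := fun x => by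
    obtain ⟨y, hy⟩ := IsAlgClosed.exists_pow_nat_eq (q.eval x) two_pos
    refine ⟨q.s * x ^ 2 - y, onCurve_iff.2 ?_⟩
    rw [← hy]
    ring
  choose w hw using hw
  have hs : ∀ x : {x | q.eval x ≠ 0}, q.Smooth x (w x) := fun x => smooth_of_ne fun h => x.2 <| by
    rw [← onCurve_iff.1 (hw x), h]
    ring
  exact Infinite.of_injective (fun x : {x | q.eval x ≠ 0} => q.toPoint x (w x)) fun x x' h =>
    Subtype.ext (toPoint_inj hq (hw x) (hw x') (hs x) (hs x') h).1

/-- Almost all points are in general position with respect to a given point. -/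
theorem eventually_generic (hq : q.Good) {E : Set ℂ} (hE : E.Finite) {x₁ w₁ : ℂ}
    (h₁ : q.OnCurve x₁ w₁) (hs₁ : q.Smooth x₁ w₁) :
    ∀ᶠ P : q.W.toAffine.Point in cofinite, ∃ x₂ w₂ x₃ w₃, q.IsNice E x₂ w₂ ∧ q.IsNice E x₃ w₃ ∧
      q.toPoint x₂ w₂ = P ∧ q.toPoint x₃ w₃ = q.toPoint x₁ w₁ + P ∧
      x₁ ≠ x₂ ∧ x₁ ≠ x₃ ∧ x₂ ≠ x₃ := by
  have hE' : (E ∪ {x₁}).Finite := hE.union (Set.finite_singleton _)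
  have hn := eventually_isNice hq hE'
  filter_upwards [hn, (add_right_injective (q.toPoint x₁ w₁)).tendsto_cofinite.eventually hn,
    (finite_double_eq (q.inftyPoint - q.toPoint x₁ w₁)).compl_mem_cofinite]
  rintro _ ⟨x₂, w₂, h₂, rfl⟩ ⟨x₃, w₃, h₃, h⟩ hd
  refine ⟨x₂, w₂, x₃, w₃, ⟨h₂.1, h₂.2, h₂.3, fun h => h₂.4 (.inl h)⟩,
    ⟨h₃.1, h₃.2, h₃.3, fun h => h₃.4 (.inl h)⟩, rfl, h, fun h => h₂.4 (.inr h.symm),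
    fun h => h₃.4 (.inr h.symm), ?_⟩
  rintro rfl
  have hw : (w₃ - w₂) * (w₃ - (2 * q.s * x₂ ^ 2 - w₂)) = 0 := by
    have e1 := h₂.1
    have e2 := h₃.1
    unfold OnCurve at *
    linear_combination e2 - e1
  -- If the second and third point have the same `x`, they are equal, and the first point would be
  -- zero, or conjugate, and twice `P` would be the value excluded by `hd`.
  rcases mul_eq_zero.1 hw with hw | hw
  · rw [sub_eq_zero.1 hw, right_eq_add] at h
    exact toPoint_ne_zero hq h₁ hs₁ h
  · rw [sub_eq_zero.1 hw] at h
    apply hd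
    rw [Set.mem_ofPred_eq, ← toPoint_add_conj hq h₂.1 h₂.2, h]
    abel

end SquareQuartic

/-! ### The standard symplectic form on `ℂ²` -/

/-- The form `dx ∧ dp` on `ℂ²`. -/
def stdForm : ℂ × ℂ →L[ℂ] ℂ × ℂ →L[ℂ] ℂ :=
  (ContinuousLinearMap.mul ℂ ℂ).bilinearComp (ContinuousLinearMap.fst ℂ ℂ ℂ)
      (ContinuousLinearMap.snd ℂ ℂ ℂ)
    - (ContinuousLinearMap.mul ℂ ℂ).bilinearComp (ContinuousLinearMap.snd ℂ ℂ ℂ)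
      (ContinuousLinearMap.fst ℂ ℂ ℂ)

@[simp]
lemma stdForm_apply (u w : ℂ × ℂ) : stdForm u w = u.1 * w.2 - u.2 * w.1 := by
  simp [stdForm]

lemma stdForm_self (u : ℂ × ℂ) : stdForm u u = 0 := by
  rw [stdForm_apply]
  ring

lemma stdForm_nondegenerate (u : ℂ × ℂ) (h : ∀ w, stdForm u w = 0) : u = 0 := by
  refine Prod.ext ?_ ?_
  · simpa using h (0, 1)
  · simpa using h (1, 0)

/-- A linear map preserving the standard form. -/
def IsSymp (L : ℂ × ℂ →L[ℂ] ℂ × ℂ) : Prop := ∀ u w, stdForm (L u) (L w) = stdForm u w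

lemma IsSymp.id : IsSymp (ContinuousLinearMap.id ℂ (ℂ × ℂ)) := fun _ _ => rfl

lemma IsSymp.comp {L L' : ℂ × ℂ →L[ℂ] ℂ × ℂ} (h : IsSymp L) (h' : IsSymp L') :
    IsSymp (L.comp L') := fun u w => (h _ _).trans (h' u w)

lemma IsSymp.injective {L : ℂ × ℂ →L[ℂ] ℂ × ℂ} (h : IsSymp L) : Function.Injective L := by
  refine (injective_iff_map_eq_zero L).2 fun u hu => ?_
  exact stdForm_nondegenerate u fun w => by rw [← h u w, hu, map_zero, zero_apply]

lemma IsSymp.surjective {L : ℂ × ℂ →L[ℂ] ℂ × ℂ} (h : IsSymp L) : Function.Surjective L :=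
  (LinearMap.injective_iff_surjective (f := (L : ℂ × ℂ →ₗ[ℂ] ℂ × ℂ))).1 h.injective

/-- A symplectic linear map as a linear equivalence. -/
def IsSymp.equiv {L : ℂ × ℂ →L[ℂ] ℂ × ℂ} (h : IsSymp L) : (ℂ × ℂ) ≃L[ℂ] ℂ × ℂ :=
  ContinuousLinearEquiv.ofBijective L (LinearMap.ker_eq_bot.2 h.injective)
    (LinearMap.range_eq_top.2 h.surjective)

lemma IsSymp.coe_equiv {L : ℂ × ℂ →L[ℂ] ℂ × ℂ} (h : IsSymp L) : (h.equiv : ℂ × ℂ →L[ℂ] ℂ × ℂ) = L :=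
  ContinuousLinearMap.ext fun _ => rfl

lemma IsSymp.symm {L : ℂ × ℂ →L[ℂ] ℂ × ℂ} (h : IsSymp L) :
    IsSymp (h.equiv.symm : ℂ × ℂ →L[ℂ] ℂ × ℂ) := by
  intro u w
  have h1 := h (h.equiv.symm u) (h.equiv.symm w)
  have h2 : ∀ u, L (h.equiv.symm u) = u := fun u => h.equiv.apply_symm_apply u
  rw [h2, h2] at h1
  exact h1.symm

/-- A map whose derivative at `z` preserves the standard form. -/
def HasSympDerivAt (g : ℂ × ℂ → ℂ × ℂ) (z : ℂ × ℂ) : Prop := ∃ L, HasFDerivAt g L z ∧ IsSymp L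

lemma HasSympDerivAt.comp {g h : ℂ × ℂ → ℂ × ℂ} {z : ℂ × ℂ} (hg : HasSympDerivAt g (h z))
    (hh : HasSympDerivAt h z) : HasSympDerivAt (fun z => g (h z)) z := by
  obtain ⟨L, h1, h2⟩ := hg
  obtain ⟨L', h1', h2'⟩ := hh
  exact ⟨_, HasFDerivAt.comp z h1 h1', h2.comp h2'⟩

lemma hasSympDerivAt_prodMk {g₁ g₂ : ℂ × ℂ → ℂ} {L₁ L₂ : ℂ × ℂ →L[ℂ] ℂ} {z : ℂ × ℂ}
    (h₁ : HasFDerivAt g₁ L₁ z) (h₂ : HasFDerivAt g₂ L₂ z)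
    (h : ∀ u w, L₁ u * L₂ w - L₂ u * L₁ w = u.1 * w.2 - u.2 * w.1) :
    HasSympDerivAt (fun z => (g₁ z, g₂ z)) z :=
  ⟨_, h₁.prodMk h₂, fun u w => by simpa using h u w⟩

namespace FourPointData

open Filter Topology

variable {D : FourPointData}

/-! ### The charts as open partial homeomorphisms -/

/-- The chart as an open partial homeomorphism. -/
def homeo (i : D.ChartIndex) : OpenPartialHomeomorph (HitchinSurface D) (ℂ × ℂ) :=
  core.openPartialHomeomorph (chart i) ⟨i, rfl⟩

lemma chartSource_chartIndexAt (m : HitchinSurface D) : chartSource (chartIndexAt m) m :=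
  mem_chart_source (ℂ × ℂ) m

lemma chartMap_mem {i : D.ChartIndex} {m : HitchinSurface D} (h : chartSource i m) :
    chartMap i m ∈ chartTarget i := (chart i).map_source h

lemma chartInv_chartMap {i : D.ChartIndex} {m : HitchinSurface D} (h : chartSource i m) :
    chartInv i (chartMap i m) = m := (chart i).left_inv h

lemma chartMap_chartInv {i : D.ChartIndex} {z : ℂ × ℂ} (h : z ∈ chartTarget i) :
    chartMap i (chartInv i z) = z := (chart i).right_inv h

lemma chartSource_chartInv {i : D.ChartIndex} {z : ℂ × ℂ} (h : z ∈ chartTarget i) :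
    chartSource i (chartInv i z) := (chart i).map_target h

lemma isOpen_chartSource (i : D.ChartIndex) : IsOpen {m : HitchinSurface D | chartSource i m} :=
  (homeo i).open_source

lemma continuousAt_chartMap {i : D.ChartIndex} {m : HitchinSurface D} (h : chartSource i m) :
    ContinuousAt (chartMap i) m := (homeo i).continuousAt h

lemma continuousAt_chartInv {i : D.ChartIndex} {z : ℂ × ℂ} (h : z ∈ chartTarget i) :
    ContinuousAt (chartInv i) z := (homeo i).symm.continuousAt h

lemma continuousAt_iff_chart {Y : Type*} [TopologicalSpace Y] {F : HitchinSurface D → Y}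
    {i : D.ChartIndex} {m : HitchinSurface D} (h : chartSource i m) :
    ContinuousAt F m ↔ ContinuousAt (F ∘ chartInv i) (chartMap i m) := by
  refine ⟨fun hF => ?_, fun hF => ?_⟩
  · refine ContinuousAt.comp ?_ (continuousAt_chartInv (chartMap_mem h))
    rwa [chartInv_chartMap h]
  · refine (hF.comp (continuousAt_chartMap h)).congr ?_
    filter_upwards [(isOpen_chartSource i).mem_nhds h] with m' hm'
    simp [chartInv_chartMap hm']

/-- An added point lies in a single chart. So a chart differs from the preferred one only at
interior points. -/
lemma chartIndexAt_eq_or {i : D.ChartIndex} {m : HitchinSurface D} (h : chartSource i m) :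
    chartIndexAt m = i ∨ ∃ z hz, m = .interior z hz := by
  rcases m with ⟨z, hz⟩ | ⟨a, v, b, hv, hs⟩
  · exact .inr ⟨z, hz, rfl⟩
  · left
    cases i with
    | main => exact h.elim
    | pole a' v' hv' hv0 =>
      obtain ⟨rfl, rfl⟩ := h
      simp [chartIndexAt, hv0]
    | branch a' hκ =>
      obtain rfl : a = a' := h
      obtain rfl : v = 0 := by simpa [hκ] using hv
      simp [chartIndexAt]

/-! ### Smoothness of the transition maps -/

lemma contDiffAt_ofLocal {n : ℕ∞ω} {a : Puncture} {z : ℂ × ℂ} (hz : z.1 ≠ 0) :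
    ContDiffAt ℂ n (D.ofLocal a) z := by
  cases a
  · exact contDiffAt_id
  · exact (by fun_prop : ContDiffAt ℂ n (fun z : ℂ × ℂ => (1 + z.1, z.2)) z)
  · exact (by fun_prop : ContDiffAt ℂ n (fun z : ℂ × ℂ => (D.t + z.1, z.2)) z)
  · exact (by fun_prop (disch := assumption) :
      ContDiffAt ℂ n (fun z : ℂ × ℂ => (z.1⁻¹, -z.1 ^ 2 * z.2)) z)

lemma contDiffAt_toLocal {n : ℕ∞ω} {a : Puncture} {z : ℂ × ℂ} (hz : z ∈ D.base) :
    ContDiffAt ℂ n (D.toLocal a) z := by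
  have h0 := hz.1
  cases a
  · exact contDiffAt_id
  · exact (by fun_prop : ContDiffAt ℂ n (fun z : ℂ × ℂ => (z.1 - 1, z.2)) z)
  · exact (by fun_prop : ContDiffAt ℂ n (fun z : ℂ × ℂ => (z.1 - D.t, z.2)) z)
  · exact (by fun_prop (disch := assumption) :
      ContDiffAt ℂ n (fun z : ℂ × ℂ => (z.1⁻¹, -z.1 ^ 2 * z.2)) z)

lemma contDiffAt_innerInv {n : ℕ∞ω} {i : D.ChartIndex} {z : ℂ × ℂ} (hz : z ∈ innerTarget i) :
    ContDiffAt ℂ n (innerInv i) z := by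
  cases i with
  | main => exact contDiffAt_id
  | pole a v hv hv0 =>
    have h0 := hz.1
    exact (contDiffAt_ofLocal (z := (z.1, v / z.1 + z.2)) h0).comp z
      (f := fun z : ℂ × ℂ => (z.1, v / z.1 + z.2)) (by fun_prop (disch := assumption))
  | branch a hκ =>
    have h0 := hz.1
    exact (contDiffAt_ofLocal (z := (z.2 * z.1 ^ 2, z.1⁻¹))
      (mul_ne_zero hz.2.1 (pow_ne_zero _ h0))).comp z
      (f := fun z : ℂ × ℂ => (z.2 * z.1 ^ 2, z.1⁻¹)) (by fun_prop (disch := assumption))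

lemma contDiffAt_innerMap {n : ℕ∞ω} {i : D.ChartIndex} {z : ℂ × ℂ} (hz : z ∈ innerSource i) :
    ContDiffAt ℂ n (innerMap i) z := by
  have hl := fun a => contDiffAt_toLocal (n := n) (a := a) (innerSource_subset i hz)
  cases i with
  | main => exact contDiffAt_id
  | pole a v hv hv0 =>
    have h0 : (D.toLocal a z).1 ≠ 0 := (D.toLocal_mem hz).1
    have := hl a
    exact (by fun_prop (disch := assumption) : ContDiffAt ℂ n
      (fun z => ((D.toLocal a z).1, (D.toLocal a z).2 - v / (D.toLocal a z).1)) z)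
  | branch a hκ =>
    have h0 : (D.toLocal a z).2 ≠ 0 := hz.2
    have := hl a
    exact (by fun_prop (disch := assumption) : ContDiffAt ℂ n
      (fun z => ((D.toLocal a z).2⁻¹, (D.toLocal a z).1 * (D.toLocal a z).2 ^ 2)) z)

/-- A change of coordinate on the base lifts to a symplectic map of the cotangent bundle. -/
lemma hasSympDerivAt_ofLocal {a : Puncture} {z : ℂ × ℂ} (hz : z.1 ≠ 0) :
    HasSympDerivAt (D.ofLocal a) z := by
  have h1 : HasFDerivAt (fun z : ℂ × ℂ => z.1) (ContinuousLinearMap.fst ℂ ℂ ℂ) z := hasFDerivAt_fst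
  have h2 : HasFDerivAt (fun z : ℂ × ℂ => z.2) (ContinuousLinearMap.snd ℂ ℂ ℂ) z := hasFDerivAt_snd
  cases a
  · exact ⟨_, hasFDerivAt_id z, IsSymp.id⟩
  · exact hasSympDerivAt_prodMk (h1.const_add 1) h2 (by simp)
  · exact hasSympDerivAt_prodMk (h1.const_add D.t) h2 (by simp)
  · refine hasSympDerivAt_prodMk ((hasDerivAt_inv hz).comp_hasFDerivAt z h1)
      ((h1.pow 2).neg.mul h2) fun u w => ?_
    simp
    field_simp
    ring

/-- All charts are Darboux charts: adding `v / ξ` to `q` is a shear, and `ξ = A r²`, `η = 1 / r`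
give `dξ ∧ dη = dr ∧ dA`. -/
lemma hasSympDerivAt_innerInv {i : D.ChartIndex} {z : ℂ × ℂ} (hz : z ∈ innerTarget i) :
    HasSympDerivAt (innerInv i) z := by
  have h1 : HasFDerivAt (fun z : ℂ × ℂ => z.1) (ContinuousLinearMap.fst ℂ ℂ ℂ) z := hasFDerivAt_fst
  have h2 : HasFDerivAt (fun z : ℂ × ℂ => z.2) (ContinuousLinearMap.snd ℂ ℂ ℂ) z := hasFDerivAt_snd
  cases i with
  | main => exact ⟨_, hasFDerivAt_id z, IsSymp.id⟩
  | pole a v hv hv0 =>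
    have h0 := hz.1
    refine HasSympDerivAt.comp (h := fun z : ℂ × ℂ => (z.1, v / z.1 + z.2))
      (hasSympDerivAt_ofLocal h0) ?_
    simp only [div_eq_mul_inv]
    refine hasSympDerivAt_prodMk h1
      ((((hasDerivAt_inv h0).comp_hasFDerivAt z h1).const_mul v).add h2) fun u w => ?_
    simp
    ring
  | branch a hκ =>
    have h0 := hz.1
    refine HasSympDerivAt.comp (h := fun z : ℂ × ℂ => (z.2 * z.1 ^ 2, z.1⁻¹))
      (hasSympDerivAt_ofLocal (mul_ne_zero hz.2.1 (pow_ne_zero _ h0))) ?_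
    refine hasSympDerivAt_prodMk (h2.mul (h1.pow 2)) ((hasDerivAt_inv h0).comp_hasFDerivAt z h1)
      fun u w => ?_
    simp
    field_simp
    ring

/-- The derivative of a map to the surface can be computed in any chart; it then differs from the
derivative in the sense of manifolds by a symplectic linear map. -/
theorem hasMFDerivAt_of_chart {F : Type*} [NormedAddCommGroup F] [NormedSpace ℂ F]
    {g : F → HitchinSurface D} {v : F} {i : D.ChartIndex} (hs : chartSource i (g v))
    (hc : ContinuousAt g v) : ∃ L, IsSymp L ∧ ∀ g' : F →L[ℂ] ℂ × ℂ,
      HasFDerivAt (fun v => chartMap i (g v)) g' v → HasMFDerivAt 𝓘(ℂ, F) 𝓘(ℂ, ℂ × ℂ) g v (L.comp g') := by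
  have hev : ∀ᶠ v' in 𝓝 v, chartSource i (g v') := hc ((isOpen_chartSource i).mem_nhds hs)
  suffices H : ∃ L, IsSymp L ∧ HasFDerivAt (chartMap (chartIndexAt (g v)) ∘ chartInv i) L
      (chartMap i (g v)) by
    obtain ⟨L, hL, hd⟩ := H
    refine ⟨L, hL, fun g' hg' => ⟨hc, ?_⟩⟩
    have h1 : HasFDerivAt (fun v' => chartMap (chartIndexAt (g v)) (g v')) (L.comp g') v :=
      (HasFDerivAt.comp v hd hg').congr_of_eventuallyEq
        (hev.mono fun v' hv' => by simp [chartInv_chartMap hv'])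
    exact h1.hasFDerivWithinAt
  rcases chartIndexAt_eq_or hs with h | ⟨z, hz, hm⟩
  · refine ⟨_, IsSymp.id, ?_⟩
    rw [h]
    refine (hasFDerivAt_id _).congr_of_eventuallyEq ?_
    filter_upwards [(isOpen_chartTarget i).mem_nhds (chartMap_mem hs)] with z hz
    simp [chartMap_chartInv hz]
  -- At an interior point the preferred chart is the main one, so the transition map is `innerInv
  -- i`.
  · rw [hm] at hs ⊢
    have hz' : z ∈ innerSource i := by simpa [chartSource] using hs
    have hm' : chartMap i (.interior z hz) = innerMap i z := by simp [chartMap]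
    rw [hm']
    obtain ⟨L, h1, h2⟩ := hasSympDerivAt_innerInv (innerMap_mem hz')
    refine ⟨L, h2, h1.congr_of_eventuallyEq ?_⟩
    filter_upwards [(isOpen_innerTarget i).mem_nhds (innerMap_mem hz')] with z hz
    simp [chartInv_inner hz, chartIndexAt, chartMap, innerMap]

lemma hasMFDerivAt_chartInv {i : D.ChartIndex} {z : ℂ × ℂ} (hz : z ∈ chartTarget i) :
    ∃ L, IsSymp L ∧ HasMFDerivAt 𝓘(ℂ, ℂ × ℂ) 𝓘(ℂ, ℂ × ℂ) (chartInv i) z L := by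
  obtain ⟨L, hL, h⟩ := hasMFDerivAt_of_chart (chartSource_chartInv hz) (continuousAt_chartInv hz)
  refine ⟨L, hL, h (ContinuousLinearMap.id ℂ _) ?_⟩
  refine (hasFDerivAt_id _).congr_of_eventuallyEq ?_
  filter_upwards [(isOpen_chartTarget i).mem_nhds hz] with z hz
  simp [chartMap_chartInv hz]

/-- The derivative of a function on the surface, computed in the preferred chart. -/
lemma hasMFDerivAt_function {F : Type*} [NormedAddCommGroup F] [NormedSpace ℂ F]
    {g : HitchinSurface D → F} {m : HitchinSurface D} {L : ℂ × ℂ →L[ℂ] F}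
    (h : HasFDerivAt (fun z => g (chartInv (chartIndexAt m) z)) L (chartMap (chartIndexAt m) m)) :
    HasMFDerivAt 𝓘(ℂ, ℂ × ℂ) 𝓘(ℂ, F) g m L :=
  ⟨(continuousAt_iff_chart (chartSource_chartIndexAt m)).2 h.continuousAt, h.hasFDerivWithinAt⟩

/-! ### The surface is a complex symplectic manifold -/

instance isManifold : IsManifold 𝓘(ℂ, ℂ × ℂ) ω (HitchinSurface D) := by
  have hat : ∀ e ∈ atlas (ℂ × ℂ) (HitchinSurface D), ∃ i, e = homeo i := by
    intro e he
    change e ∈ ⋃ (e) (he : e ∈ core.atlas), {core.openPartialHomeomorph e he} at he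
    simp only [Set.mem_iUnion] at he
    obtain ⟨_, ⟨i, rfl⟩, h⟩ := he
    exact ⟨i, h⟩
  refine isManifold_of_contDiffOn _ _ _ fun e e' he he' => ?_
  obtain ⟨i, rfl⟩ := hat e he
  obtain ⟨j, rfl⟩ := hat e' he'
  rintro z ⟨hz, -⟩
  refine ContDiffAt.contDiffWithinAt ?_
  change ContDiffAt ℂ ω (fun z => chartMap j (chartInv i z)) z
  change z ∈ ((chart i).symm.trans (chart j)).source at hz
  by_cases hij : i = j
  · subst hij
    refine contDiffAt_id.congr_of_eventuallyEq ?_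
    filter_upwards [(isOpen_chartTarget i).mem_nhds hz.1] with z hz
    simp [chartMap_chartInv hz]
  · obtain ⟨h1, h2⟩ := chart_overlap hij hz
    refine (ContDiffAt.comp z (contDiffAt_innerMap h2) (contDiffAt_innerInv h1)).congr_of_eventuallyEq ?_
    filter_upwards [(isOpen_innerTarget i).mem_nhds h1] with z hz
    simp [chartInv_inner hz, chartMap]

/-- The image of a point of the projective line under a stereographic projection. -/
def stereo (x : ℂ) : ℂ × ℝ := (x / (1 + ‖x‖ ^ 2 : ℝ), 1 / (1 + ‖x‖ ^ 2))

/-- The same map in terms of the coordinate at infinity. -/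
def stereoInv (ξ : ℂ) : ℂ × ℝ := (starRingEnd ℂ ξ / (1 + ‖ξ‖ ^ 2 : ℝ), ‖ξ‖ ^ 2 / (1 + ‖ξ‖ ^ 2))

lemma continuous_stereo : Continuous stereo := by
  unfold stereo
  refine (continuous_id.div (by fun_prop) fun x => ?_).prodMk
    (continuous_const.div (by fun_prop) fun x => by positivity)
  exact Complex.ofReal_ne_zero.2 (by positivity)

lemma continuous_stereoInv : Continuous stereoInv := by
  unfold stereoInv
  refine (Complex.continuous_conj.div (by fun_prop) fun x => ?_).prodMk
    (Continuous.div (by fun_prop) (by fun_prop) fun x => by positivity)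
  exact Complex.ofReal_ne_zero.2 (by positivity)

lemma stereo_inv {ξ : ℂ} (h : ξ ≠ 0) : stereo ξ⁻¹ = stereoInv ξ := by
  have h1 : ‖ξ‖ ≠ 0 := norm_ne_zero_iff.2 h
  have h2 : (1 + ‖ξ‖ ^ 2 : ℝ) ≠ 0 := by positivity
  have h3 : (1 + ‖ξ⁻¹‖ ^ 2 : ℝ) = (1 + ‖ξ‖ ^ 2) / ‖ξ‖ ^ 2 := by
    rw [norm_inv]; field_simp; ring
  unfold stereo stereoInv
  rw [h3]
  refine Prod.ext ?_ ?_
  · have h4 : starRingEnd ℂ ξ = (‖ξ‖ ^ 2 : ℝ) / ξ := by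
      rw [eq_div_iff h, ← Complex.normSq_eq_norm_sq, ← Complex.normSq_eq_conj_mul_self]
    have h5 : ((1 + ‖ξ‖ ^ 2 : ℝ) : ℂ) ≠ 0 := Complex.ofReal_ne_zero.2 h2
    have h6 : ((‖ξ‖ ^ 2 : ℝ) : ℂ) ≠ 0 := Complex.ofReal_ne_zero.2 (pow_ne_zero _ h1)
    simp only [h4, Complex.ofReal_div]
    field_simp
  · simp only
    field_simp

lemma stereo_injective : Function.Injective stereo := by
  intro x y h
  have h1 : (1 : ℝ) / (1 + ‖x‖ ^ 2) = 1 / (1 + ‖y‖ ^ 2) := congrArg Prod.snd h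
  have h2 : (1 + ‖x‖ ^ 2 : ℝ) = 1 + ‖y‖ ^ 2 := by
    rwa [one_div, one_div, inv_inj] at h1
  have h3 : x / (1 + ‖x‖ ^ 2 : ℝ) = y / (1 + ‖y‖ ^ 2 : ℝ) := congrArg Prod.fst h
  rw [h2] at h3
  exact (div_left_inj' (Complex.ofReal_ne_zero.2 (by positivity))).1 h3

lemma stereo_ne (x : ℂ) : stereo x ≠ stereoInv 0 := by
  intro h
  have h1 : (1 : ℝ) / (1 + ‖x‖ ^ 2) = ‖(0 : ℂ)‖ ^ 2 / (1 + ‖(0 : ℂ)‖ ^ 2) := congrArg Prod.snd h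
  have h2 : (0 : ℝ) < 1 / (1 + ‖x‖ ^ 2) := by positivity
  simp only [norm_zero, ne_eq, OfNat.ofNat_ne_zero, not_false_eq_true, zero_pow, zero_div] at h1
  exact h2.ne' h1

/-- The coordinate `ξ` in a chart at a puncture, `x` in the main chart. -/
def xiChart : D.ChartIndex → ℂ × ℂ → ℂ
  | .main, z => z.1
  | .pole _ _ _ _, z => z.1
  | .branch _ _, z => z.2 * z.1 ^ 2

lemma continuous_xiChart (i : D.ChartIndex) : Continuous (xiChart i) := by
  cases i with
  | main => exact continuous_fst
  | pole a v hv hv0 => exact continuous_fst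
  | branch a hκ => exact (by fun_prop : Continuous fun z : ℂ × ℂ => z.2 * z.1 ^ 2)

/-- The point of the projective line with coordinate `ξ` at the puncture, stereographically
projected. -/
def stereoLocal (D : FourPointData) : Puncture → ℂ → ℂ × ℝ
  | .zero, ξ => stereo ξ
  | .one, ξ => stereo (1 + ξ)
  | .t, ξ => stereo (D.t + ξ)
  | .infty, ξ => stereoInv ξ

lemma continuous_stereoLocal (a : Puncture) : Continuous (D.stereoLocal a) := by
  cases a
  · exact continuous_stereo
  · exact continuous_stereo.comp (by fun_prop)
  · exact continuous_stereo.comp (by fun_prop)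
  · exact continuous_stereoInv

lemma stereo_ofLocal {a : Puncture} {z : ℂ × ℂ} (h : z.1 ≠ 0) :
    stereo (D.ofLocal a z).1 = D.stereoLocal a z.1 := by
  cases a
  · rfl
  · rfl
  · rfl
  · exact stereo_inv h

/-- The projection of the surface to the projective line, stereographically projected. -/
def stereoX : HitchinSurface D → ℂ × ℝ
  | .interior z _ => stereo z.1
  | .added a _ _ _ _ => D.stereoLocal a 0

/-- One continuous map to a Hausdorff space thus separates points over different `x`, infinity
included. -/
lemma continuous_stereoX : Continuous (stereoX (D := D)) := by
  refine continuous_iff_continuousAt.2 fun m => ?_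
  have hs := chartSource_chartIndexAt m
  rw [continuousAt_iff_chart hs]
  have ht := chartMap_mem hs
  generalize chartMap (chartIndexAt m) m = z at ht
  generalize chartIndexAt m = i at ht
  cases i with
  | main =>
    refine (continuous_stereo.comp continuous_fst).continuousAt.congr ?_
    filter_upwards [(isOpen_innerTarget (D := D) .main).mem_nhds ht] with z hz
    simp [chartInv_inner hz, stereoX, innerInv]
  | pole a v hv hv0 =>
    refine ((continuous_stereoLocal (D := D) a).comp (continuous_xiChart
      (.pole a v hv hv0))).continuousAt.congr ?_
    filter_upwards [(isOpen_chartTarget (.pole a v hv hv0)).mem_nhds ht] with z hz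
    by_cases h : z.1 = 0
    · simp [chartInv_pole hv hv0 h, stereoX, xiChart, h]
    · have h' : z ∈ innerTarget (.pole a v hv hv0) := ⟨h, hz⟩
      simp only [Function.comp_apply, chartInv_inner h', stereoX, xiChart, innerInv]
      rw [stereo_ofLocal (by exact h)]
  | branch a hκ =>
    refine ((continuous_stereoLocal (D := D) a).comp (continuous_xiChart
      (.branch a hκ))).continuousAt.congr ?_
    filter_upwards [(isOpen_chartTarget (.branch a hκ)).mem_nhds ht] with z hz
    by_cases h : z.1 = 0
    · simp [chartInv_branch hκ h hz.1, stereoX, xiChart, h]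
    · have h' : z ∈ innerTarget (.branch a hκ) := ⟨h, hz⟩
      simp only [Function.comp_apply, chartInv_inner h', stereoX, xiChart, innerInv]
      rw [stereo_ofLocal (by exact mul_ne_zero hz.1 (pow_ne_zero _ h))]

lemma stereoLocal_zero_injective : Function.Injective fun a => D.stereoLocal a 0 := by
  have h0 := D.t_ne_zero
  have h1 := D.t_ne_one
  intro a a' h
  cases a <;> cases a' <;> simp only [stereoLocal] at h <;>
    first
    | rfl
    | exact (stereo_ne _ h).elim
    | exact (stereo_ne _ h.symm).elim
    | (have := stereo_injective h; simp [h0, h1, h0.symm, h1.symm] at this)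

lemma stereo_ne_stereoLocal {z : ℂ × ℂ} (hz : z ∈ D.base) (a : Puncture) :
    stereo z.1 ≠ D.stereoLocal a 0 := by
  obtain ⟨h0, h1, h2⟩ := hz
  intro h
  cases a <;> simp only [stereoLocal, add_zero] at h
  · exact h0 (stereo_injective h)
  · exact h1 (stereo_injective h)
  · exact h2 (stereo_injective h)
  · exact stereo_ne _ h

lemma separated_of_chart {i : D.ChartIndex} {m m' : HitchinSurface D} (h : chartSource i m)
    (h' : chartSource i m') (hne : m ≠ m') :
    ∃ U V : Set (HitchinSurface D), IsOpen U ∧ IsOpen V ∧ m ∈ U ∧ m' ∈ V ∧ Disjoint U V := by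
  obtain ⟨U, V, hU, hV, hm, hm', hd⟩ := t2_separation
    (fun he : chartMap i m = chartMap i m' => hne ((chart i).injOn h h' he))
  refine ⟨_, _, (homeo i).isOpen_inter_preimage hU, (homeo i).isOpen_inter_preimage hV,
    ⟨h, hm⟩, ⟨h', hm'⟩, ?_⟩
  exact (hd.preimage _).mono Set.inter_subset_right Set.inter_subset_right

/-- The part of a chart at an added point with `v ≠ 0` where `ξ η` is near `v`. -/
def nearPole (a : Puncture) (v : ℂ) (hv : v ^ 2 = D.κ a ^ 2) (hv0 : v ≠ 0) :
    Set (HitchinSurface D) :=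
  (homeo (.pole a v hv hv0)).source ∩ chartMap (.pole a v hv hv0) ⁻¹' {z | ‖z.1 * z.2‖ < ‖v‖}

lemma isOpen_nearPole {a : Puncture} {v : ℂ} (hv : v ^ 2 = D.κ a ^ 2) (hv0 : v ≠ 0) :
    IsOpen (nearPole a v hv hv0) :=
  (homeo (.pole a v hv hv0)).isOpen_inter_preimage (isOpen_lt (by fun_prop) (by fun_prop))

lemma added_mem_nearPole {a : Puncture} {v b : ℂ} (hv : v ^ 2 = D.κ a ^ 2) (hv0 : v ≠ 0) (hs) :
    .added a v b hv hs ∈ nearPole a v hv hv0 :=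
  ⟨⟨rfl, rfl⟩, by simpa [chartMap] using hv0⟩

lemma interior_mem_nearPole {a : Puncture} {v : ℂ} (hv : v ^ 2 = D.κ a ^ 2) (hv0 : v ≠ 0)
    {z : ℂ × ℂ} {hz : z ∈ D.base} (h : .interior z hz ∈ nearPole a v hv hv0) :
    ‖(D.toLocal a z).1 * (D.toLocal a z).2 - v‖ < ‖v‖ := by
  have h0 : (D.toLocal a z).1 ≠ 0 := (D.toLocal_mem hz).1
  have h1 := h.2
  simp only [Set.mem_preimage, Set.mem_ofPred_eq, chartMap, innerMap] at h1
  rwa [mul_sub, mul_div_cancel₀ _ h0] at h1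

instance : T2Space (HitchinSurface D) := by
  refine ⟨fun m m' hne => ?_⟩
  -- Points over the same `x` lie in a common chart, except for added points with opposite nonzero
  -- `v`. For these the neighbourhoods `‖ξ η - v‖ < ‖v‖` and `‖ξ η + v‖ < ‖v‖` are disjoint.
  by_cases h : stereoX m = stereoX m'
  swap
  · obtain ⟨U, V, hU, hV, hm, hm', hd⟩ := t2_separation h
    exact ⟨_, _, hU.preimage continuous_stereoX, hV.preimage continuous_stereoX, hm, hm',
      hd.preimage _⟩
  rcases m with ⟨z, hz⟩ | ⟨a, v, b, hv, hs⟩ <;> rcases m' with ⟨z', hz'⟩ | ⟨a', v', b', hv', hs'⟩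
  · exact separated_of_chart (i := .main) hz hz' hne
  · exact (stereo_ne_stereoLocal hz a' h).elim
  · exact (stereo_ne_stereoLocal hz' a h.symm).elim
  · obtain rfl := stereoLocal_zero_injective h
    have hsq : v' = v ∨ v' = -v := sq_eq_sq_iff_eq_or_eq_neg.1 (hv'.trans hv.symm)
    by_cases hv0 : v = 0
    · subst hv0
      obtain rfl : v' = 0 := by simpa using hsq
      refine separated_of_chart (i := .branch a (by simpa using hv.symm)) rfl rfl hne
    rcases hsq with rfl | rfl
    · exact separated_of_chart (i := .pole a v' hv hv0) ⟨rfl, rfl⟩ ⟨rfl, rfl⟩ hne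
    have hv0' : -v ≠ 0 := neg_ne_zero.2 hv0
    refine ⟨_, _, isOpen_nearPole hv hv0, isOpen_nearPole hv' hv0',
      added_mem_nearPole hv hv0 hs, added_mem_nearPole hv' hv0' hs', ?_⟩
    refine Set.disjoint_left.2 ?_
    rintro (⟨z, hz⟩ | ⟨a'', v'', b'', hv'', hs''⟩) h1 h2
    · have e1 := interior_mem_nearPole hv hv0 h1
      have e2 := interior_mem_nearPole hv' hv0' h2
      set y := (D.toLocal a z).1 * (D.toLocal a z).2
      have e3 : ‖(y - -v) - (y - v)‖ ≤ ‖y - -v‖ + ‖y - v‖ := norm_sub_le _ _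
      have e4 : (y - -v) - (y - v) = 2 * v := by ring
      rw [e4, norm_mul, Complex.norm_ofNat] at e3
      rw [norm_neg] at e2
      linarith
    · obtain ⟨⟨-, rfl⟩, -⟩ := h1
      obtain ⟨⟨-, h3⟩, -⟩ := h2
      exact hv0 (by linear_combination h3 / 2)

instance : SecondCountableTopology (HitchinSurface D) := by
  have hfin : Finite Puncture := by
    refine Finite.of_surjective (fun n : Fin 4 => match n with
      | 0 => Puncture.zero | 1 => .one | 2 => .t | 3 => .infty) fun a => ?_
    cases a
    exacts [⟨0, rfl⟩, ⟨1, rfl⟩, ⟨2, rfl⟩, ⟨3, rfl⟩]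
  -- One point over each puncture for each sign of the root. The value `b = β + 1` is allowed even
  -- if `κ = 0`.
  let p : Puncture × Bool → HitchinSurface D := fun x =>
    .added x.1 (if x.2 then D.κ x.1 else -D.κ x.1) (D.β x.1 + 1) (by split_ifs <;> ring)
      (.inr (by simp))
  obtain ⟨z₀, hz₀⟩ : ∃ z, z ∈ D.base := by
    obtain ⟨x, hx⟩ := (Set.toFinite {0, 1, D.t}).infinite_compl.nonempty
    exact ⟨(x, 0), fun h => hx (.inl h), fun h => hx (.inr (.inl h)), fun h => hx (.inr (.inr h))⟩
  refine ChartedSpace.secondCountable_of_countable_cover (ℂ × ℂ)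
    (s := insert (.interior z₀ hz₀) (Set.range p)) ?_ ((Set.finite_range p).insert _).countable
  refine Set.eq_univ_of_forall fun m => ?_
  rw [Set.mem_iUnion₂]
  rcases m with ⟨z, hz⟩ | ⟨a, v, b, hv, hs⟩
  · exact ⟨_, Set.mem_insert _ _, hz⟩
  · obtain ⟨ε, hε⟩ : ∃ ε : Bool, v = if ε then D.κ a else -D.κ a := by
      rcases sq_eq_sq_iff_eq_or_eq_neg.1 hv with h | h
      exacts [⟨true, by simpa using h⟩, ⟨false, by simpa using h⟩]
    refine ⟨p (a, ε), Set.mem_insert_of_mem _ ⟨_, rfl⟩, ?_⟩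
    change chartSource (chartIndexAt (p (a, ε))) _
    by_cases h : v = 0
    · simp [p, chartIndexAt, ← hε, h, chartSource]
    · simp [p, chartIndexAt, ← hε, h, chartSource]

/-- The form is standard in the preferred coordinates at every point and the transition maps are
symplectic. So it is constant throughout each chart, which makes it holomorphic and closed. -/
lemma localForm_eq (m : HitchinSurface D) {z : ℂ × ℂ}
    (hz : z ∈ (extChartAt 𝓘(ℂ, ℂ × ℂ) m).target) : localForm D.Ω m z = stdForm := by
  have hz' : z ∈ (chartAt (ℂ × ℂ) m).target := by simpa using hz
  change z ∈ chartTarget (chartIndexAt m) at hz'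
  obtain ⟨L, hL, h⟩ := hasMFDerivAt_chartInv hz'
  have h1 : mfderiv 𝓘(ℂ, ℂ × ℂ) 𝓘(ℂ, ℂ × ℂ) (extChartAt 𝓘(ℂ, ℂ × ℂ) m).symm z = L := h.mfderiv
  refine ContinuousLinearMap.ext fun u => ContinuousLinearMap.ext fun w => ?_
  simp only [localForm, h1]
  exact hL u w

theorem isSymplectic : IsSymplectic D.Ω where
  finiteDimensional := inferInstance
  t2 := inferInstance
  secondCountable := inferInstance
  isManifold := inferInstance
  alternating m u := stdForm_self u
  nondegenerate m u h := stdForm_nondegenerate u h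
  holomorphic m := (differentiableOn_const stdForm).congr fun z hz => localForm_eq m hz
  closed m z hz u v w := by
    have h : fderiv ℂ (localForm D.Ω m) z = 0 := by
      have hn : (extChartAt 𝓘(ℂ, ℂ × ℂ) m).target ∈ 𝓝 z :=
        (isOpen_extChartAt_target m).mem_nhds hz
      have : localForm D.Ω m =ᶠ[𝓝 z] fun _ => stdForm := by
        filter_upwards [hn] with z hz using localForm_eq m hz
      rw [this.fderiv_eq, fderiv_fun_const]
      rfl
    simp [h]

end FourPointData

namespace FourPointData

open Filter Topology

variable {D : FourPointData}

/-! ### The fibres as quartics -/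

variable (D) in
/-- The fibre `f = b` as a quartic. -/
def quart (b : ℂ) : SquareQuartic where
  s := D.s
  a := b - D.s ^ 2 * (1 + D.t)
  c := D.s ^ 2 * D.t - (1 + D.t) * b + D.k₁ ^ 2 * D.t - D.k₂ ^ 2 * (D.t - 1)
    + D.k₃ ^ 2 * D.t * (D.t - 1)
  d := D.t * b - D.k₁ ^ 2 * D.t * (1 + D.t) + D.k₂ ^ 2 * (D.t - 1) * D.t
    - D.k₃ ^ 2 * D.t * (D.t - 1)
  e := D.k₁ ^ 2 * D.t ^ 2

lemma quart_eval (b x : ℂ) : (D.quart b).eval x = D.quartic b x := by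
  unfold SquareQuartic.eval quartic quart
  ring

/-- For `s = 0` the coefficient `a` is `b`. The remaining case `s = b = 0` is the fibre which does
not meet `N`, since `β` at infinity is then `0`. -/
lemma good_iff {b : ℂ} : (D.quart b).Good ↔ ¬ D.IsReducible b ∧ (D.s ≠ 0 ∨ b ≠ 0) := by
  have h : (D.s ≠ 0 ∨ (D.quart b).a ≠ 0) ↔ (D.s ≠ 0 ∨ b ≠ 0) := by
    by_cases hs : D.s = 0 <;> simp [hs, quart]
  constructor
  · rintro ⟨h1, h2⟩
    exact ⟨by simpa only [quart_eval, IsReducible] using h1, h.1 h2⟩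
  · rintro ⟨h1, h2⟩
    exact ⟨by simpa only [quart_eval, IsReducible] using h1, h.2 h2⟩

/-- The leading coefficient and the values at `0` and `1` do not depend on `b`. If the quartic is
`(c₂ x² + c₁ x + c₀)²`, they fix `c₂`, `c₀` and `c₂ + c₁ + c₀` up to signs, and the `x³` coefficient
then gives `b`. -/
lemma finite_isReducible : {b | D.IsReducible b}.Finite := by
  have hsq : ∀ κ : ℂ, {c : ℂ | c ^ 2 = κ ^ 2}.Finite := fun κ =>
    (Set.toFinite {κ, -κ}).subset fun c hc => sq_eq_sq_iff_eq_or_eq_neg.1 hc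
  refine (((hsq (D.k₁ * D.t)).prod ((hsq D.s).prod (hsq (D.k₂ * (D.t - 1))))).image
    fun c => 2 * (c.2.2 - c.1 - c.2.1) * c.2.1 + D.s ^ 2 * (1 + D.t)).subset ?_
  rintro b ⟨c₀, c₁, c₂, h⟩
  simp only [← quart_eval, SquareQuartic.eval] at h
  -- The values at `0, ±1, ±2` determine the coefficients; the fourth difference isolates `x⁴`, the
  -- odd one `x³`.
  have h0 := h 0
  have h1 := h 1
  have h2 := h (-1)
  have h3 := h 2
  have h4 := h (-2)
  refine ⟨(c₀, c₂, c₂ + c₁ + c₀), ⟨?_, ?_, ?_⟩, ?_⟩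
  · simp only [quart] at h0
    simp only [Set.mem_ofPred_eq]
    linear_combination -h0
  · simp only [quart] at *
    simp only [Set.mem_ofPred_eq]
    linear_combination (-h3 + 4 * h1 - 6 * h0 + 4 * h2 - h4) / 24
  · simp only [quart] at h1
    simp only [Set.mem_ofPred_eq]
    linear_combination -h1
  · simp only [quart] at *
    linear_combination -(h3 - 2 * h1 + 2 * h2 - h4) / 12

lemma isOpen_setOf_good : IsOpen {b | (D.quart b).Good} := by
  simp only [good_iff]
  refine IsOpen.and (finite_isReducible (D := D)).isClosed.isOpen_compl ?_
  by_cases hs : D.s = 0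
  · simpa [hs] using isOpen_ne
  · simp [hs]

variable (D) in
/-- The cubic polynomial `x (x - 1) (x - t)`. -/
def cubic (x : ℂ) : ℂ := x * (x - 1) * (x - D.t)

lemma cubic_ne_zero {z : ℂ × ℂ} (hz : z ∈ D.base) : D.cubic z.1 ≠ 0 :=
  mul_ne_zero (mul_ne_zero hz.1 (sub_ne_zero.2 hz.2.1)) (sub_ne_zero.2 hz.2.2)

lemma f₀_eq_iff {z : ℂ × ℂ} (hz : z ∈ D.base) {b : ℂ} :
    D.f₀ z.1 z.2 = b ↔ (D.cubic z.1 * z.2) ^ 2 = (D.quart b).eval z.1 := by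
  have hA := cubic_ne_zero hz
  have h : D.cubic z.1 * (D.f₀ z.1 z.2 - b) =
      (D.cubic z.1 * z.2) ^ 2 - (D.quart b).eval z.1 := by
    obtain ⟨h0, h1, h2⟩ := hz
    have h1' := sub_ne_zero.2 h1
    have h2' := sub_ne_zero.2 h2
    rw [quart_eval]
    unfold f₀ cubic quartic
    field_simp
    ring
  rw [← sub_eq_zero, ← mul_right_inj' hA, mul_zero, h, sub_eq_zero]

/-! ### The function `f` in the charts -/

/-- The function `g (ξ)` in the expression `C (ξ) ((ξ η)² - κ²) / ξ + g (ξ)` of `f`. -/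
def regularPart (D : FourPointData) : Puncture → ℂ → ℂ
  | .zero, ξ => D.k₁ ^ 2 * (ξ - 1 - D.t) - D.s ^ 2 * ξ + D.k₂ ^ 2 * (D.t - 1) / (ξ - 1)
      - D.k₃ ^ 2 * D.t * (D.t - 1) / (ξ - D.t)
  | .one, ξ => D.k₂ ^ 2 * (ξ + 2 - D.t) - D.s ^ 2 * (1 + ξ) - D.k₁ ^ 2 * D.t / (1 + ξ)
      - D.k₃ ^ 2 * D.t * (D.t - 1) / (1 + ξ - D.t)
  | .t, ξ => D.k₃ ^ 2 * (ξ + 2 * D.t - 1) - D.s ^ 2 * (D.t + ξ) - D.k₁ ^ 2 * D.t / (D.t + ξ)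
      + D.k₂ ^ 2 * (D.t - 1) / (D.t + ξ - 1)
  | .infty, ξ => D.s ^ 2 * (D.t * ξ - 1 - D.t) - D.k₁ ^ 2 * D.t * ξ
      + D.k₂ ^ 2 * (D.t - 1) * ξ / (1 - ξ) - D.k₃ ^ 2 * D.t * (D.t - 1) * ξ / (1 - D.t * ξ)

lemma regularPart_zero (a : Puncture) : D.regularPart a 0 = D.β a := by
  have h0 := D.t_ne_zero
  have h1 := sub_ne_zero.2 D.t_ne_one
  have h2 : 1 - D.t ≠ 0 := sub_ne_zero.2 D.t_ne_one.symm
  cases a <;> simp only [regularPart, β, zero_sub, add_zero, zero_add, mul_zero, sub_zero, zero_div]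
    <;> field_simp <;> ring

lemma contDiffAt_regularPart {n : ℕ∞ω} {a : Puncture} {ξ : ℂ} (h : D.C a ξ ≠ 0) :
    ContDiffAt ℂ n (D.regularPart a) ξ := by
  cases a <;> obtain ⟨h1, h2⟩ := mul_ne_zero_iff.1 h
  · exact (by fun_prop (disch := assumption) : ContDiffAt ℂ n (fun ξ => D.k₁ ^ 2 * (ξ - 1 - D.t)
      - D.s ^ 2 * ξ + D.k₂ ^ 2 * (D.t - 1) / (ξ - 1) - D.k₃ ^ 2 * D.t * (D.t - 1) / (ξ - D.t)) ξ)
  · exact (by fun_prop (disch := assumption) : ContDiffAt ℂ n (fun ξ => D.k₂ ^ 2 * (ξ + 2 - D.t)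
      - D.s ^ 2 * (1 + ξ) - D.k₁ ^ 2 * D.t / (1 + ξ)
      - D.k₃ ^ 2 * D.t * (D.t - 1) / (1 + ξ - D.t)) ξ)
  · exact (by fun_prop (disch := assumption) : ContDiffAt ℂ n (fun ξ => D.k₃ ^ 2 * (ξ + 2 * D.t - 1)
      - D.s ^ 2 * (D.t + ξ) - D.k₁ ^ 2 * D.t / (D.t + ξ)
      + D.k₂ ^ 2 * (D.t - 1) / (D.t + ξ - 1)) ξ)
  · exact (by fun_prop (disch := assumption) : ContDiffAt ℂ n (fun ξ =>
      D.s ^ 2 * (D.t * ξ - 1 - D.t) - D.k₁ ^ 2 * D.t * ξ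
      + D.k₂ ^ 2 * (D.t - 1) * ξ / (1 - ξ) - D.k₃ ^ 2 * D.t * (D.t - 1) * ξ / (1 - D.t * ξ)) ξ)

lemma contDiff_C {n : ℕ∞ω} (a : Puncture) : ContDiff ℂ n (D.C a) := by
  cases a
  · exact (by fun_prop : ContDiff ℂ n fun ξ : ℂ => (ξ - 1) * (ξ - D.t))
  · exact (by fun_prop : ContDiff ℂ n fun ξ : ℂ => (1 + ξ) * (1 + ξ - D.t))
  · exact (by fun_prop : ContDiff ℂ n fun ξ : ℂ => (D.t + ξ) * (D.t + ξ - 1))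
  · exact (by fun_prop : ContDiff ℂ n fun ξ : ℂ => (1 - ξ) * (1 - D.t * ξ))

lemma f₀_ofLocal {a : Puncture} {z : ℂ × ℂ} (hz : z ∈ D.localBase a) :
    D.f₀ (D.ofLocal a z).1 (D.ofLocal a z).2 =
      D.C a z.1 * ((z.1 * z.2) ^ 2 - D.κ a ^ 2) / z.1 + D.regularPart a z.1 := by
  obtain ⟨h0, h⟩ := hz
  obtain ⟨ξ, η⟩ := z
  simp only at h0 h
  cases a <;> obtain ⟨h1, h2⟩ := mul_ne_zero_iff.1 h <;>
    simp only [f₀, ofLocal, C, κ, regularPart]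
  · field_simp
    ring
  · have h3 : 1 + ξ - 1 = ξ := by ring
    rw [h3]
    field_simp
    ring
  · have h3 : D.t + ξ - D.t = ξ := by ring
    rw [h3]
    field_simp
    ring
  · have h3 : ξ⁻¹ - 1 = (1 - ξ) / ξ := by field_simp
    have h4 : ξ⁻¹ - D.t = (1 - D.t * ξ) / ξ := by field_simp
    rw [h3, h4]
    field_simp
    ring

/-- The function `f` in a chart. -/
def fChart : D.ChartIndex → ℂ × ℂ → ℂ
  | .main, z => D.f₀ z.1 z.2
  | .pole a v _ _, z => D.C a z.1 * z.2 * (2 * v + z.1 * z.2) + D.regularPart a z.1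
  | .branch a _, z => D.C a (z.2 * z.1 ^ 2) * z.2 + D.regularPart a (z.2 * z.1 ^ 2)

lemma f_chartInv {i : D.ChartIndex} {z : ℂ × ℂ} (hz : z ∈ chartTarget i) :
    D.f (chartInv i z) = fChart i z := by
  by_cases h : z ∈ innerTarget i
  · rw [chartInv_inner h]
    simp only [f, fChart]
    cases i with
    | main => rfl
    | pole a v hv hv0 =>
      have h0 := h.1
      have h' : (z.1, v / z.1 + z.2) ∈ D.localBase a := h
      simp only [innerInv]
      rw [f₀_ofLocal h', ← hv]
      field_simp
      ring
    | branch a hκ =>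
      have h0 := h.1
      have h2 := h.2.1
      have h' : (z.2 * z.1 ^ 2, z.1⁻¹) ∈ D.localBase a :=
        ⟨mul_ne_zero h.2.1 (pow_ne_zero _ h0), h.2.2⟩
      simp only [innerInv]
      rw [f₀_ofLocal h', hκ]
      field_simp
      ring
  · cases i with
    | main => exact (h hz).elim
    | pole a v hv hv0 =>
      have h1 : z.1 = 0 := by_contra fun h1 => h ⟨h1, hz⟩
      rw [chartInv_pole hv hv0 h1]
      simp only [f, fChart, h1, regularPart_zero]
      ring
    | branch a hκ =>
      have h1 : z.1 = 0 := by_contra fun h1 => h ⟨h1, hz⟩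
      rw [chartInv_branch hκ h1 hz.1]
      simp [f, fChart, h1, regularPart_zero]

lemma contDiffAt_f₀ {n : ℕ∞ω} {z : ℂ × ℂ} (hz : z ∈ D.base) :
    ContDiffAt ℂ n (fun z : ℂ × ℂ => D.f₀ z.1 z.2) z := by
  obtain ⟨h0, h1, h2⟩ := hz
  have h1' := sub_ne_zero.2 h1
  have h2' := sub_ne_zero.2 h2
  unfold f₀
  fun_prop (disch := assumption)

lemma contDiffAt_fChart {n : ℕ∞ω} {i : D.ChartIndex} {z : ℂ × ℂ} (hz : z ∈ chartTarget i) :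
    ContDiffAt ℂ n (fChart i) z := by
  cases i with
  | main => exact contDiffAt_f₀ hz
  | pole a v hv hv0 =>
    have h1 : ContDiffAt ℂ n (fun z : ℂ × ℂ => D.C a z.1) z :=
      ((contDiff_C a).comp contDiff_fst).contDiffAt
    have h2 : ContDiffAt ℂ n (fun z : ℂ × ℂ => D.regularPart a z.1) z :=
      (contDiffAt_regularPart hz).comp z contDiffAt_fst
    exact (by fun_prop : ContDiffAt ℂ n (fun z : ℂ × ℂ =>
      D.C a z.1 * z.2 * (2 * v + z.1 * z.2) + D.regularPart a z.1) z)
  | branch a hκ =>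
    have h0 : ContDiffAt ℂ n (fun z : ℂ × ℂ => z.2 * z.1 ^ 2) z := by fun_prop
    have h1 : ContDiffAt ℂ n (fun z : ℂ × ℂ => D.C a (z.2 * z.1 ^ 2)) z :=
      (contDiff_C a).contDiffAt.comp z h0
    have h2 : ContDiffAt ℂ n (fun z : ℂ × ℂ => D.regularPart a (z.2 * z.1 ^ 2)) z :=
      ContDiffAt.comp (g := D.regularPart a) (f := fun z : ℂ × ℂ => z.2 * z.1 ^ 2) z
        (contDiffAt_regularPart hz.2) h0
    exact (by fun_prop : ContDiffAt ℂ n (fun z : ℂ × ℂ =>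
      D.C a (z.2 * z.1 ^ 2) * z.2 + D.regularPart a (z.2 * z.1 ^ 2)) z)

lemma fChart_chartMap {i : D.ChartIndex} {m : HitchinSurface D} (h : chartSource i m) :
    fChart i (chartMap i m) = D.f m := by
  rw [← f_chartInv (chartMap_mem h), chartInv_chartMap h]

lemma f_chartInv_eventuallyEq {i : D.ChartIndex} {z : ℂ × ℂ} (hz : z ∈ chartTarget i) :
    (fun z => D.f (chartInv i z)) =ᶠ[𝓝 z] fChart i := by
  filter_upwards [(isOpen_chartTarget i).mem_nhds hz] with z hz using f_chartInv hz

lemma continuous_f : Continuous D.f := by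
  refine continuous_iff_continuousAt.2 fun m => ?_
  have hs := chartSource_chartIndexAt m
  rw [continuousAt_iff_chart hs]
  exact (contDiffAt_fChart (n := 0) (chartMap_mem hs)).continuousAt.congr
    (f_chartInv_eventuallyEq (chartMap_mem hs)).symm

lemma hasMFDerivAt_f (m : HitchinSurface D) : HasMFDerivAt 𝓘(ℂ, ℂ × ℂ) 𝓘(ℂ, ℂ) D.f m
    (fderiv ℂ (fChart (chartIndexAt m)) (chartMap (chartIndexAt m) m)) := by
  have ht := chartMap_mem (chartSource_chartIndexAt m)
  refine hasMFDerivAt_function ?_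
  exact ((contDiffAt_fChart (n := 1) ht).differentiableAt one_ne_zero).hasFDerivAt.congr_of_eventuallyEq
    (f_chartInv_eventuallyEq ht)

/-! ### The regular points -/

lemma regular_iff {m : HitchinSurface D} : m ∈ D.regular ↔
    fderiv ℂ (fChart (chartIndexAt m)) (chartMap (chartIndexAt m) m) ≠ 0 ∧
      ¬ D.IsReducible (D.f m) := by
  have h : mfderiv 𝓘(ℂ, ℂ × ℂ) 𝓘(ℂ, ℂ) D.f m =
    fderiv ℂ (fChart (chartIndexAt m)) (chartMap (chartIndexAt m) m) := (hasMFDerivAt_f m).mfderiv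
  unfold regular
  rw [Set.mem_ofPred_eq, h]
  rfl

lemma fderiv_f₀_eq_zero_iff {z : ℂ × ℂ} (hz : z ∈ D.base) :
    fderiv ℂ (fun z : ℂ × ℂ => D.f₀ z.1 z.2) z = 0 ↔ z.2 = 0 ∧
      -D.s ^ 2 + D.k₁ ^ 2 * D.t / z.1 ^ 2 - D.k₂ ^ 2 * (D.t - 1) / (z.1 - 1) ^ 2
        + D.k₃ ^ 2 * D.t * (D.t - 1) / (z.1 - D.t) ^ 2 = 0 := by
  have hA := cubic_ne_zero hz
  obtain ⟨h0, h1, h2⟩ := hz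
  have h1' := sub_ne_zero.2 h1
  have h2' := sub_ne_zero.2 h2
  have e1 : HasFDerivAt (fun z : ℂ × ℂ => z.1) (ContinuousLinearMap.fst ℂ ℂ ℂ) z := hasFDerivAt_fst
  have e2 : HasFDerivAt (fun z : ℂ × ℂ => z.2) (ContinuousLinearMap.snd ℂ ℂ ℂ) z := hasFDerivAt_snd
  have i0 := ((hasDerivAt_inv h0).comp_hasFDerivAt z e1).const_mul (D.k₁ ^ 2 * D.t)
  have i1 := ((hasDerivAt_inv h1').comp_hasFDerivAt z (e1.sub_const 1)).const_mul
    (D.k₂ ^ 2 * (D.t - 1))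
  have i2 := ((hasDerivAt_inv h2').comp_hasFDerivAt z (e1.sub_const D.t)).const_mul
    (D.k₃ ^ 2 * D.t * (D.t - 1))
  have H := ((((((e1.mul (e1.sub_const 1)).mul (e1.sub_const D.t)).mul (e2.pow 2)).sub
    (e1.const_mul (D.s ^ 2))).sub i0).add i1).sub i2
  obtain ⟨L, hL, hL'⟩ : ∃ L, HasFDerivAt (fun z : ℂ × ℂ => D.f₀ z.1 z.2) L z ∧ ∀ u, L u =
      D.cubic z.1 * (2 * z.2) * u.2 + (z.2 ^ 2 * ((z.1 - 1) * (z.1 - D.t) + z.1 * (z.1 - D.t)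
        + z.1 * (z.1 - 1)) + (-D.s ^ 2 + D.k₁ ^ 2 * D.t / z.1 ^ 2
        - D.k₂ ^ 2 * (D.t - 1) / (z.1 - 1) ^ 2
        + D.k₃ ^ 2 * D.t * (D.t - 1) / (z.1 - D.t) ^ 2)) * u.1 := by
    refine ⟨_, H.congr_of_eventuallyEq (Eventually.of_forall fun z => ?_), fun u => ?_⟩
    · simp [f₀, div_eq_mul_inv]
    · simp [cubic]
      ring
  rw [hL.fderiv]
  constructor
  · intro h
    have h3 := hL' (0, 1)
    have h4 := hL' (1, 0)
    rw [h, zero_apply] at h3 h4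
    have h5 : z.2 = 0 := by simpa [hA] using h3
    exact ⟨h5, by simpa [h5] using h4.symm⟩
  · rintro ⟨h3, h4⟩
    refine ContinuousLinearMap.ext fun u => ?_
    rw [hL', h3, h4]
    simp

lemma interior_mem_regular {z : ℂ × ℂ} (hz : z ∈ D.base) : .interior z hz ∈ D.regular ↔
    (D.quart (D.f₀ z.1 z.2)).Smooth z.1 (D.s * z.1 ^ 2 - D.cubic z.1 * z.2) ∧
      ¬ D.IsReducible (D.f₀ z.1 z.2) := by
  rw [regular_iff]
  have e : chartMap .main (.interior z hz) = z := by simp [chartMap, innerMap]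
  simp only [chartIndexAt, e, f]
  refine and_congr_left fun _ => ?_
  change fderiv ℂ (fun z : ℂ × ℂ => D.f₀ z.1 z.2) z ≠ 0 ↔ _
  rw [ne_eq, fderiv_f₀_eq_zero_iff hz, SquareQuartic.Smooth, not_and_or]
  have hA := cubic_ne_zero hz
  have hs : (D.quart (D.f₀ z.1 z.2)).s = D.s := rfl
  have h1 : D.s * z.1 ^ 2 - D.cubic z.1 * z.2 - (D.quart (D.f₀ z.1 z.2)).s * z.1 ^ 2 =
      -D.cubic z.1 * z.2 := by rw [hs]; ring
  rw [h1]
  by_cases hp : z.2 = 0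
  -- The identity `cubic x * (f₀ x 0 - b) = -Q_b (x)` is differentiated at a zero of `Q_b`.
  · have h2 : 4 * (D.quart (D.f₀ z.1 z.2)).s * z.1 * (D.s * z.1 ^ 2 - D.cubic z.1 * z.2)
        + 3 * (D.quart (D.f₀ z.1 z.2)).a * z.1 ^ 2 + 2 * (D.quart (D.f₀ z.1 z.2)).c * z.1
        + (D.quart (D.f₀ z.1 z.2)).d = -D.cubic z.1 * (-D.s ^ 2 + D.k₁ ^ 2 * D.t / z.1 ^ 2
        - D.k₂ ^ 2 * (D.t - 1) / (z.1 - 1) ^ 2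
        + D.k₃ ^ 2 * D.t * (D.t - 1) / (z.1 - D.t) ^ 2) := by
      obtain ⟨h0, h1, h2⟩ := hz
      have h1' := sub_ne_zero.2 h1
      have h2' := sub_ne_zero.2 h2
      rw [hp]
      unfold quart f₀ cubic
      field_simp
      ring
    rw [h2, hp]
    simp [hA]
  · simp [hp, hA]

lemma interior_mem_regular_of_ne {z : ℂ × ℂ} (hz : z ∈ D.base) (hp : z.2 ≠ 0)
    (hb : ¬ D.IsReducible (D.f₀ z.1 z.2)) : .interior z hz ∈ D.regular := by
  refine (interior_mem_regular hz).2 ⟨SquareQuartic.smooth_of_ne fun h => ?_, hb⟩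
  have hs : (D.quart (D.f₀ z.1 z.2)).s = D.s := rfl
  rw [hs] at h
  exact mul_ne_zero (cubic_ne_zero hz) hp (by linear_combination -h)

/-- Along the added line `f` is an affine function of the chart coordinate, with slope `2 v C (0)`
or `C (0)`. So `df` never vanishes there. -/
lemma added_mem_regular {a : Puncture} {v b : ℂ} (hv) (hs) :
    .added a v b hv hs ∈ D.regular ↔ ¬ D.IsReducible b := by
  rw [regular_iff]
  refine and_iff_right fun h0 => ?_
  set m : HitchinSurface D := .added a v b hv hs
  have ht := chartMap_mem (chartSource_chartIndexAt m)
  have h1 := ((contDiffAt_fChart (n := 1) ht).differentiableAt one_ne_zero).hasFDerivAt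
  rw [h0] at h1
  have h2 : chartMap (chartIndexAt m) m = (0, (chartMap (chartIndexAt m) m).2) := by
    refine Prod.ext ?_ rfl
    by_cases hv0 : v = 0 <;> simp [m, chartIndexAt, hv0, chartMap]
  generalize (chartMap (chartIndexAt m) m).2 = q at h2
  rw [h2] at h1
  have h3 : HasDerivAt (fun q' : ℂ => ((0, q') : ℂ × ℂ)) (0, 1) q :=
    (hasDerivAt_const q (0 : ℂ)).prodMk (hasDerivAt_id q)
  have h4 := h1.comp_hasDerivAt q h3
  have hC := D.C_ne_zero a
  suffices H : ∃ c : ℂ, c ≠ 0 ∧ ∀ q', fChart (chartIndexAt m) (0, q') = q' * c + D.β a by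
    obtain ⟨c, hc, H⟩ := H
    refine hc ?_
    have h5 : HasDerivAt (fun q' : ℂ => q' * c + D.β a) (1 * c) q :=
      ((hasDerivAt_id q).mul_const c).add_const _
    have h6 := h5.unique (h4.congr_of_eventuallyEq (Eventually.of_forall fun q' => (H q').symm))
    simpa using h6
  by_cases hv0 : v = 0
  · refine ⟨D.C a 0, hC, fun q' => ?_⟩
    simp [m, chartIndexAt, hv0, fChart, regularPart_zero, mul_comm]
  · refine ⟨2 * v * D.C a 0, mul_ne_zero (mul_ne_zero two_ne_zero hv0) hC, fun q' => ?_⟩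
    simp [m, chartIndexAt, hv0, fChart, regularPart_zero]
    ring

/-- The preferred chart jumps between added and interior points, so continuity of `df` is used only
at interior points. Near an added point the interior points have `p ≠ 0`, which is sufficient. -/
lemma isOpen_regular : IsOpen D.regular := by
  refine isOpen_iff_mem_nhds.2 fun m hm => ?_
  have hb : ∀ᶠ m' in 𝓝 m, ¬ D.IsReducible (D.f m') :=
    (continuous_f.continuousAt (x := m)).eventually
      ((finite_isReducible (D := D)).isClosed.isOpen_compl.mem_nhds hm.2)
  rcases m with ⟨z, hz⟩ | ⟨a, v, b, hv, hs⟩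
  · have h1 := (regular_iff.1 hm).1
    have e : chartMap .main (.interior z hz) = z := by simp [chartMap, innerMap]
    simp only [chartIndexAt, e] at h1
    have h2 : ContinuousAt (fderiv ℂ (fChart (D := D) .main)) z :=
      ((contDiffAt_fChart (n := 1) (i := .main) hz).fderiv_right (m := 0) le_rfl).continuousAt
    rw [← e] at h2 h1
    have h3 := (h2.comp (continuousAt_chartMap (i := .main) (m := .interior z hz) hz)).eventually_ne h1
    filter_upwards [hb, h3, (isOpen_chartSource (D := D) .main).mem_nhds
      (show chartSource .main (.interior z hz) from hz)] with m' h4 h5 h6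
    refine regular_iff.2 ⟨?_, h4⟩
    rcases m' with ⟨z', hz'⟩ | ⟨a', v', b', hv', hs'⟩
    · exact h5
    · exact h6.elim
  · by_cases hv0 : v = 0
    · subst hv0
      have hκ : D.κ a = 0 := by simpa using hv.symm
      filter_upwards [hb, (isOpen_chartSource (.branch a hκ)).mem_nhds
        (show chartSource (.branch a hκ) (.added a 0 b hv hs) from rfl)] with m' h4 h6
      rcases m' with ⟨z', hz'⟩ | ⟨a', v', b', hv', hs'⟩
      · refine interior_mem_regular_of_ne hz' ?_ h4
        intro hp
        have h7 : z' ∈ innerSource (.branch a hκ) := by simpa [chartSource] using h6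
        refine h7.2 ?_
        cases a <;> simp [toLocal, hp]
      · exact (added_mem_regular hv' hs').2 h4
    · filter_upwards [hb, (isOpen_nearPole hv hv0).mem_nhds (added_mem_nearPole hv hv0 hs)]
        with m' h4 h6
      rcases m' with ⟨z', hz'⟩ | ⟨a', v', b', hv', hs'⟩
      · refine interior_mem_regular_of_ne hz' ?_ h4
        intro hp
        have h7 := interior_mem_nearPole hv hv0 h6
        have h8 : (D.toLocal a z').2 = 0 := by cases a <;> simp [toLocal, hp]
        simp [h8] at h7
      · exact (added_mem_regular hv' hs').2 h4

end FourPointData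

namespace FourPointData

open Filter Topology

variable {D : FourPointData}

/-! ### The regular part of a fibre and the Weierstrass curve -/

/-- The points which do not lie over `x = ∞`. -/
def IsFinite : HitchinSurface D → Prop
  | .interior _ _ => True
  | .added a _ _ _ _ => a ≠ .infty

variable (D) in
/-- The coordinate `x` of a puncture (zero at infinity). -/
def location : Puncture → ℂ
  | .zero => 0
  | .one => 1
  | .t => D.t
  | .infty => 0

/-- The coordinate `x` at a finite point. -/
def xCoord : HitchinSurface D → ℂ
  | .interior z _ => z.1
  | .added a _ _ _ _ => D.location a

/-- The coordinate `y` at a finite point. -/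
def yCoord : HitchinSurface D → ℂ
  | .interior z _ => D.cubic z.1 * z.2
  | .added a v _ _ _ => D.C a 0 * v

/-- The coordinate `w = s x² - y` at a finite point. -/
def wCoord (m : HitchinSurface D) : ℂ := D.s * xCoord m ^ 2 - yCoord m

open Classical in
/-- The point of the Weierstrass curve of the fibre over `b` given by a point of this fibre. -/
def pt (b : ℂ) (m : HitchinSurface D) : (D.quart b).W.toAffine.Point :=
  if IsFinite m then (D.quart b).toPoint (xCoord m) (wCoord m)
  else if m ∈ D.N then 0 else (D.quart b).inftyPoint

lemma pt_of_finite {m : HitchinSurface D} (h : IsFinite m) (b : ℂ) :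
    pt b m = (D.quart b).toPoint (xCoord m) (wCoord m) := if_pos h

lemma mem_N_iff {a : Puncture} {v b : ℂ} (hv) (hs) :
    (.added a v b hv hs : HitchinSurface D) ∈ D.N ↔ a = .infty ∧ v = D.s := by
  constructor
  · rintro ⟨b', hv', hs', h⟩
    cases h
    exact ⟨rfl, rfl⟩
  · rintro ⟨rfl, rfl⟩
    exact ⟨b, hv, hs, rfl⟩

lemma not_isFinite_of_mem_N {m : HitchinSurface D} (h : m ∈ D.N) : ¬ IsFinite m := by
  obtain ⟨b, hv, hs, rfl⟩ := h
  exact fun h => h rfl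

lemma pt_of_mem_N {m : HitchinSurface D} (h : m ∈ D.N) (b : ℂ) : pt b m = 0 := by
  rw [pt, if_neg (not_isFinite_of_mem_N h), if_pos h]

/-- The term with `b` contains the factor `x (x - 1) (x - t)`, so all fibres have the same values of
`y` over a finite puncture. -/
lemma eval_location {a : Puncture} (ha : a ≠ .infty) (b : ℂ) :
    (D.quart b).eval (D.location a) = (D.C a 0 * D.κ a) ^ 2 := by
  cases a
  · simp only [quart_eval, location, quartic, C, κ]; ring
  · simp only [quart_eval, location, quartic, C, κ]; ring
  · simp only [quart_eval, location, quartic, C, κ]; ring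
  · exact (ha rfl).elim

/-- This is the derivative of the quartic at a branch point over a puncture. It vanishes exactly for
the value of `b` omitted from the surface. -/
lemma deriv_location {a : Puncture} (ha : a ≠ .infty) (hκ : D.κ a = 0) (b : ℂ) :
    4 * D.s * D.location a * (D.s * D.location a ^ 2) + 3 * (D.quart b).a * D.location a ^ 2
      + 2 * (D.quart b).c * D.location a + (D.quart b).d = D.C a 0 * (b - D.β a) := by
  cases a
  · simp only [κ] at hκ
    simp only [location, quart, C, β, hκ]; ring
  · simp only [κ] at hκ
    simp only [location, quart, C, β, hκ]; ring
  · simp only [κ] at hκ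
    simp only [location, quart, C, β, hκ]; ring
  · exact (ha rfl).elim

lemma onCurve_of_finite {m : HitchinSurface D} (h : IsFinite m) :
    (D.quart (D.f m)).OnCurve (xCoord m) (wCoord m) := by
  rw [SquareQuartic.onCurve_iff]
  have h1 : (D.quart (D.f m)).s * xCoord m ^ 2 - wCoord m = yCoord m := by
    unfold wCoord
    exact sub_sub_cancel _ _
  rw [h1]
  rcases m with ⟨z, hz⟩ | ⟨a, v, b, hv, hs⟩
  · exact (f₀_eq_iff hz).1 rfl
  · refine Eq.trans ?_ (eval_location h _).symm
    simp only [yCoord]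
    rw [mul_pow, mul_pow, hv]

lemma smooth_of_finite {m : HitchinSurface D} (h : IsFinite m) (hm : m ∈ D.regular) :
    (D.quart (D.f m)).Smooth (xCoord m) (wCoord m) := by
  rcases m with ⟨z, hz⟩ | ⟨a, v, b, hv, hs⟩
  · exact ((interior_mem_regular hz).1 hm).1
  · by_cases hv0 : v = 0
    · right
      have hκ : D.κ a = 0 := by simpa [hv0] using hv.symm
      have hw : wCoord (.added a v b hv hs) = D.s * D.location a ^ 2 := by
        simp [wCoord, xCoord, yCoord, hv0]
      rw [hw]
      refine ne_of_eq_of_ne (deriv_location h hκ _) (mul_ne_zero (D.C_ne_zero a) ?_)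
      exact sub_ne_zero.2 (hs.resolve_left (not_not.2 hv0))
    · refine SquareQuartic.smooth_of_ne fun h1 => mul_ne_zero (D.C_ne_zero a) hv0 ?_
      have h2 : D.s * D.location a ^ 2 - D.C a 0 * v = D.s * D.location a ^ 2 := h1
      linear_combination -h2

lemma location_ne {a a' : Puncture} (ha : a ≠ .infty) (ha' : a' ≠ .infty)
    (h : D.location a = D.location a') : a = a' := by
  have h0 := D.t_ne_zero
  have h1 := D.t_ne_one
  cases a <;> cases a' <;> simp_all [location]

lemma location_notMem_base {a : Puncture} {z : ℂ × ℂ} (ha : a ≠ .infty) (hz : z ∈ D.base) :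
    z.1 ≠ D.location a := by
  obtain ⟨h0, h1, h2⟩ := hz
  cases a
  exacts [h0, h1, h2, (ha rfl).elim]

lemma ext_of_finite {m m' : HitchinSurface D} (h : IsFinite m) (h' : IsFinite m')
    (hf : D.f m = D.f m') (hx : xCoord m = xCoord m') (hy : yCoord m = yCoord m') : m = m' := by
  rcases m with ⟨z, hz⟩ | ⟨a, v, b, hv, hs⟩ <;> rcases m' with ⟨z', hz'⟩ | ⟨a', v', b', hv', hs'⟩
  · have h1 : z.1 = z'.1 := hx
    have h2 : D.cubic z.1 * z.2 = D.cubic z'.1 * z'.2 := hy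
    rw [← h1] at h2
    obtain rfl : z = z' := Prod.ext h1 (mul_left_cancel₀ (cubic_ne_zero hz) h2)
    rfl
  · exact (location_notMem_base h' hz hx).elim
  · exact (location_notMem_base h hz' hx.symm).elim
  · obtain rfl := location_ne h h' hx
    obtain rfl : v = v' := mul_left_cancel₀ (D.C_ne_zero a) hy
    obtain rfl : b = b' := hf
    rfl

lemma ext_of_not_finite {m m' : HitchinSurface D} (h : ¬ IsFinite m) (h' : ¬ IsFinite m')
    (hf : D.f m = D.f m') (hN : m ∈ D.N ↔ m' ∈ D.N) : m = m' := by
  rcases m with ⟨z, hz⟩ | ⟨a, v, b, hv, hs⟩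
  · exact (h trivial).elim
  rcases m' with ⟨z', hz'⟩ | ⟨a', v', b', hv', hs'⟩
  · exact (h' trivial).elim
  obtain rfl : a = .infty := not_not.1 h
  obtain rfl : a' = .infty := not_not.1 h'
  obtain rfl : b = b' := hf
  rw [mem_N_iff, mem_N_iff] at hN
  simp only [true_and] at hN
  obtain rfl : v = v' := by
    rcases sq_eq_sq_iff_eq_or_eq_neg.1 hv with h1 | h1 <;>
      rcases sq_eq_sq_iff_eq_or_eq_neg.1 hv' with h2 | h2
    · exact h1.trans h2.symm
    · exact h1.trans (hN.1 h1).symm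
    · exact (hN.2 h2).trans h2.symm
    · exact h1.trans h2.symm
  rfl

/-- For `s = 0` every point at infinity is in `N`. Hence `s ≠ 0`, and the point is the one with `y ~
s x²`. -/
lemma pt_of_not_finite {m : HitchinSurface D} (hm : ¬ IsFinite m) (hN : m ∉ D.N)
    (hb : (D.quart (D.f m)).Good) : ∃ hs : D.s ≠ 0, pt (D.f m) m =
      .some _ _ (SquareQuartic.nonsingular_infty hb hs) := by
  have hs : D.s ≠ 0 := by
    rcases m with ⟨z, hz⟩ | ⟨a, v, b, hv, hs⟩
    · exact (hm trivial).elim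
    · intro hs0
      obtain rfl : a = .infty := not_not.1 hm
      refine hN ((mem_N_iff hv _).2 ⟨rfl, ?_⟩)
      have hv' : v ^ 2 = D.s ^ 2 := hv
      simpa [hs0] using hv'
  refine ⟨hs, ?_⟩
  rw [pt, if_neg hm, if_neg hN, SquareQuartic.inftyPoint_eq hb hs]

/-- Different regular points of a fibre give different points of the Weierstrass curve. -/
theorem pt_injective {m m' : HitchinSurface D} (hb : (D.quart (D.f m)).Good) (hm : m ∈ D.regular)
    (hm' : m' ∈ D.regular) (hf : D.f m' = D.f m) (h : pt (D.f m) m = pt (D.f m) m') : m = m' := by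
  -- A finite point is neither zero nor the second point at infinity of the Weierstrass curve.
  have aux : ∀ m m' : HitchinSurface D, m ∈ D.regular → m' ∈ D.regular → D.f m' = D.f m →
      (D.quart (D.f m)).Good → IsFinite m → ¬ IsFinite m' → pt (D.f m) m ≠ pt (D.f m) m' := by
    intro m m' hm hm' hf hb h1 h2 h
    have hc := onCurve_of_finite h1
    have hsm := smooth_of_finite h1 hm
    rw [pt_of_finite h1] at h
    by_cases hN : m' ∈ D.N
    · rw [pt_of_mem_N hN] at h
      exact SquareQuartic.toPoint_ne_zero hb hc hsm h
    · rw [← hf] at h hb hc hsm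
      obtain ⟨hs, h3⟩ := pt_of_not_finite h2 hN hb
      rw [h3, SquareQuartic.toPoint_eq (hc.nonsingular hb hsm),
        WeierstrassCurve.Affine.Point.some.injEq] at h
      exact hc.ne_infty hb hs h.1 h.2
  by_cases h1 : IsFinite m <;> by_cases h2 : IsFinite m'
  · have hc := onCurve_of_finite h2
    have hsm := smooth_of_finite h2 hm'
    rw [pt_of_finite h1, pt_of_finite h2] at h
    rw [hf] at hc hsm
    obtain ⟨hx, hw⟩ := SquareQuartic.toPoint_inj hb (onCurve_of_finite h1) hc
      (smooth_of_finite h1 hm) hsm h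
    refine ext_of_finite h1 h2 hf.symm hx ?_
    unfold wCoord at hw
    rw [hx] at hw
    linear_combination -hw
  · exact (aux m m' hm hm' hf hb h1 h2 h).elim
  · refine (aux m' m hm' hm hf.symm (hf ▸ hb) h2 h1 ?_).elim
    rw [hf]
    exact h.symm
  · refine ext_of_not_finite h1 h2 hf.symm ?_
    by_cases h3 : m ∈ D.N <;> by_cases h4 : m' ∈ D.N
    · exact iff_of_true h3 h4
    · rw [pt_of_mem_N h3] at h
      rw [← hf] at h hb
      obtain ⟨hs, h5⟩ := pt_of_not_finite h2 h4 hb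
      rw [h5] at h
      exact (WeierstrassCurve.Affine.Point.some_ne_zero _ h.symm).elim
    · rw [pt_of_mem_N h4] at h
      obtain ⟨hs, h5⟩ := pt_of_not_finite h1 h3 hb
      rw [h5] at h
      exact (WeierstrassCurve.Affine.Point.some_ne_zero _ h).elim
    · exact iff_of_false h3 h4

/-- Over a puncture the root is `v = y / C (0)`. Smoothness keeps the point away from the omitted
one when `κ = 0`. -/
lemma exists_of_onCurve {b x w : ℂ} (hb : ¬ D.IsReducible b) (h : (D.quart b).OnCurve x w)
    (hs : (D.quart b).Smooth x w) : ∃ m ∈ D.regular, D.f m = b ∧ IsFinite m ∧ xCoord m = x ∧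
      wCoord m = w := by
  have hsq := SquareQuartic.onCurve_iff.1 h
  have hs' : (D.quart b).s = D.s := rfl
  by_cases hx : ∃ a, a ≠ .infty ∧ x = D.location a
  · obtain ⟨a, ha, rfl⟩ := hx
    rw [eval_location ha, hs'] at hsq
    have hC := D.C_ne_zero a
    obtain ⟨v, hv⟩ : ∃ v, D.C a 0 * v = D.s * D.location a ^ 2 - w := ⟨_, mul_div_cancel₀ _ hC⟩
    rw [← hv, mul_pow, mul_pow] at hsq
    have hv2 : v ^ 2 = D.κ a ^ 2 := mul_left_cancel₀ (pow_ne_zero 2 hC) hsq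
    have hvb : v ≠ 0 ∨ b ≠ D.β a := by
      by_contra! hc
      obtain ⟨rfl, rfl⟩ := hc
      have hκ : D.κ a = 0 := by simpa using hv2.symm
      have hw : w = D.s * D.location a ^ 2 := by linear_combination hv
      rcases hs with hs | hs
      · exact hs (by rw [hw, hs', sub_self])
      · refine hs ?_
        rw [hw]
        exact (deriv_location ha hκ _).trans (by rw [sub_self, mul_zero])
    refine ⟨.added a v b hv2 hvb, (added_mem_regular hv2 hvb).2 hb, rfl, ha, rfl, ?_⟩
    simp only [wCoord, xCoord, yCoord, hv]
    ring
  · push Not at hx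
    have hz : ∀ p, (x, p) ∈ D.base := fun p =>
      ⟨hx .zero (by simp), hx .one (by simp), hx .t (by simp)⟩
    have hA := cubic_ne_zero (hz 0)
    obtain ⟨p, hp⟩ : ∃ p, D.cubic x * p = D.s * x ^ 2 - w := ⟨_, mul_div_cancel₀ _ hA⟩
    have hf : D.f₀ x p = b := (f₀_eq_iff (hz p)).2 (by simp only [hp]; exact hsq)
    have hw : D.s * x ^ 2 - D.cubic x * p = w := by rw [hp]; ring
    refine ⟨.interior (x, p) (hz p), (interior_mem_regular (hz p)).2 ?_, hf, trivial, rfl, hw⟩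
    simp only [hf, hw]
    exact ⟨hs, hb⟩

lemma exists_mem_N {b : ℂ} (hb : (D.quart b).Good) :
    ∃ m ∈ D.N, m ∈ D.regular ∧ D.f m = b := by
  obtain ⟨h1, h2⟩ := good_iff.1 hb
  have h3 : D.s ≠ 0 ∨ b ≠ D.β .infty := by
    by_cases hs : D.s = 0
    · simpa [β, hs] using h2
    · exact .inl hs
  exact ⟨.added .infty D.s b rfl h3, ⟨_, _, _, rfl⟩, (added_mem_regular _ _).2 h1, rfl⟩

/-- Every point of the Weierstrass curve comes from a regular point of the fibre. -/
theorem pt_surjective {b : ℂ} (hb : (D.quart b).Good) (P : (D.quart b).W.toAffine.Point) :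
    ∃ m ∈ D.regular, D.f m = b ∧ pt b m = P := by
  have hr := (good_iff.1 hb).1
  rcases P with _ | ⟨X, Y, h⟩
  · obtain ⟨m, h1, h2, h3⟩ := exists_mem_N hb
    exact ⟨m, h2, h3, pt_of_mem_N h1 b⟩
  rcases SquareQuartic.exists_of_nonsingular hb h with ⟨x, w, hc, hs, rfl, rfl⟩ | ⟨hs, rfl, rfl⟩
  · obtain ⟨m, h1, h2, h3, rfl, rfl⟩ := exists_of_onCurve hr hc hs
    exact ⟨m, h1, h2, (pt_of_finite h3 b).trans (SquareQuartic.toPoint_eq h)⟩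
  · have hs' : D.s ≠ 0 := hs
    have hv : (-D.s) ^ 2 = D.κ .infty ^ 2 := by simp [κ]
    let m : HitchinSurface D := .added .infty (-D.s) b hv (.inl (neg_ne_zero.2 hs'))
    have hN : m ∉ D.N := fun h => by
      have := ((mem_N_iff hv _).1 h).2
      exact hs' (by linear_combination -this / 2)
    obtain ⟨_, h3⟩ := pt_of_not_finite (m := m) (fun h => h rfl) hN hb
    exact ⟨m, (added_mem_regular _ _).2 hr, rfl, h3⟩

end FourPointData

/-! ### The sum in Jacobian coordinates. -/

namespace SquareQuartic

open WeierstrassCurve Filter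

variable {q : SquareQuartic}

/-- The `X`-coordinate of the sum of two points of the Weierstrass curve in Jacobian coordinates. -/
def sumX (q : SquareQuartic) (J J' : Fin 3 → ℂ) : ℂ :=
  q.W.toJacobian.addX J J' / Jacobian.addZ J J' ^ 2

/-- The `Y`-coordinate of the sum of two points of the Weierstrass curve in Jacobian coordinates. -/
def sumY (q : SquareQuartic) (J J' : Fin 3 → ℂ) : ℂ :=
  q.W.toJacobian.addY J J' / Jacobian.addZ J J' ^ 3

/-- The sum, as a point `(x, w)` of the quartic. -/
def sumPoint (q : SquareQuartic) (J J' : Fin 3 → ℂ) : ℂ × ℂ :=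
  ((2 * q.s * q.sumY J J' - q.a * q.sumX J J') / q.delta (q.sumX J J'),
    (2 * q.s * (q.sumX J J' + q.c) * q.sumX J J' - q.a * q.sumY J J') / q.delta (q.sumX J J'))

/-- The same rational expression covers a summand which is zero (`Z = 0`). This is why Jacobian
coordinates are used. -/
lemma toAffine_add_eq {J J' : Fin 3 → ℂ} (h : q.W.toJacobian.Nonsingular J)
    (h' : q.W.toJacobian.Nonsingular J') (hz : Jacobian.addZ J J' ≠ 0) :
    ∃ hn : q.W.toAffine.Nonsingular (q.sumX J J') (q.sumY J J'),
      Jacobian.Point.toAffine q.W J + Jacobian.Point.toAffine q.W J' = .some _ _ hn := by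
  have h1 := Jacobian.Point.toAffine_add h h'
  have h2 := Jacobian.nonsingular_add h h'
  rw [Jacobian.add_of_not_equiv fun he => hz (sub_eq_zero.2 (Jacobian.X_eq_of_equiv he))] at h1 h2
  have hz' : q.W.toJacobian.addXYZ J J' 2 ≠ 0 := hz
  exact ⟨(Jacobian.nonsingular_of_Z_ne_zero hz').1 h2,
    h1.symm.trans (Jacobian.Point.toAffine_of_Z_ne_zero h2 hz')⟩

theorem sumPoint_spec {J J' : Fin 3 → ℂ} (h : q.W.toJacobian.Nonsingular J)
    (h' : q.W.toJacobian.Nonsingular J') (hz : Jacobian.addZ J J' ≠ 0)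
    (hd : q.delta (q.sumX J J') ≠ 0) :
    q.OnCurve (q.sumPoint J J').1 (q.sumPoint J J').2 ∧
    q.Smooth (q.sumPoint J J').1 (q.sumPoint J J').2 ∧
    q.toPoint (q.sumPoint J J').1 (q.sumPoint J J').2 =
      Jacobian.Point.toAffine q.W J + Jacobian.Point.toAffine q.W J' := by
  obtain ⟨hn, hs⟩ := toAffine_add_eq h h' hz
  obtain ⟨h1, h2, h3⟩ := onCurve_of_delta_ne_zero hn.1 hd
  have h2' : q.X (q.sumPoint J J').1 (q.sumPoint J J').2 = q.sumX J J' := h2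
  have h3' : q.Y (q.sumPoint J J').1 (q.sumPoint J J').2 = q.sumY J J' := h3
  have hn' : q.W.toAffine.Nonsingular (q.X (q.sumPoint J J').1 (q.sumPoint J J').2)
      (q.Y (q.sumPoint J J').1 (q.sumPoint J J').2) := by rwa [h2', h3']
  refine ⟨h1, OnCurve.smooth_of_nonsingular h1 hn', ?_⟩
  rw [hs, toPoint_eq hn', Affine.Point.some.injEq]
  exact ⟨h2', h3'⟩

/-- `addZ` is the difference of the affine `X`-coordinates with denominators cleared, and points
with equal `X` are equal or opposite. -/
lemma addZ_ne_zero {J J' : Fin 3 → ℂ} (h : q.W.toJacobian.Nonsingular J)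
    (h' : q.W.toJacobian.Nonsingular J')
    (hne : Jacobian.Point.toAffine q.W J ≠ Jacobian.Point.toAffine q.W J')
    (hne' : Jacobian.Point.toAffine q.W J + Jacobian.Point.toAffine q.W J' ≠ 0) :
    Jacobian.addZ J J' ≠ 0 := by
  intro hz
  have hz' : J 0 * J' 2 ^ 2 = J' 0 * J 2 ^ 2 := sub_eq_zero.1 hz
  -- For `Z = 0` the equation is `Y² = X³`, so `X = 0` would leave only the zero vector.
  have hX : ∀ {K : Fin 3 → ℂ}, q.W.toJacobian.Nonsingular K → K 2 = 0 → K 0 ≠ 0 := by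
    intro K hK h0 h1
    have h2 := (Jacobian.nonsingular_of_Z_eq_zero h0).1 hK
    have h3 := (Jacobian.equation_of_Z_eq_zero h0).1 h2.1
    have h4 : K 1 = 0 := by
      rw [h1] at h3
      simpa using h3
    simp [h1, h4, W] at h2
  by_cases h0 : J 2 = 0
  · have h1 : J' 2 = 0 := by
      rw [h0] at hz'
      simpa [hX h h0] using hz'
    exact hne ((Jacobian.Point.toAffine_of_Z_eq_zero h0).trans
      (Jacobian.Point.toAffine_of_Z_eq_zero h1).symm)
  · have h1 : J' 2 ≠ 0 := by
      intro h1
      rw [h1] at hz'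
      have : J' 0 * J 2 ^ 2 ≠ 0 := mul_ne_zero (hX h' h1) (pow_ne_zero _ h0)
      exact this (by rw [← hz']; ring)
    rw [Jacobian.Point.toAffine_of_Z_ne_zero h h0, Jacobian.Point.toAffine_of_Z_ne_zero h' h1]
      at hne hne'
    have hXX : J 0 / J 2 ^ 2 = J' 0 / J' 2 ^ 2 :=
      (div_eq_div_iff (pow_ne_zero _ h0) (pow_ne_zero _ h1)).2 hz'
    rcases Affine.Y_eq_of_X_eq ((Jacobian.nonsingular_of_Z_ne_zero h0).1 h).1
      ((Jacobian.nonsingular_of_Z_ne_zero h1).1 h').1 hXX with hY | hY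
    · exact hne (by rw [Affine.Point.some.injEq]; exact ⟨hXX, hY⟩)
    · exact hne' (Affine.Point.add_of_Y_eq hXX hY)

/-- If the sum is in general position, then the formula for the sum applies. -/
theorem sumPoint_of_isNice (hq : q.Good) {J J' : Fin 3 → ℂ} (h : q.W.toJacobian.Nonsingular J)
    (h' : q.W.toJacobian.Nonsingular J')
    (hne : Jacobian.Point.toAffine q.W J ≠ Jacobian.Point.toAffine q.W J') {E : Set ℂ} {x w : ℂ}
    (hn : q.IsNice E x w)
    (he : q.toPoint x w = Jacobian.Point.toAffine q.W J + Jacobian.Point.toAffine q.W J') :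
    Jacobian.addZ J J' ≠ 0 ∧ q.delta (q.sumX J J') ≠ 0 ∧ q.sumPoint J J' = (x, w) := by
  have hz := addZ_ne_zero h h' hne (he ▸ toPoint_ne_zero hq hn.1 hn.smooth)
  obtain ⟨hns, hs⟩ := toAffine_add_eq h h' hz
  have hd : q.delta (q.sumX J J') ≠ 0 := by
    rw [hs, toPoint_eq (hn.1.nonsingular hq hn.smooth), Affine.Point.some.injEq] at he
    rw [← he.1]
    exact hn.delta
  obtain ⟨h1, h2, h3⟩ := sumPoint_spec h h' hz hd
  rw [← he] at h3
  obtain ⟨h4, h5⟩ := toPoint_inj hq h1 hn.1 h2 hn.smooth h3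
  exact ⟨hz, hd, Prod.ext h4 h5⟩

end SquareQuartic

/-! ### Holomorphic Jacobian coordinates on the surface. -/

namespace FourPointData

open Filter Topology WeierstrassCurve

variable {D : FourPointData}

section

variable {F : Type*} [NormedAddCommGroup F] [NormedSpace ℂ F] {n : ℕ∞ω}

lemma contDiffAt_sumX {b : F → ℂ} {J J' : F → Fin 3 → ℂ} {v : F} (hb : ContDiffAt ℂ n b v)
    (hJ : ContDiffAt ℂ n J v) (hJ' : ContDiffAt ℂ n J' v) (hz : Jacobian.addZ (J v) (J' v) ≠ 0) :
    ContDiffAt ℂ n (fun v => (D.quart (b v)).sumX (J v) (J' v)) v ∧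
    ContDiffAt ℂ n (fun v => (D.quart (b v)).sumY (J v) (J' v)) v := by
  have h0 := fun i => contDiffAt_pi.1 hJ i
  have h1 := fun i => contDiffAt_pi.1 hJ' i
  unfold Jacobian.addZ at hz
  constructor
  · unfold SquareQuartic.sumX Jacobian.addX Jacobian.addZ
    simp only [SquareQuartic.W, quart]
    have h2 := pow_ne_zero 2 hz
    fun_prop (disch := assumption)
  · unfold SquareQuartic.sumY Jacobian.addY Jacobian.negAddY Jacobian.addX Jacobian.addZ
    simp only [Jacobian.negY, SquareQuartic.W, quart]
    have h2 := pow_ne_zero 3 hz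
    simp only [Matrix.cons_val]
    fun_prop (disch := assumption)

lemma contDiffAt_sumPoint {b : F → ℂ} {J J' : F → Fin 3 → ℂ} {v : F} (hb : ContDiffAt ℂ n b v)
    (hJ : ContDiffAt ℂ n J v) (hJ' : ContDiffAt ℂ n J' v) (hz : Jacobian.addZ (J v) (J' v) ≠ 0)
    (hd : (D.quart (b v)).delta ((D.quart (b v)).sumX (J v) (J' v)) ≠ 0) :
    ContDiffAt ℂ n (fun v => (D.quart (b v)).sumPoint (J v) (J' v)) v := by
  obtain ⟨h1, h2⟩ := contDiffAt_sumX (D := D) hb hJ hJ' hz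
  have h3 : ContDiffAt ℂ n (fun v => (D.quart (b v)).delta ((D.quart (b v)).sumX (J v) (J' v))) v := by
    unfold SquareQuartic.delta
    simp only [quart] at h1 ⊢
    fun_prop
  unfold SquareQuartic.sumPoint
  have h4 : ContDiffAt ℂ n (fun v => (D.quart (b v)).a) v := by
    simp only [quart]
    fun_prop
  have h5 : ContDiffAt ℂ n (fun v => (D.quart (b v)).c) v := by
    simp only [quart]
    fun_prop
  have h6 : ContDiffAt ℂ n (fun v => (D.quart (b v)).s) v := contDiffAt_const
  fun_prop (disch := assumption)

end

/-- `J` is a vector of Jacobian coordinates of the point of the Weierstrass curve given by `m`. -/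
def IsRep (J : Fin 3 → ℂ) (m : HitchinSurface D) : Prop :=
  (D.quart (D.f m)).W.toJacobian.Nonsingular J ∧
    Jacobian.Point.toAffine (D.quart (D.f m)).W J = pt (D.f m) m

lemma isRep_of_eq_some {J : Fin 3 → ℂ} {m : HitchinSurface D} {X Y : ℂ}
    {h : (D.quart (D.f m)).W.toAffine.Nonsingular X Y} (hm : pt (D.f m) m = .some X Y h)
    (hz : J 2 ≠ 0) (hx : J 0 = X * J 2 ^ 2) (hy : J 1 = Y * J 2 ^ 3) : IsRep J m := by
  have hx' : J 0 / J 2 ^ 2 = X := by rw [hx, mul_div_cancel_right₀ _ (pow_ne_zero _ hz)]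
  have hy' : J 1 / J 2 ^ 3 = Y := by rw [hy, mul_div_cancel_right₀ _ (pow_ne_zero _ hz)]
  have hn : (D.quart (D.f m)).W.toJacobian.Nonsingular J := by
    rw [Jacobian.nonsingular_of_Z_ne_zero hz, hx', hy']
    exact h
  refine ⟨hn, ?_⟩
  rw [Jacobian.Point.toAffine_of_Z_ne_zero hn hz, hm, Affine.Point.some.injEq]
  exact ⟨hx', hy'⟩

lemma isRep_of_finite {J : Fin 3 → ℂ} {m : HitchinSurface D} (hm : m ∈ D.regular)
    (hb : (D.quart (D.f m)).Good) (hfin : IsFinite m) (hz : J 2 ≠ 0)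
    (hx : J 0 = (D.quart (D.f m)).X (xCoord m) (wCoord m) * J 2 ^ 2)
    (hy : J 1 = (D.quart (D.f m)).Y (xCoord m) (wCoord m) * J 2 ^ 3) : IsRep J m :=
  isRep_of_eq_some ((pt_of_finite hfin _).trans (SquareQuartic.toPoint_eq
    ((onCurve_of_finite hfin).nonsingular hb (smooth_of_finite hfin hm)))) hz hx hy

lemma isRep_of_mem_N {J : Fin 3 → ℂ} {m : HitchinSurface D} (hN : m ∈ D.N) (hz : J 2 = 0)
    (hx : J 0 ≠ 0) (he : J 1 ^ 2 = J 0 ^ 3) : IsRep J m := by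
  refine ⟨?_, ?_⟩
  · rw [Jacobian.nonsingular_of_Z_eq_zero hz, Jacobian.equation_of_Z_eq_zero hz]
    exact ⟨he, .inl (by simpa using hx)⟩
  · rw [pt_of_mem_N hN, Jacobian.Point.toAffine_of_Z_eq_zero hz]

/-- The puncture of a chart; the main chart does not have one. -/
def chartPuncture : D.ChartIndex → Option Puncture
  | .main => none
  | .pole a _ _ _ => some a
  | .branch a _ => some a

/-- The coordinate `x` in a chart over the finite part of the line. -/
def xChart : D.ChartIndex → ℂ × ℂ → ℂ
  | .main, z => z.1
  | .pole a _ _ _, z => D.location a + z.1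
  | .branch a _, z => D.location a + z.2 * z.1 ^ 2

/-- The coordinate `y` in a chart over the finite part of the line. -/
def yChart : D.ChartIndex → ℂ × ℂ → ℂ
  | .main, z => D.cubic z.1 * z.2
  | .pole a v _ _, z => D.C a z.1 * (v + z.1 * z.2)
  | .branch a _, z => D.C a (z.2 * z.1 ^ 2) * (z.2 * z.1)

lemma contDiff_xChart {n : ℕ∞ω} (i : D.ChartIndex) : ContDiff ℂ n (xChart i) := by
  cases i with
  | main => exact contDiff_fst
  | pole a v hv hv0 => exact (by fun_prop : ContDiff ℂ n fun z : ℂ × ℂ => D.location a + z.1)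
  | branch a hκ =>
    exact (by fun_prop : ContDiff ℂ n fun z : ℂ × ℂ => D.location a + z.2 * z.1 ^ 2)

lemma contDiff_yChart {n : ℕ∞ω} (i : D.ChartIndex) : ContDiff ℂ n (yChart i) := by
  have hC := fun a => contDiff_C (D := D) (n := n) a
  cases i with
  | main =>
    exact (by fun_prop : ContDiff ℂ n fun z : ℂ × ℂ => z.1 * (z.1 - 1) * (z.1 - D.t) * z.2)
  | pole a v hv hv0 =>
    have := hC a
    exact (by fun_prop : ContDiff ℂ n fun z : ℂ × ℂ => D.C a z.1 * (v + z.1 * z.2))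
  | branch a hκ =>
    have := hC a
    exact (by fun_prop : ContDiff ℂ n fun z : ℂ × ℂ => D.C a (z.2 * z.1 ^ 2) * (z.2 * z.1))

lemma ofLocal_finite {a : Puncture} (ha : a ≠ .infty) (z : ℂ × ℂ) :
    (D.ofLocal a z).1 = D.location a + z.1 ∧ (D.ofLocal a z).2 = z.2 ∧
      D.cubic (D.location a + z.1) = z.1 * D.C a z.1 := by
  cases a
  · simp [ofLocal, location, cubic, C, mul_assoc]
  · refine ⟨rfl, rfl, ?_⟩
    simp only [location, cubic, C]
    ring
  · refine ⟨rfl, rfl, ?_⟩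
    simp only [location, cubic, C]
    ring
  · exact (ha rfl).elim

lemma chartInv_finite {i : D.ChartIndex} (hi : chartPuncture i ≠ some .infty) {z : ℂ × ℂ}
    (hz : z ∈ chartTarget i) : IsFinite (chartInv i z) ∧ xCoord (chartInv i z) = xChart i z ∧
      yCoord (chartInv i z) = yChart i z := by
  by_cases h : z ∈ innerTarget i
  · rw [chartInv_inner h]
    refine ⟨trivial, ?_⟩
    simp only [xCoord, yCoord]
    cases i with
    | main => exact ⟨rfl, rfl⟩
    | pole a v hv hv0 =>
      have ha : a ≠ .infty := fun h => hi (by rw [chartPuncture, h])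
      obtain ⟨h1, h2, h3⟩ := ofLocal_finite (D := D) ha (z.1, v / z.1 + z.2)
      have h0 := h.1
      simp only [innerInv, xChart, yChart, h1, h2, h3, true_and]
      field_simp
    | branch a hκ =>
      have ha : a ≠ .infty := fun h => hi (by rw [chartPuncture, h])
      obtain ⟨h1, h2, h3⟩ := ofLocal_finite (D := D) ha (z.2 * z.1 ^ 2, z.1⁻¹)
      have h0 := h.1
      simp only [innerInv, xChart, yChart, h1, h2, h3, true_and]
      field_simp
  · cases i with
    | main => exact (h hz).elim
    | pole a v hv hv0 =>
      have h1 : z.1 = 0 := by_contra fun h1 => h ⟨h1, hz⟩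
      have ha : a ≠ .infty := fun h => hi (by rw [chartPuncture, h])
      rw [chartInv_pole hv hv0 h1]
      exact ⟨ha, by simp [xCoord, xChart, h1], by simp [yCoord, yChart, h1]⟩
    | branch a hκ =>
      have h1 : z.1 = 0 := by_contra fun h1 => h ⟨h1, hz⟩
      have ha : a ≠ .infty := fun h => hi (by rw [chartPuncture, h])
      rw [chartInv_branch hκ h1 hz.1]
      exact ⟨ha, by simp [xCoord, xChart, h1], by simp [yCoord, yChart, h1]⟩

lemma ofLocal_infty {z : ℂ × ℂ} (h : z.1 ≠ 0) : (D.ofLocal .infty z).1 = z.1⁻¹ ∧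
    D.cubic (D.ofLocal .infty z).1 * (D.ofLocal .infty z).2 = -D.C .infty z.1 * z.2 / z.1 := by
  refine ⟨rfl, ?_⟩
  have h3 : z.1⁻¹ - 1 = (1 - z.1) / z.1 := by field_simp
  have h4 : z.1⁻¹ - D.t = (1 - D.t * z.1) / z.1 := by field_simp
  simp only [ofLocal, cubic, C, h3, h4]
  field_simp

/-- Near each regular point there are holomorphic Jacobian coordinates. -/
theorem exists_isRep {m₀ : HitchinSurface D} {i : D.ChartIndex} (hi : chartSource i m₀) :
    ∃ J : ℂ × ℂ → Fin 3 → ℂ, (∀ n : ℕ∞ω, ContDiffAt ℂ n J (chartMap i m₀)) ∧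
      ∀ z ∈ chartTarget i, chartInv i z ∈ D.regular → (D.quart (D.f (chartInv i z))).Good →
        IsRep (J z) (chartInv i z) := by
  have ht := chartMap_mem hi
  have hf := fun n : ℕ∞ω => contDiffAt_fChart (n := n) ht
  by_cases hfin : chartPuncture i ≠ some .infty
  · refine ⟨fun z => ![(D.quart (fChart i z)).X (xChart i z) (D.s * xChart i z ^ 2 - yChart i z),
      (D.quart (fChart i z)).Y (xChart i z) (D.s * xChart i z ^ 2 - yChart i z), 1],
      fun n => contDiffAt_pi.2 fun j => ?_, fun z hz hm hb => ?_⟩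
    · have hx := (contDiff_xChart (n := n) i).contDiffAt (x := chartMap i m₀)
      have hy := (contDiff_yChart (n := n) i).contDiffAt (x := chartMap i m₀)
      have hf := hf n
      fin_cases j
      · simp [SquareQuartic.X, quart]
        fun_prop
      · simp [SquareQuartic.Y, quart]
        fun_prop
      · simpa using contDiffAt_const
    · obtain ⟨h1, h2, h3⟩ := chartInv_finite hfin hz
      refine isRep_of_finite hm hb h1 (by simp) ?_ ?_ <;>
        simp [wCoord, h2, h3, f_chartInv hz]
  rw [not_not] at hfin
  cases i with
  | main => simp [chartPuncture] at hfin
  | branch a hκ =>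
    obtain rfl : a = .infty := by simpa [chartPuncture] using hfin
    have hs0 : D.s = 0 := hκ
    -- Here `s = 0`, `a = f` and `x = 1 / (A r²)`. The vector consists of `X = f x` and `Y = -f y`,
    -- multiplied by `r²` and `r³`, and of `Z = r`; at `r = 0` it is `(1, 1, 0)` because `f = A`.
    refine ⟨fun z => ![fChart (.branch .infty hκ) z / z.2,
      fChart (.branch .infty hκ) z / z.2 * D.C .infty (z.2 * z.1 ^ 2), z.1],
      fun n => contDiffAt_pi.2 fun j => ?_, fun z hz hm hb => ?_⟩
    · have hf := hf n
      have hC := contDiff_C (D := D) (n := n) .infty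
      have h2 : (chartMap (.branch .infty hκ) m₀).2 ≠ 0 := ht.1
      fin_cases j
      · simp
        fun_prop (disch := assumption)
      · simp
        fun_prop (disch := assumption)
      · simp
        fun_prop
    · have h2 := hz.1
      by_cases h : z.1 = 0
      · have h3 : fChart (.branch .infty hκ) z = z.2 := by
          simp [fChart, h, regularPart_zero, β, hs0, C]
        refine isRep_of_mem_N ?_ h ?_ ?_
        · rw [chartInv_branch hκ h h2]
          exact (mem_N_iff _ _).2 ⟨rfl, hs0.symm⟩
        · simp [h3, h2]
        · simp [h3, h2, h, C]
      · have h' : z ∈ innerTarget (.branch .infty hκ) := ⟨h, hz⟩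
        have e := f_chartInv hz
        obtain ⟨e1, e2⟩ := ofLocal_infty (D := D) (z := (z.2 * z.1 ^ 2, z.1⁻¹))
          (mul_ne_zero h2 (pow_ne_zero _ h))
        have e3 : xCoord (chartInv (.branch .infty hκ) z) = (z.2 * z.1 ^ 2)⁻¹ := by
          rw [chartInv_inner h']
          exact e1
        have e4 : yCoord (chartInv (.branch .infty hκ) z) =
            -D.C .infty (z.2 * z.1 ^ 2) * z.1⁻¹ / (z.2 * z.1 ^ 2) := by
          rw [chartInv_inner h']
          exact e2
        have e5 : IsFinite (chartInv (.branch .infty hκ) z) := by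
          rw [chartInv_inner h']
          trivial
        refine isRep_of_finite hm hb e5 h ?_ ?_
        · simp [SquareQuartic.X, quart, e, e3, wCoord, e4, hs0]
          field_simp
        · simp [SquareQuartic.Y, quart, e, e3, wCoord, e4, hs0]
          field_simp
  | pole a v hv hv0 =>
    obtain rfl : a = .infty := by simpa [chartPuncture] using hfin
    have hv' : v ^ 2 = D.s ^ 2 := hv
    set i : D.ChartIndex := .pole .infty v hv hv0 with hi'
    have hC := fun n : ℕ∞ω => contDiff_C (D := D) (n := n) .infty
    have e5 : ∀ z ∈ chartTarget i, z.1 ≠ 0 → IsFinite (chartInv i z) ∧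
        xCoord (chartInv i z) = z.1⁻¹ ∧
        yCoord (chartInv i z) = -D.C .infty z.1 * (v + z.1 * z.2) / z.1 ^ 2 := by
      intro z hz h
      have h' : z ∈ innerTarget i := ⟨h, hz⟩
      obtain ⟨e1, e2⟩ := ofLocal_infty (D := D) (z := (z.1, v / z.1 + z.2)) h
      rw [chartInv_inner h']
      refine ⟨trivial, e1, ?_⟩
      refine e2.trans ?_
      field_simp
    have e0 : ∀ z ∈ chartTarget i, z.1 = 0 → chartInv i z =
        .added .infty v (2 * v * D.C .infty 0 * z.2 + D.β .infty) hv (.inl hv0) := fun z _ h =>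
      chartInv_pole hv hv0 h
    by_cases hvs : v = D.s
    · have hs0 : D.s ≠ 0 := hvs ▸ hv0
      -- Near `N` one has `x = 1 / ξ`, and `Z = ξ` clears the poles of order two and three of `X`
      -- and `Y`.
      refine ⟨fun z => ![2 * D.s * (D.s + D.C .infty z.1 * (v + z.1 * z.2))
          + (D.quart (fChart i z)).a * z.1,
        2 * D.s * (2 * D.s * (D.s + D.C .infty z.1 * (v + z.1 * z.2))
          + (D.quart (fChart i z)).a * z.1 + (D.quart (fChart i z)).c * z.1 ^ 2)
          + (D.quart (fChart i z)).a * z.1 * (D.s + D.C .infty z.1 * (v + z.1 * z.2)), z.1],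
        fun n => contDiffAt_pi.2 fun j => ?_, fun z hz hm hb => ?_⟩
      · have hf := hf n
        have hC := hC n
        fin_cases j
        · simp [quart]
          fun_prop
        · simp [quart]
          fun_prop
        · simp
          fun_prop
      · by_cases h : z.1 = 0
        · refine isRep_of_mem_N ?_ h ?_ ?_
          · rw [e0 z hz h]
            exact (mem_N_iff _ _).2 ⟨rfl, hvs⟩
          · have : D.s + D.s ≠ 0 := by rw [← two_mul]; exact mul_ne_zero two_ne_zero hs0
            simp [h, hvs, C, hs0, this]
          · simp [h, hvs, C]
            ring
        · obtain ⟨e1, e2, e3⟩ := e5 z hz h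
          have e := f_chartInv hz
          refine isRep_of_finite hm hb e1 h ?_ ?_
          · simp [SquareQuartic.X, quart, e, e2, wCoord, e3]
            field_simp
            ring
          · simp [SquareQuartic.Y, quart, e, e2, wCoord, e3]
            field_simp
            ring
    · have hvs' : v = -D.s := (sq_eq_sq_iff_eq_or_eq_neg.1 hv').resolve_left hvs
      have hs0 : D.s ≠ 0 := fun h => hv0 (by rw [hvs', h, neg_zero])
      -- At the other point at infinity `X` and `Y` are regular, but their definitions are
      -- differences of terms with poles. With `w` now standing for `ξ` times the coordinate `w`,
      -- the equation of the quartic gives `X = w² - c - d ξ - e ξ²` and `Y = w X - 2 s d - 2 s e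
      -- ξ`.
      refine ⟨fun z =>
        let w := (1 + D.t) * D.s - D.t * z.1 * D.s + D.C .infty z.1 * z.2
        let q := D.quart (fChart i z)
        let X := w ^ 2 - q.c - q.d * z.1 - q.e * z.1 ^ 2
        ![X, w * X - 2 * D.s * q.d - 2 * D.s * q.e * z.1, 1],
        fun n => contDiffAt_pi.2 fun j => ?_, fun z hz hm hb => ?_⟩
      · have hf := hf n
        have hC := hC n
        fin_cases j
        · simp [quart]
          fun_prop
        · simp [quart]
          fun_prop
        · simpa using contDiffAt_const
      · have e := f_chartInv hz
        by_cases h : z.1 = 0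
        · have hn : ¬ IsFinite (chartInv i z) := by
            rw [e0 z hz h]
            exact fun h => h rfl
          have hN : chartInv i z ∉ D.N := by
            rw [e0 z hz h, mem_N_iff]
            exact fun h => hvs h.2
          obtain ⟨_, h3⟩ := pt_of_not_finite hn hN hb
          have h4 : fChart i z = -2 * D.s * z.2 - D.s ^ 2 * (1 + D.t) := by
            simp [hi', fChart, h, regularPart_zero, β, C, hvs']
            ring
          refine isRep_of_eq_some h3 (by simp) ?_ ?_
          · simp [SquareQuartic.XInf, e, h4, h, C]
            simp [quart]
            field_simp
            ring
          · simp [SquareQuartic.YInf, SquareQuartic.XInf, e, h4, h, C]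
            simp [quart]
            field_simp
            ring
        · obtain ⟨e1, e2, e3⟩ := e5 z hz h
          have hc := onCurve_of_finite e1
          rw [e] at hc
          have hw : wCoord (chartInv i z) = ((1 + D.t) * D.s - D.t * z.1 * D.s
              + D.C .infty z.1 * z.2) / z.1 := by
            rw [wCoord, e2, e3, hvs']
            simp only [C]
            field_simp
            ring
          rw [hw, e2] at hc
          have hX : (D.quart (fChart i z)).X z.1⁻¹ (((1 + D.t) * D.s - D.t * z.1 * D.s
              + D.C .infty z.1 * z.2) / z.1) = ((1 + D.t) * D.s - D.t * z.1 * D.s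
              + D.C .infty z.1 * z.2) ^ 2 - (D.quart (fChart i z)).c
              - (D.quart (fChart i z)).d * z.1 - (D.quart (fChart i z)).e * z.1 ^ 2 := by
            unfold SquareQuartic.OnCurve at hc
            unfold SquareQuartic.X
            field_simp at hc ⊢
            linear_combination -hc
          refine isRep_of_finite hm hb e1 (by simp) ?_ ?_
          · rw [hw, e2, e, hX]
            simp
          · rw [hw, e2, e]
            have hY : (D.quart (fChart i z)).Y z.1⁻¹ (((1 + D.t) * D.s - D.t * z.1 * D.s
                + D.C .infty z.1 * z.2) / z.1) = ((1 + D.t) * D.s - D.t * z.1 * D.s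
                + D.C .infty z.1 * z.2) * (D.quart (fChart i z)).X z.1⁻¹
                  (((1 + D.t) * D.s - D.t * z.1 * D.s + D.C .infty z.1 * z.2) / z.1)
                - 2 * D.s * (D.quart (fChart i z)).d
                - 2 * D.s * (D.quart (fChart i z)).e * z.1 := by
              have hs : (D.quart (fChart i z)).s = D.s := rfl
              unfold SquareQuartic.OnCurve at hc
              unfold SquareQuartic.Y SquareQuartic.X
              rw [hs] at hc ⊢
              field_simp at hc ⊢
              linear_combination -2 * D.s * hc
            rw [hY, hX]
            simp

end FourPointData

namespace FourPointData

open Filter Topology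

variable {D : FourPointData}

/-! ### The multiplication is isotropic -/

variable (D) in
/-- The interpolation condition: there is a polynomial `s x² + …` with the values `y₁`, `y₂`, `-y₃`
at the points `x₁`, `x₂`, `x₃`, where `yᵢ = xᵢ (xᵢ - 1) (xᵢ - t) pᵢ`. -/
def Interpolates (z₁ z₂ z₃ : ℂ × ℂ) : Prop :=
  D.cubic z₁.1 * z₁.2 / ((z₁.1 - z₂.1) * (z₁.1 - z₃.1)) +
    D.cubic z₂.1 * z₂.2 / ((z₂.1 - z₁.1) * (z₂.1 - z₃.1)) -
    D.cubic z₃.1 * z₃.2 / ((z₃.1 - z₁.1) * (z₃.1 - z₂.1)) - D.s = 0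

/-- Differentiating `Q_b (x) = q (x) ^ 2`, where `q = s x² + c₁ x + c₀`. -/
lemma deriv_quartic_eq {x y b c₁ c₀ : ℂ → ℂ} {x' y' b' c₁' c₀' : ℂ}
    (hx : HasDerivAt x x' 0) (hy : HasDerivAt y y' 0) (hb : HasDerivAt b b' 0)
    (hc₁ : HasDerivAt c₁ c₁' 0) (hc₀ : HasDerivAt c₀ c₀' 0)
    (h : ∀ᶠ τ in 𝓝 0, y τ ^ 2 = (D.quart (b τ)).eval (x τ))
    (h' : ∀ᶠ τ in 𝓝 0, y τ = D.s * x τ ^ 2 + c₁ τ * x τ + c₀ τ) :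
    (4 * D.s ^ 2 * x 0 ^ 3 + 3 * (D.quart (b 0)).a * x 0 ^ 2 + 2 * (D.quart (b 0)).c * x 0
        + (D.quart (b 0)).d - 2 * y 0 * (2 * D.s * x 0 + c₁ 0)) * x' + D.cubic (x 0) * b' =
      2 * y 0 * (c₁' * x 0 + c₀') ∧
    2 * y 0 * y' = (4 * D.s ^ 2 * x 0 ^ 3 + 3 * (D.quart (b 0)).a * x 0 ^ 2
        + 2 * (D.quart (b 0)).c * x 0 + (D.quart (b 0)).d) * x' + D.cubic (x 0) * b' := by
  have e1 : HasDerivAt (fun τ => y τ ^ 2) (2 * y 0 * y') 0 :=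
    (hy.pow 2).congr_deriv (by simp)
  have e2 : HasDerivAt (fun τ => (D.quart (b τ)).eval (x τ))
      ((4 * D.s ^ 2 * x 0 ^ 3 + 3 * (D.quart (b 0)).a * x 0 ^ 2 + 2 * (D.quart (b 0)).c * x 0
        + (D.quart (b 0)).d) * x' + D.cubic (x 0) * b') 0 := by
    have hs : ∀ β X : ℂ, (D.quart β).eval X = D.cubic X * β + (D.quart 0).eval X := by
      intro β X
      unfold SquareQuartic.eval cubic quart
      ring
    have ha : HasDerivAt (fun τ => D.cubic (x τ)) ((3 * x 0 ^ 2 - 2 * (1 + D.t) * x 0 + D.t) * x') 0 := by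
      unfold cubic
      refine ((hx.mul (hx.sub_const 1)).mul (hx.sub_const D.t)).congr_deriv ?_
      simp only [Pi.mul_apply]
      ring
    have hq : HasDerivAt (fun τ => (D.quart 0).eval (x τ)) ((4 * D.s ^ 2 * x 0 ^ 3
        + 3 * (D.quart 0).a * x 0 ^ 2 + 2 * (D.quart 0).c * x 0 + (D.quart 0).d) * x') 0 := by
      refine (((((hx.pow 4).const_mul ((D.quart 0).s ^ 2)).add
        ((hx.pow 3).const_mul (D.quart 0).a)).add ((hx.pow 2).const_mul (D.quart 0).c)).add
          (hx.const_mul (D.quart 0).d)).add_const (D.quart 0).e |>.congr_deriv ?_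
      simp only [quart, Nat.cast_ofNat, Nat.reduceSub, pow_one]
      ring
    rw [show (fun τ => (D.quart (b τ)).eval (x τ)) =
      fun τ => D.cubic (x τ) * b τ + (D.quart 0).eval (x τ) from funext fun τ => by rw [hs]]
    refine ((ha.mul hb).add hq).congr_deriv ?_
    simp only [quart]
    ring
  have e3 := e1.unique (e2.congr_of_eventuallyEq h)
  have e4 := hy.unique (((((hx.pow 2).const_mul D.s).add (hc₁.mul hx)).add
    hc₀).congr_of_eventuallyEq h')
  refine ⟨?_, e3⟩
  simp only [Nat.cast_ofNat, Nat.reduceSub, pow_one] at e4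
  linear_combination -e3 + 2 * y 0 * e4

/-- The Lagrange interpolation identity behind the isotropy of the multiplication. -/
lemma lagrange_identity {x y F : Fin 3 → ℂ} {x' x'' : Fin 3 → ℂ} {A : Fin 3 → ℂ}
    {K b' b'' c₁' c₁'' c₀' c₀'' : ℂ} (hK : K ≠ 0) (hy : ∀ i, y i ≠ 0)
    (h01 : x 0 ≠ x 1) (h02 : x 0 ≠ x 2) (h12 : x 1 ≠ x 2)
    (hF0 : F 0 = K * ((x 0 - x 1) * (x 0 - x 2))) (hF1 : F 1 = K * ((x 1 - x 0) * (x 1 - x 2)))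
    (hF2 : F 2 = K * ((x 2 - x 0) * (x 2 - x 1)))
    (h' : ∀ i, F i * x' i + A i * b' = 2 * y i * (c₁' * x i + c₀'))
    (h'' : ∀ i, F i * x'' i + A i * b'' = 2 * y i * (c₁'' * x i + c₀'')) :
    ∑ i, (x' i * b'' - x'' i * b') / (2 * y i) = 0 := by
  have e01 := sub_ne_zero.2 h01
  have e02 := sub_ne_zero.2 h02
  have e12 := sub_ne_zero.2 h12
  have e10 := sub_ne_zero.2 h01.symm
  have e20 := sub_ne_zero.2 h02.symm
  have e21 := sub_ne_zero.2 h12.symm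
  -- Eliminating `A i` from the equations of the two tangent vectors expresses `dx ∧ db` through
  -- `dc₁ ∧ db` and `dc₀ ∧ db`.
  have key : ∀ i, F i ≠ 0 → (x' i * b'' - x'' i * b') / (2 * y i) =
      ((c₁' * b'' - c₁'' * b') * x i + (c₀' * b'' - c₀'' * b')) / F i := by
    intro i hi
    have h1 := hy i
    have h2 := h' i
    have h3 := h'' i
    rw [div_eq_div_iff (mul_ne_zero two_ne_zero h1) hi]
    linear_combination b'' * h2 - b' * h3
  -- What remains is the `x²` coefficient in the interpolation of a linear polynomial at three
  -- points, divided by `K`.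
  rw [Fin.sum_univ_three, key 0, key 1, key 2, hF0, hF1, hF2]
  · rw [← neg_sub (x 0) (x 1), ← neg_sub (x 0) (x 2), ← neg_sub (x 1) (x 2)]
    field_simp
    ring
  · rw [hF2]; exact mul_ne_zero hK (mul_ne_zero e20 e21)
  · rw [hF1]; exact mul_ne_zero hK (mul_ne_zero e10 e12)
  · rw [hF0]; exact mul_ne_zero hK (mul_ne_zero e01 e02)

/-- The polynomial `Q_b - q²` vanishes at the three points, so it is `K ∏ (x - xᵢ)`. -/
lemma eval_sub_sq_eq {b c₁ c₀ x₀ x₁ x₂ : ℂ} (h01 : x₀ ≠ x₁) (h02 : x₀ ≠ x₂) (h12 : x₁ ≠ x₂)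
    (h0 : (D.quart b).eval x₀ = (D.s * x₀ ^ 2 + c₁ * x₀ + c₀) ^ 2)
    (h1 : (D.quart b).eval x₁ = (D.s * x₁ ^ 2 + c₁ * x₁ + c₀) ^ 2)
    (h2 : (D.quart b).eval x₂ = (D.s * x₂ ^ 2 + c₁ * x₂ + c₀) ^ 2) (x : ℂ) :
    (D.quart b).eval x - (D.s * x ^ 2 + c₁ * x + c₀) ^ 2 =
      ((D.quart b).a - 2 * D.s * c₁) * (x - x₀) * (x - x₁) * (x - x₂) := by
  set K := (D.quart b).a - 2 * D.s * c₁ with hK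
  obtain ⟨L₂, L₁, L₀, hL⟩ : ∃ L₂ L₁ L₀ : ℂ, ∀ x, (D.quart b).eval x
      - (D.s * x ^ 2 + c₁ * x + c₀) ^ 2 = K * x ^ 3 + L₂ * x ^ 2 + L₁ * x + L₀ := by
    refine ⟨(D.quart b).c - c₁ ^ 2 - 2 * D.s * c₀,
      (D.quart b).d - 2 * c₁ * c₀, (D.quart b).e - c₀ ^ 2, fun x => ?_⟩
    rw [hK]
    unfold SquareQuartic.eval quart
    ring
  have e0 := (hL x₀).symm.trans (sub_eq_zero.2 h0)
  have e1 := (hL x₁).symm.trans (sub_eq_zero.2 h1)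
  have e2 := (hL x₂).symm.trans (sub_eq_zero.2 h2)
  have d01 := sub_ne_zero.2 h01
  have d02 := sub_ne_zero.2 h02
  have d12 := sub_ne_zero.2 h12
  have f1 : K * (x₀ ^ 2 + x₀ * x₁ + x₁ ^ 2) + L₂ * (x₀ + x₁) + L₁ = 0 := by
    apply mul_left_cancel₀ d01
    linear_combination e0 - e1
  have f2 : K * (x₀ ^ 2 + x₀ * x₂ + x₂ ^ 2) + L₂ * (x₀ + x₂) + L₁ = 0 := by
    apply mul_left_cancel₀ d02
    linear_combination e0 - e2
  have g : L₂ = -K * (x₀ + x₁ + x₂) := by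
    apply mul_left_cancel₀ d12
    linear_combination f1 - f2
  have g1 : L₁ = K * (x₀ * x₁ + x₀ * x₂ + x₁ * x₂) := by
    rw [g] at f1
    linear_combination f1
  have g0 : L₀ = -K * x₀ * x₁ * x₂ := by
    rw [g, g1] at e0
    linear_combination e0
  rw [hL, g, g1, g0]
  ring

/-- The coefficient `K` does not vanish if the fibre is irreducible. -/
lemma exists_leading_coeff {b c₁ c₀ x₀ x₁ x₂ : ℂ} (hb : ¬ D.IsReducible b)
    (h01 : x₀ ≠ x₁) (h02 : x₀ ≠ x₂) (h12 : x₁ ≠ x₂)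
    (h0 : (D.quart b).eval x₀ = (D.s * x₀ ^ 2 + c₁ * x₀ + c₀) ^ 2)
    (h1 : (D.quart b).eval x₁ = (D.s * x₁ ^ 2 + c₁ * x₁ + c₀) ^ 2)
    (h2 : (D.quart b).eval x₂ = (D.s * x₂ ^ 2 + c₁ * x₂ + c₀) ^ 2) :
    ∃ K ≠ 0, ∀ x, (D.quart b).eval x - (D.s * x ^ 2 + c₁ * x + c₀) ^ 2 =
      K * (x - x₀) * (x - x₁) * (x - x₂) := by
  have hfin := eval_sub_sq_eq h01 h02 h12 h0 h1 h2
  refine ⟨_, fun hK => hb ⟨c₀, c₁, D.s, fun x => ?_⟩, hfin⟩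
  have := hfin x
  rw [hK, quart_eval] at this
  linear_combination this

variable {F : Type*} [NormedAddCommGroup F] [NormedSpace ℂ F]

variable (D) in
/-- The derivative of `Q_b - q²` at `x`, where `q (x) = y`. -/
def derivDefect (b c₁ x y : ℂ) : ℂ :=
  4 * D.s ^ 2 * x ^ 3 + 3 * (D.quart b).a * x ^ 2 + 2 * (D.quart b).c * x
    + (D.quart b).d - 2 * y * (2 * D.s * x + c₁)

lemma hasDerivAt_line {G : Type*} [NormedAddCommGroup G] [NormedSpace ℂ G] {g : F → G}
    {g' : F →L[ℂ] G} {v : F} (hg : HasFDerivAt g g' v) (α : F) :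
    HasDerivAt (fun τ : ℂ => g (v + τ • α)) (g' α) 0 := by
  have h : HasDerivAt (fun τ : ℂ => v + τ • α) α 0 := by
    simpa using ((hasDerivAt_id (0 : ℂ)).smul_const α).const_add v
  refine HasFDerivAt.comp_hasDerivAt (0 : ℂ) (l := g) ?_ h
  simpa using hg

/-- The second part is `dx ∧ dp = dx ∧ db / (2 y)`, which follows by wedging `2 y dy = Q_b' dx +
cubic db` with `dx`. The sign `σ` serves the third point of a triple, where the quadratic takes the
value `-y`. -/
lemma derivDefect_spec {g : F → ℂ × ℂ} {g' : F →L[ℂ] ℂ × ℂ} {b c₁ c₀ : F → ℂ}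
    {b' c₁' c₀' : F →L[ℂ] ℂ} {v : F} {σ : ℂ} (hg : HasFDerivAt g g' v) (hb : HasFDerivAt b b' v)
    (hc₁ : HasFDerivAt c₁ c₁' v) (hc₀ : HasFDerivAt c₀ c₀' v) (hσ : σ ^ 2 = 1)
    (hbase : g v ∈ D.base) (hp : (g v).2 ≠ 0)
    (hf : ∀ᶠ u in 𝓝 v, D.f₀ (g u).1 (g u).2 = b u)
    (hq : ∀ᶠ u in 𝓝 v, σ * (D.cubic (g u).1 * (g u).2) =
      D.s * (g u).1 ^ 2 + c₁ u * (g u).1 + c₀ u) :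
    (∀ α, D.derivDefect (b v) (c₁ v) (g v).1 (σ * (D.cubic (g v).1 * (g v).2)) * (g' α).1
      + D.cubic (g v).1 * b' α =
        2 * (σ * (D.cubic (g v).1 * (g v).2)) * (c₁' α * (g v).1 + c₀' α)) ∧
    ∀ α β, stdForm (g' α) (g' β) = σ * (((g' α).1 * b' β - (g' β).1 * b' α) /
      (2 * (σ * (D.cubic (g v).1 * (g v).2)))) := by
  have hA := cubic_ne_zero hbase
  have hσ0 : σ ≠ 0 := fun h => by simp [h] at hσ
  have hf' : ∀ᶠ u in 𝓝 v, (σ * (D.cubic (g u).1 * (g u).2)) ^ 2 = (D.quart (b u)).eval (g u).1 := by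
    filter_upwards [hf, hg.continuousAt.eventually_mem (D.isOpen_base.mem_nhds hbase)]
      with u h1 h2
    rw [mul_pow, hσ, one_mul, ← (f₀_eq_iff h2).1 h1]
  have line : ∀ α : F, Tendsto (fun τ : ℂ => v + τ • α) (𝓝 0) (𝓝 v) := fun α => by
    have : Continuous fun τ : ℂ => v + τ • α := by fun_prop
    simpa using this.tendsto 0
  have hx : HasFDerivAt (fun u => (g u).1) _ v := hg.fst
  have hp' : HasFDerivAt (fun u => (g u).2) _ v := hg.snd
  have key := fun α => by
    have hx1 := hasDerivAt_line hx α
    have hp1 := hasDerivAt_line hp' α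
    have hA1 : HasDerivAt (fun τ : ℂ => D.cubic (g (v + τ • α)).1)
        ((3 * (g v).1 ^ 2 - 2 * (1 + D.t) * (g v).1 + D.t) * (g' α).1) 0 := by
      unfold cubic
      refine ((hx1.mul (hx1.sub_const 1)).mul (hx1.sub_const D.t)).congr_deriv ?_
      simp
      ring
    exact deriv_quartic_eq hx1 ((hA1.mul hp1).const_mul σ) (hasDerivAt_line hb α)
      (hasDerivAt_line hc₁ α) (hasDerivAt_line hc₀ α) ((line α).eventually hf')
      ((line α).eventually hq)
  simp only [zero_smul, add_zero, Pi.mul_apply] at key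
  refine ⟨fun α => ?_, fun α β => ?_⟩
  · unfold derivDefect
    exact (key α).1
  · have h1 := (key α).2
    have h2 := (key β).2
    simp only [ContinuousLinearMap.comp_apply, ContinuousLinearMap.coe_fst',
      ContinuousLinearMap.coe_snd'] at h1 h2
    rw [stdForm_apply]
    rw [mul_div_assoc', eq_div_iff (mul_ne_zero two_ne_zero
      (mul_ne_zero hσ0 (mul_ne_zero hA hp)))]
    apply mul_left_cancel₀ hA
    linear_combination σ * ((g' α).1 * h2 - (g' β).1 * h1) - 2 * σ * D.cubic (g v).1 ^ 2 *
      (g v).2 * ((g' α).1 * (g' β).2 - (g' α).2 * (g' β).1) * hσ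

/-- Families of triples which satisfy the equations of the multiplication are isotropic. -/
theorem isotropic_of_interpolates {g h k : F → ℂ × ℂ} {g' h' k' : F →L[ℂ] ℂ × ℂ} {v : F}
    (hg : HasFDerivAt g g' v) (hh : HasFDerivAt h h' v) (hk : HasFDerivAt k k' v)
    (bg : g v ∈ D.base) (bh : h v ∈ D.base) (bk : k v ∈ D.base)
    (pg : (g v).2 ≠ 0) (ph : (h v).2 ≠ 0) (pk : (k v).2 ≠ 0)
    (h₁₂ : (g v).1 ≠ (h v).1) (h₁₃ : (g v).1 ≠ (k v).1) (h₂₃ : (h v).1 ≠ (k v).1)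
    (f₁₂ : ∀ᶠ u in 𝓝 v, D.f₀ (h u).1 (h u).2 = D.f₀ (g u).1 (g u).2)
    (f₁₃ : ∀ᶠ u in 𝓝 v, D.f₀ (k u).1 (k u).2 = D.f₀ (g u).1 (g u).2)
    (hI : ∀ᶠ u in 𝓝 v, D.Interpolates (g u) (h u) (k u))
    (hr : ¬ D.IsReducible (D.f₀ (g v).1 (g v).2)) (α β : F) :
    -stdForm (g' α) (g' β) - stdForm (h' α) (h' β) + stdForm (k' α) (k' β) = 0 := by
  have d₁₂ := sub_ne_zero.2 h₁₂
  have hx := hg.differentiableAt.fst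
  have hy := hg.differentiableAt.snd
  have kx := hh.differentiableAt.fst
  have ky := hh.differentiableAt.snd
  set b : F → ℂ := fun u => D.f₀ (g u).1 (g u).2 with hb
  -- The coefficients are those of the polynomial `s x² + c₁ x + c₀` through the first two points.
  -- The condition `hI` makes it pass through the third with opposite sign.
  set c₁ : F → ℂ := fun u => (D.cubic (g u).1 * (g u).2 - D.cubic (h u).1 * (h u).2) /
    ((g u).1 - (h u).1) - D.s * ((g u).1 + (h u).1) with hc₁
  set c₀ : F → ℂ := fun u => D.cubic (g u).1 * (g u).2 - D.s * (g u).1 ^ 2 - c₁ u * (g u).1 with hc₀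
  have db : DifferentiableAt ℂ b v :=
    ((contDiffAt_f₀ (n := 1) bg).differentiableAt (by norm_num)).comp v hg.differentiableAt
  have dc₁ : DifferentiableAt ℂ c₁ v := by
    simp only [hc₁]
    unfold cubic
    fun_prop (disch := assumption)
  have dc₀ : DifferentiableAt ℂ c₀ v := by
    simp only [hc₀]
    unfold cubic
    fun_prop (disch := assumption)
  have ex₁₂ : ∀ᶠ u in 𝓝 v, (g u).1 ≠ (h u).1 :=
    (hg.continuousAt.fst.prodMk hh.continuousAt.fst).eventually_mem
      ((isOpen_ne_fun continuous_fst continuous_snd).mem_nhds h₁₂)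
  have ex₁₃ : ∀ᶠ u in 𝓝 v, (g u).1 ≠ (k u).1 :=
    (hg.continuousAt.fst.prodMk hk.continuousAt.fst).eventually_mem
      ((isOpen_ne_fun continuous_fst continuous_snd).mem_nhds h₁₃)
  have ex₂₃ : ∀ᶠ u in 𝓝 v, (h u).1 ≠ (k u).1 :=
    (hh.continuousAt.fst.prodMk hk.continuousAt.fst).eventually_mem
      ((isOpen_ne_fun continuous_fst continuous_snd).mem_nhds h₂₃)
  have q₁ : ∀ᶠ u in 𝓝 v, 1 * (D.cubic (g u).1 * (g u).2) =
      D.s * (g u).1 ^ 2 + c₁ u * (g u).1 + c₀ u := by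
    refine Eventually.of_forall fun u => ?_
    simp only [hc₀]
    ring
  have q₂ : ∀ᶠ u in 𝓝 v, 1 * (D.cubic (h u).1 * (h u).2) =
      D.s * (h u).1 ^ 2 + c₁ u * (h u).1 + c₀ u := by
    filter_upwards [ex₁₂] with u h1
    have := sub_ne_zero.2 h1
    simp only [hc₀, hc₁]
    field_simp
    ring
  have q₃ : ∀ᶠ u in 𝓝 v, -1 * (D.cubic (k u).1 * (k u).2) =
      D.s * (k u).1 ^ 2 + c₁ u * (k u).1 + c₀ u := by
    filter_upwards [ex₁₂, ex₁₃, ex₂₃, hI] with u h1 h2 h3 h4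
    have e1 := sub_ne_zero.2 h1
    have e2 := sub_ne_zero.2 h2
    have e3 := sub_ne_zero.2 h3
    unfold Interpolates at h4
    rw [← neg_sub (g u).1 (h u).1, ← neg_sub (g u).1 (k u).1, ← neg_sub (h u).1 (k u).1] at h4
    simp only [hc₀, hc₁]
    field_simp at h4 ⊢
    linear_combination h4
  obtain ⟨A₁, B₁⟩ := derivDefect_spec hg db.hasFDerivAt dc₁.hasFDerivAt dc₀.hasFDerivAt
    (one_pow 2) bg pg (Eventually.of_forall fun u => rfl) q₁
  obtain ⟨A₂, B₂⟩ := derivDefect_spec hh db.hasFDerivAt dc₁.hasFDerivAt dc₀.hasFDerivAt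
    (one_pow 2) bh ph f₁₂ q₂
  obtain ⟨A₃, B₃⟩ := derivDefect_spec hk db.hasFDerivAt dc₁.hasFDerivAt dc₀.hasFDerivAt
    (by norm_num) bk pk f₁₃ q₃
  have E₁ := (f₀_eq_iff bg).1 rfl
  have E₂ := (f₀_eq_iff bh).1 f₁₂.self_of_nhds
  have E₃ := (f₀_eq_iff bk).1 f₁₃.self_of_nhds
  have r₁ := q₁.self_of_nhds
  have r₂ := q₂.self_of_nhds
  have r₃ := q₃.self_of_nhds
  obtain ⟨K, hK, hfac⟩ := exists_leading_coeff (b := b v) hr h₁₂ h₁₃ h₂₃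
    (by rw [← E₁, ← r₁]; ring) (by rw [← E₂, ← r₂]; ring) (by rw [← E₃, ← r₃]; ring)
  -- Both sides of `hfac` have degree at most three, since `s² x⁴` cancels. Their values at `0, 1,
  -- -1, 2` determine the coefficients and hence the derivatives.
  have hder : ∀ x, D.derivDefect (b v) (c₁ v) x (D.s * x ^ 2 + c₁ v * x + c₀ v) =
      K * ((x - (h v).1) * (x - (k v).1) + (x - (g v).1) * (x - (k v).1)
        + (x - (g v).1) * (x - (h v).1)) := by
    intro x
    have f0 := hfac 0
    have f1 := hfac 1
    have f2 := hfac (-1)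
    have f3 := hfac 2
    unfold SquareQuartic.eval at f0 f1 f2 f3
    simp only [show (D.quart (b v)).s = D.s from rfl] at f0 f1 f2 f3
    unfold derivDefect
    linear_combination (3 * x ^ 2 - 1) * (f3 - 4 * ((f1 + f2) / 2 - f0) - f0 - (f1 - f2)) / 6 +
      2 * x * ((f1 + f2) / 2 - f0) + (f1 - f2) / 2
  have := lagrange_identity (x := ![(g v).1, (h v).1, (k v).1])
    (y := ![1 * (D.cubic (g v).1 * (g v).2), 1 * (D.cubic (h v).1 * (h v).2),
      -1 * (D.cubic (k v).1 * (k v).2)])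
    (F := ![D.derivDefect (b v) (c₁ v) (g v).1 (1 * (D.cubic (g v).1 * (g v).2)),
      D.derivDefect (b v) (c₁ v) (h v).1 (1 * (D.cubic (h v).1 * (h v).2)),
      D.derivDefect (b v) (c₁ v) (k v).1 (-1 * (D.cubic (k v).1 * (k v).2))])
    (x' := ![(g' α).1, (h' α).1, (k' α).1]) (x'' := ![(g' β).1, (h' β).1, (k' β).1])
    (A := ![D.cubic (g v).1, D.cubic (h v).1, D.cubic (k v).1]) (K := K)
    (b' := fderiv ℂ b v α) (b'' := fderiv ℂ b v β) (c₁' := fderiv ℂ c₁ v α)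
    (c₁'' := fderiv ℂ c₁ v β) (c₀' := fderiv ℂ c₀ v α) (c₀'' := fderiv ℂ c₀ v β) hK
    (by
      have a1 := mul_ne_zero (cubic_ne_zero bg) pg
      have a2 := mul_ne_zero (cubic_ne_zero bh) ph
      have a3 := mul_ne_zero (cubic_ne_zero bk) pk
      intro i
      fin_cases i
      · simpa using a1
      · simpa using a2
      · simpa using a3)
    h₁₂ h₁₃ h₂₃
    (by
      change D.derivDefect (b v) (c₁ v) (g v).1 (1 * (D.cubic (g v).1 * (g v).2)) =
        K * (((g v).1 - (h v).1) * ((g v).1 - (k v).1))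
      rw [r₁, hder]
      ring)
    (by
      change D.derivDefect (b v) (c₁ v) (h v).1 (1 * (D.cubic (h v).1 * (h v).2)) =
        K * (((h v).1 - (g v).1) * ((h v).1 - (k v).1))
      rw [r₂, hder]
      ring)
    (by
      change D.derivDefect (b v) (c₁ v) (k v).1 (-1 * (D.cubic (k v).1 * (k v).2)) =
        K * (((k v).1 - (g v).1) * ((k v).1 - (h v).1))
      rw [r₃, hder]
      ring)
    (fun i => by fin_cases i; exacts [A₁ α, A₂ α, A₃ α])
    (fun i => by fin_cases i; exacts [A₁ β, A₂ β, A₃ β])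
  rw [B₁, B₂, B₃]
  rw [Fin.sum_univ_three] at this
  simp only [Matrix.cons_val] at this
  linear_combination -this

end FourPointData

namespace FourPointData

open Filter Topology WeierstrassCurve

variable {D : FourPointData}

/-! ### Addition of families of points -/

variable (D) in
/-- The points of the cotangent bundle with `p ≠ 0`. -/
def baseNe : Set (ℂ × ℂ) := {z | z ∈ D.base ∧ z.2 ≠ 0}

lemma isOpen_baseNe : IsOpen D.baseNe := D.isOpen_base.and (isOpen_ne_fun continuous_snd continuous_const)

variable (D) in
/-- Jacobian coordinates of the point of the Weierstrass curve given by `(x, p)`. -/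
def jac (b : ℂ) (z : ℂ × ℂ) : Fin 3 → ℂ :=
  ![(D.quart b).X z.1 (D.s * z.1 ^ 2 - D.cubic z.1 * z.2),
    (D.quart b).Y z.1 (D.s * z.1 ^ 2 - D.cubic z.1 * z.2), 1]

variable (D) in
/-- The point of the Weierstrass curve given by `(x, p)`. -/
def point (b : ℂ) (z : ℂ × ℂ) : (D.quart b).W.toAffine.Point :=
  (D.quart b).toPoint z.1 (D.s * z.1 ^ 2 - D.cubic z.1 * z.2)

lemma toAffine_jac (b : ℂ) (z : ℂ × ℂ) :
    Jacobian.Point.toAffine (D.quart b).W (D.jac b z) = D.point b z := rfl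

lemma pt_interior {b : ℂ} {z : ℂ × ℂ} (hz : z ∈ D.base) : pt b (.interior z hz) = D.point b z :=
  pt_of_finite (m := .interior z hz) trivial b

variable (D) in
/-- `z` is a point of the cotangent bundle with `f = b` and `p ≠ 0`. -/
def OnFibre (b : ℂ) (z : ℂ × ℂ) : Prop := z ∈ D.baseNe ∧ D.f₀ z.1 z.2 = b

lemma OnFibre.onCurve {b : ℂ} {z : ℂ × ℂ} (h : D.OnFibre b z) :
    (D.quart b).OnCurve z.1 (D.s * z.1 ^ 2 - D.cubic z.1 * z.2) := by
  rw [SquareQuartic.onCurve_iff, ← (f₀_eq_iff h.1.1).1 h.2]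
  simp [quart]

lemma OnFibre.smooth {b : ℂ} {z : ℂ × ℂ} (h : D.OnFibre b z) :
    (D.quart b).Smooth z.1 (D.s * z.1 ^ 2 - D.cubic z.1 * z.2) := by
  refine SquareQuartic.smooth_of_ne fun h' => ?_
  have h1 : D.s * z.1 ^ 2 - D.cubic z.1 * z.2 = D.s * z.1 ^ 2 := h'
  exact mul_ne_zero (cubic_ne_zero h.1.1) h.1.2 (by linear_combination -h1)

lemma OnFibre.nonsingular {b : ℂ} {z : ℂ × ℂ} (h : D.OnFibre b z) (hb : (D.quart b).Good) :
    (D.quart b).W.toJacobian.Nonsingular (D.jac b z) :=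
  (Jacobian.nonsingular_some ..).2 (h.onCurve.nonsingular hb h.smooth)

lemma OnFibre.point_inj {b : ℂ} {z z' : ℂ × ℂ} (hb : (D.quart b).Good) (h : D.OnFibre b z)
    (h' : D.OnFibre b z') (he : D.point b z = D.point b z') : z = z' := by
  obtain ⟨h1, h2⟩ := SquareQuartic.toPoint_inj hb h.onCurve h'.onCurve h.smooth h'.smooth he
  refine Prod.ext h1 ?_
  rw [h1] at h2
  exact mul_left_cancel₀ (cubic_ne_zero h'.1.1) (by linear_combination -h2)

lemma OnFibre.ext_or {b : ℂ} {z z' : ℂ × ℂ} (h : D.OnFibre b z) (h' : D.OnFibre b z')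
    (hx : z.1 = z'.1) : z = z' ∨ z = (z'.1, -z'.2) := by
  have h1 := (f₀_eq_iff h.1.1).1 h.2
  have h2 := (f₀_eq_iff h'.1.1).1 h'.2
  rw [hx, ← h2, mul_pow, mul_pow, mul_right_inj' (pow_ne_zero 2 (cubic_ne_zero h'.1.1)),
    sq_eq_sq_iff_eq_or_eq_neg] at h1
  exact h1.imp (Prod.ext hx) (Prod.ext hx)

lemma OnFibre.regular {b : ℂ} {z : ℂ × ℂ} (h : D.OnFibre b z) (hb : (D.quart b).Good) :
    .interior z h.1.1 ∈ D.regular :=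
  interior_mem_regular_of_ne h.1.1 h.1.2 (h.2 ▸ (good_iff.1 hb).1)

lemma OnFibre.add_iff {b : ℂ} {z₁ z₂ z₃ : ℂ × ℂ} (hb : (D.quart b).Good) (h₁ : D.OnFibre b z₁)
    (h₂ : D.OnFibre b z₂) (h₃ : D.OnFibre b z₃) (h12 : z₁.1 ≠ z₂.1) (h13 : z₁.1 ≠ z₃.1)
    (h23 : z₂.1 ≠ z₃.1) :
    D.point b z₁ + D.point b z₂ = D.point b z₃ ↔ D.Interpolates z₁ z₂ z₃ := by
  unfold point
  rw [SquareQuartic.toPoint_add_iff hb h₁.onCurve h₂.onCurve h₃.onCurve h₁.smooth h₂.smooth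
    h₃.smooth h12 h13 h23]
  simp only [show (D.quart b).s = D.s from rfl, sub_sub_cancel]
  rfl

/-- The point `(x, p)` for a point `(x, w)` of the quartic. -/
lemma onFibre_of_isNice {b x w : ℂ} {E : Set ℂ} (h : (D.quart b).IsNice E x w)
    (hE : {0, 1, D.t} ⊆ E) : D.OnFibre b (x, (D.s * x ^ 2 - w) / D.cubic x) ∧
      D.point b (x, (D.s * x ^ 2 - w) / D.cubic x) = (D.quart b).toPoint x w := by
  have hbase : (x, (D.s * x ^ 2 - w) / D.cubic x) ∈ D.base := by
    refine ⟨?_, ?_, ?_⟩ <;> rintro rfl <;> exact h.notMem (hE (by simp))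
  have hA := cubic_ne_zero hbase
  have hy : D.cubic x * ((D.s * x ^ 2 - w) / D.cubic x) = D.s * x ^ 2 - w := mul_div_cancel₀ _ hA
  refine ⟨⟨⟨hbase, div_ne_zero (sub_ne_zero.2 h.ne.symm) hA⟩, ?_⟩, ?_⟩
  · rw [f₀_eq_iff hbase]
    have h1 := SquareQuartic.onCurve_iff.1 h.onCurve
    rw [show (D.quart b).s = D.s from rfl] at h1
    simp only [hy]
    exact h1
  · simp only [point, hy, sub_sub_cancel]

section

variable {F : Type*} [NormedAddCommGroup F] [NormedSpace ℂ F]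

lemma contDiffAt_jac {b : F → ℂ} {g : F → ℂ × ℂ} {v : F} (hb : ContDiffAt ℂ ω b v)
    (hg : ContDiffAt ℂ ω g v) : ContDiffAt ℂ ω (fun u => D.jac (b u) (g u)) v := by
  have h1 : ContDiffAt ℂ ω (fun u => (g u).1) v := contDiffAt_fst.comp v hg
  have h2 : ContDiffAt ℂ ω (fun u => (g u).2) v := contDiffAt_snd.comp v hg
  refine contDiffAt_pi.2 fun j => ?_
  fin_cases j
  · simp [jac, SquareQuartic.X, quart, cubic]
    fun_prop
  · simp [jac, SquareQuartic.Y, quart, cubic]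
    fun_prop
  · simpa [jac] using contDiffAt_const

/-- The sum of two holomorphic families of points of the fibres is holomorphic, near a place where
it is in general position. -/
theorem exists_sum {b : F → ℂ} {J J' : F → Fin 3 → ℂ} {v : F} (hb : ContDiffAt ℂ ω b v)
    (hJ : ContDiffAt ℂ ω J v) (hJ' : ContDiffAt ℂ ω J' v) (hgood : (D.quart (b v)).Good)
    (hn : ∀ᶠ u in 𝓝 v, (D.quart (b u)).W.toJacobian.Nonsingular (J u))
    (hn' : ∀ᶠ u in 𝓝 v, (D.quart (b u)).W.toJacobian.Nonsingular (J' u))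
    (hne : Jacobian.Point.toAffine (D.quart (b v)).W (J v) ≠
      Jacobian.Point.toAffine (D.quart (b v)).W (J' v)) {E : Set ℂ} (hE : {0, 1, D.t} ⊆ E)
    {x w : ℂ} (hxw : (D.quart (b v)).IsNice E x w)
    (he : (D.quart (b v)).toPoint x w = Jacobian.Point.toAffine (D.quart (b v)).W (J v) +
      Jacobian.Point.toAffine (D.quart (b v)).W (J' v)) :
    ∃ k : F → ℂ × ℂ, ContDiffAt ℂ ω k v ∧ k v = (x, (D.s * x ^ 2 - w) / D.cubic x) ∧
      ∀ᶠ u in 𝓝 v, D.OnFibre (b u) (k u) ∧ D.point (b u) (k u) =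
        Jacobian.Point.toAffine (D.quart (b u)).W (J u) +
          Jacobian.Point.toAffine (D.quart (b u)).W (J' u) := by
  obtain ⟨hz, hd, hs⟩ := SquareQuartic.sumPoint_of_isNice hgood hn.self_of_nhds hn'.self_of_nhds
    hne hxw he
  have hfib := (onFibre_of_isNice hxw hE).1
  have hA : D.cubic x ≠ 0 := cubic_ne_zero hfib.1.1
  set S : F → ℂ × ℂ := fun u => (D.quart (b u)).sumPoint (J u) (J' u) with hS
  have hSv : S v = (x, w) := hs
  have cS : ContDiffAt ℂ ω S v := contDiffAt_sumPoint hb hJ hJ' hz hd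
  have c1 : ContDiffAt ℂ ω (fun u => (S u).1) v := contDiffAt_fst.comp v cS
  have c2 : ContDiffAt ℂ ω (fun u => (S u).2) v := contDiffAt_snd.comp v cS
  set k : F → ℂ × ℂ := fun u => ((S u).1, (D.s * (S u).1 ^ 2 - (S u).2) / D.cubic (S u).1) with hk
  have hAv : D.cubic (S v).1 ≠ 0 := by rwa [hSv]
  have ck : ContDiffAt ℂ ω k v := by
    have c3 : ContDiffAt ℂ ω (fun u => D.cubic (S u).1) v := by
      unfold cubic
      fun_prop
    exact c1.prodMk (((contDiffAt_const.mul (c1.pow 2)).sub c2).div c3 hAv)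
  have kv : k v = (x, (D.s * x ^ 2 - w) / D.cubic x) := by simp only [hk, hSv]
  refine ⟨k, ck, kv, ?_⟩
  have ez : ∀ᶠ u in 𝓝 v, Jacobian.addZ (J u) (J' u) ≠ 0 := by
    have h0 := fun i => (contDiffAt_pi.1 hJ i).continuousAt
    have h1 := fun i => (contDiffAt_pi.1 hJ' i).continuousAt
    refine ContinuousAt.eventually_ne ?_ hz
    unfold Jacobian.addZ
    exact ((h0 0).mul ((h1 2).pow 2)).sub ((h1 0).mul ((h0 2).pow 2))
  have ed : ∀ᶠ u in 𝓝 v, (D.quart (b u)).delta ((D.quart (b u)).sumX (J u) (J' u)) ≠ 0 := by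
    have h1 := (contDiffAt_sumX (D := D) hb hJ hJ' hz).1.continuousAt
    have h2 := hb.continuousAt
    refine ContinuousAt.eventually_ne ?_ hd
    unfold SquareQuartic.delta
    simp only [quart] at h1 ⊢
    fun_prop
  have eb : ∀ᶠ u in 𝓝 v, k u ∈ D.baseNe := ck.continuousAt.eventually_mem
    (isOpen_baseNe.mem_nhds (by rw [kv]; exact hfib.1))
  filter_upwards [hn, hn', ez, ed, eb] with u h1 h2 h3 h4 h5
  obtain ⟨a1, a2, a3⟩ := SquareQuartic.sumPoint_spec h1 h2 h3 h4
  have hy : D.cubic (k u).1 * (k u).2 = D.s * (S u).1 ^ 2 - (S u).2 :=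
    mul_div_cancel₀ _ (cubic_ne_zero h5.1)
  refine ⟨⟨h5, ?_⟩, ?_⟩
  · have h6 := SquareQuartic.onCurve_iff.1 a1
    rw [show (D.quart (b u)).s = D.s from rfl] at h6
    rw [f₀_eq_iff h5.1, hy]
    exact h6
  · rw [← a3, point, hy, sub_sub_cancel]

end

/-! ### The coordinates `(f, x)` -/

lemma fderiv_f₀_snd {z : ℂ × ℂ} (hz : z ∈ D.base) :
    fderiv ℂ (fun z : ℂ × ℂ => D.f₀ z.1 z.2) z (0, 1) = 2 * D.cubic z.1 * z.2 := by
  have h1 := hasDerivAt_line ((contDiffAt_f₀ (n := 1) hz).differentiableAt one_ne_zero).hasFDerivAt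
    (0, 1)
  refine h1.unique ?_
  have h2 : HasDerivAt (fun τ : ℂ => z.2 + τ) 1 0 := (hasDerivAt_id 0).const_add _
  have h3 := (((h2.pow 2).const_mul (D.cubic z.1)).add_const (D.f₀ z.1 0))
  refine (h3.congr_deriv ?_).congr_of_eventuallyEq (Eventually.of_forall fun τ => ?_)
  · simp
    ring
  · simp [f₀, cubic]
    ring

lemma exists_equiv {L : ℂ × ℂ →L[ℂ] ℂ × ℂ} (hL : Function.Injective L) :
    ∃ L' : (ℂ × ℂ) ≃L[ℂ] ℂ × ℂ, (L' : ℂ × ℂ →L[ℂ] ℂ × ℂ) = L :=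
  ⟨(LinearEquiv.ofInjectiveEndo (L : ℂ × ℂ →ₗ[ℂ] ℂ × ℂ) hL).toContinuousLinearEquiv,
    ContinuousLinearMap.ext fun _ => rfl⟩

/-- Where `p ≠ 0`, the functions `f` and `x` are local coordinates on the cotangent bundle. -/
theorem exists_fx {z₀ : ℂ × ℂ} (hz₀ : z₀ ∈ D.baseNe) :
    ∃ e : OpenPartialHomeomorph (ℂ × ℂ) (ℂ × ℂ), z₀ ∈ e.source ∧ e.source ⊆ D.baseNe ∧
      (∀ z, e z = (D.f₀ z.1 z.2, z.1)) ∧ ∀ y ∈ e.target, ContDiffAt ℂ ω e.symm y := by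
  have hc : ∀ z ∈ D.baseNe, ContDiffAt ℂ ω (fun z : ℂ × ℂ => (D.f₀ z.1 z.2, z.1)) z := fun z hz =>
    (contDiffAt_f₀ hz.1).prodMk contDiffAt_fst
  have hd : ∀ z ∈ D.baseNe, ∃ L : (ℂ × ℂ) ≃L[ℂ] ℂ × ℂ,
      HasFDerivAt (fun z : ℂ × ℂ => (D.f₀ z.1 z.2, z.1)) (L : ℂ × ℂ →L[ℂ] ℂ × ℂ) z := by
    intro z hz
    have h1 := ((contDiffAt_f₀ (n := 1) hz.1).differentiableAt one_ne_zero).hasFDerivAt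
    have h2 : HasFDerivAt (fun z : ℂ × ℂ => z.1) (ContinuousLinearMap.fst ℂ ℂ ℂ) z := hasFDerivAt_fst
    have h3 := h1.prodMk h2
    obtain ⟨L, hL⟩ := exists_equiv (L := (fderiv ℂ (fun z : ℂ × ℂ => D.f₀ z.1 z.2) z).prod
      (ContinuousLinearMap.fst ℂ ℂ ℂ)) (by
        refine (injective_iff_map_eq_zero _).2 fun u hu => ?_
        have e1 : fderiv ℂ (fun z : ℂ × ℂ => D.f₀ z.1 z.2) z u = 0 := congrArg Prod.fst hu
        have e2 : u.1 = 0 := congrArg Prod.snd hu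
        have e3 : u = u.2 • ((0, 1) : ℂ × ℂ) := Prod.ext (by simp [e2]) (by simp)
        rw [e3, map_smul, fderiv_f₀_snd hz.1, smul_eq_mul] at e1
        have e4 : 2 * D.cubic z.1 * z.2 ≠ 0 :=
          mul_ne_zero (mul_ne_zero two_ne_zero (cubic_ne_zero hz.1)) hz.2
        exact Prod.ext e2 ((mul_eq_zero.1 e1).resolve_right e4))
    exact ⟨L, by rw [hL]; exact h3⟩
  obtain ⟨L, hL⟩ := hd z₀ hz₀
  set e := ((hc z₀ hz₀).toOpenPartialHomeomorph _ hL (by simp)).restrOpen D.baseNe isOpen_baseNe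
    with he
  have hcoe : (e : ℂ × ℂ → ℂ × ℂ) = fun z => (D.f₀ z.1 z.2, z.1) := rfl
  have hsub : e.source ⊆ D.baseNe := Set.inter_subset_right
  refine ⟨e, ⟨(hc z₀ hz₀).mem_toOpenPartialHomeomorph_source hL (by simp), hz₀⟩, hsub,
    fun z => rfl, fun y hy => ?_⟩
  have h1 := hsub (e.map_target hy)
  obtain ⟨L', hL'⟩ := hd _ h1
  exact e.contDiffAt_symm hy hL' (hc _ h1)

/-- A holomorphic family of points of the fibres with constant `x`. -/
lemma exists_section {b : ℂ} {z : ℂ × ℂ} (h : D.OnFibre b z) :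
    ∃ σ : ℂ → ℂ × ℂ, ContDiffAt ℂ ω σ b ∧ σ b = z ∧ ∀ᶠ β in 𝓝 b, D.OnFibre β (σ β) := by
  obtain ⟨e, h1, h2, h3, h4⟩ := exists_fx h.1
  have hb : e z = (b, z.1) := by rw [h3, h.2]
  have ht : (b, z.1) ∈ e.target := hb ▸ e.map_source h1
  have hc : ContDiffAt ℂ ω (fun β : ℂ => (β, z.1)) b := contDiffAt_id.prodMk contDiffAt_const
  refine ⟨fun β => e.symm (β, z.1), (h4 _ ht).comp b hc, ?_, ?_⟩
  · change e.symm (b, z.1) = z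
    rw [← hb, e.left_inv h1]
  · filter_upwards [hc.continuousAt.eventually_mem (e.open_target.mem_nhds ht)] with β hβ
    refine ⟨h2 (e.map_target hβ), ?_⟩
    have := congrArg Prod.fst (e.right_inv hβ)
    rw [h3] at this
    exact this

end FourPointData

namespace FourPointData

open Filter Topology WeierstrassCurve

variable {D : FourPointData}

/-! ### Translations as Darboux coordinates -/

lemma eventually_ne_punctured (c : ℂ) : ∀ᶠ τ in 𝓝[≠] (0 : ℂ), τ ≠ c := by
  by_cases h : (0 : ℂ) = c
  · subst h
    exact self_mem_nhdsWithin
  · exact nhdsWithin_le_nhds (eventually_ne_nhds h)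

lemma innerInv_snd_ne_zero {i : D.ChartIndex} {z : ℂ × ℂ} (hz : z ∈ innerTarget i) :
    (innerInv i z).2 ≠ 0 ↔ match i with
      | .main => z.2 ≠ 0
      | .pole _ v _ _ => v + z.1 * z.2 ≠ 0
      | .branch _ _ => True := by
  have key : ∀ (a : Puncture) (y : ℂ × ℂ), y.1 ≠ 0 → ((D.ofLocal a y).2 ≠ 0 ↔ y.2 ≠ 0) := by
    intro a y hy
    cases a <;> simp [ofLocal, hy]
  cases i with
  | main => rfl
  | pole a v hv hv0 =>
    have h0 := hz.1
    simp only [innerInv]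
    refine (key a (z.1, v / z.1 + z.2) h0).trans ?_
    have : v / z.1 + z.2 = (v + z.1 * z.2) / z.1 := by field_simp
    simp [this, h0]
  | branch a hκ =>
    have h0 := hz.1
    simp only [innerInv]
    refine (key a (z.2 * z.1 ^ 2, z.1⁻¹) (mul_ne_zero hz.2.1 (pow_ne_zero 2 h0))).trans ?_
    simp [h0]

/-- In each chart, the points of the cotangent bundle with `p ≠ 0` are dense. -/
lemma frequently_inner {i : D.ChartIndex} {z : ℂ × ℂ} (hz : z ∈ chartTarget i) :
    ∃ᶠ z' in 𝓝 z, z' ∈ innerTarget i ∧ (innerInv i z').2 ≠ 0 := by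
  suffices H : ∃ u : ℂ × ℂ, ∀ᶠ τ in 𝓝[≠] (0 : ℂ), z + τ • u ∈ innerTarget i ∧
      (innerInv i (z + τ • u)).2 ≠ 0 by
    obtain ⟨u, hu⟩ := H
    have hc : Continuous fun τ : ℂ => z + τ • u := by fun_prop
    have ht : Tendsto (fun τ : ℂ => z + τ • u) (𝓝[≠] 0) (𝓝 z) := by
      simpa using (hc.tendsto 0).mono_left nhdsWithin_le_nhds
    exact ht.frequently hu.frequently
  have hopen : ∀ u : ℂ × ℂ, ∀ᶠ τ in 𝓝[≠] (0 : ℂ), z + τ • u ∈ chartTarget i := fun u => by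
    have hc : Continuous fun τ : ℂ => z + τ • u := by fun_prop
    refine nhdsWithin_le_nhds (hc.continuousAt.eventually_mem ((isOpen_chartTarget i).mem_nhds ?_))
    simpa using hz
  cases i with
  | main =>
    refine ⟨(0, 1), ?_⟩
    filter_upwards [hopen (0, 1), eventually_ne_punctured (-z.2)] with τ h1 h2
    refine ⟨h1, (innerInv_snd_ne_zero (i := .main) h1).2 ?_⟩
    intro h3
    exact h2 (by simp at h3; linear_combination h3)
  | pole a v hv hv0 =>
    refine ⟨(1, 0), ?_⟩
    -- On this line only `ξ` varies. The two excluded values of `τ` are those with `ξ = 0` and with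
    -- `v + ξ q = 0`, that is, `η = 0`.
    filter_upwards [hopen (1, 0), eventually_ne_punctured (-z.1),
      eventually_ne_punctured (-v / z.2 - z.1)] with τ h1 h2 h3
    have h4 : z + τ • ((1, 0) : ℂ × ℂ) ∈ innerTarget (.pole a v hv hv0) :=
      ⟨fun h => h2 (by simp at h; linear_combination h), h1⟩
    refine ⟨h4, (innerInv_snd_ne_zero h4).2 ?_⟩
    intro h5
    simp at h5
    by_cases h6 : z.2 = 0
    · simp [h6, hv0] at h5
    · refine h3 ?_
      field_simp
      linear_combination h5
  | branch a hκ =>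
    refine ⟨(1, 0), ?_⟩
    filter_upwards [hopen (1, 0), eventually_ne_punctured (-z.1)] with τ h1 h2
    have h4 : z + τ • ((1, 0) : ℂ × ℂ) ∈ innerTarget (.branch a hκ) :=
      ⟨fun h => h2 (by simp at h; linear_combination h), h1⟩
    exact ⟨h4, (innerInv_snd_ne_zero h4).2 trivial⟩

/-- `Θ` is the translation by the section `σ` of the fibration, from an open set of regular points
to the cotangent bundle with its coordinates `(x, p)`. -/
structure IsTranslation (σ : ℂ → ℂ × ℂ)
    (Θ : OpenPartialHomeomorph (HitchinSurface D) (ℂ × ℂ)) : Prop where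
  regular : ∀ m ∈ Θ.source, m ∈ D.regular
  good : ∀ m ∈ Θ.source, (D.quart (D.f m)).Good
  sect : ∀ m ∈ Θ.source, D.OnFibre (D.f m) (σ (D.f m))
  onFibre : ∀ m ∈ Θ.source, D.OnFibre (D.f m) (Θ m)
  point_eq : ∀ m ∈ Θ.source,
    D.point (D.f m) (Θ m) = pt (D.f m) m + D.point (D.f m) (σ (D.f m))
  symm : ∀ z ∈ Θ.target, ∃ L, IsSymp L ∧ HasMFDerivAt 𝓘(ℂ, ℂ × ℂ) 𝓘(ℂ, ℂ × ℂ) Θ.symm z L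

theorem exists_isTranslation {m₀ : HitchinSurface D} (hm₀ : m₀ ∈ D.regular)
    (hb : (D.quart (D.f m₀)).Good) {σ : ℂ → ℂ × ℂ} (hσ : ContDiffAt ℂ ω σ (D.f m₀))
    (hσ' : ∀ᶠ β in 𝓝 (D.f m₀), D.OnFibre β (σ β))
    (hx : stereoX m₀ ≠ stereo (σ (D.f m₀)).1) {E : Set ℂ} (hE : {0, 1, D.t} ⊆ E)
    (hE' : ∀ x, stereoX m₀ = stereo x → x ∈ E) {x w : ℂ} (hxw : (D.quart (D.f m₀)).IsNice E x w)
    (he : (D.quart (D.f m₀)).toPoint x w = pt (D.f m₀) m₀ + D.point (D.f m₀) (σ (D.f m₀)))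
    (hconj : (x, (D.s * x ^ 2 - w) / D.cubic x) ≠ ((σ (D.f m₀)).1, -(σ (D.f m₀)).2)) :
    ∃ Θ : OpenPartialHomeomorph (HitchinSurface D) (ℂ × ℂ), m₀ ∈ Θ.source ∧
      IsTranslation σ Θ ∧ Θ m₀ = (x, (D.s * x ^ 2 - w) / D.cubic x) := by
  set i := chartIndexAt m₀ with hi
  have hs : chartSource i m₀ := chartSource_chartIndexAt m₀
  set z₀ := chartMap i m₀ with hz₀
  have ht : z₀ ∈ chartTarget i := chartMap_mem hs
  have hf₀ : fChart i z₀ = D.f m₀ := fChart_chartMap hs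
  have hinv : chartInv i z₀ = m₀ := chartInv_chartMap hs
  have hc : ContDiffAt ℂ ω (fChart i) z₀ := contDiffAt_fChart ht
  have hc0 := hc.continuousAt
  have hci := continuousAt_chartInv ht
  obtain ⟨J, hJ, hJ'⟩ := exists_isRep hs
  rw [← hf₀] at hσ hσ'
  have eT : ∀ᶠ z in 𝓝 z₀, z ∈ chartTarget i := (isOpen_chartTarget i).mem_nhds ht
  have eR : ∀ᶠ z in 𝓝 z₀, chartInv i z ∈ D.regular :=
    hci.eventually_mem (isOpen_regular.mem_nhds (hinv.symm ▸ hm₀))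
  have eG : ∀ᶠ z in 𝓝 z₀, (D.quart (fChart i z)).Good :=
    hc0.eventually_mem (isOpen_setOf_good.mem_nhds (show (D.quart (fChart i z₀)).Good from
      hf₀.symm ▸ hb))
  have eS : ∀ᶠ z in 𝓝 z₀, D.OnFibre (fChart i z) (σ (fChart i z)) := hc0.eventually hσ'
  have eσ : ∀ᶠ z in 𝓝 z₀, ContDiffAt ℂ ω σ (fChart i z) :=
    hc0.eventually (hσ.eventually (by simp))
  have eJ : ∀ᶠ z in 𝓝 z₀, (D.quart (fChart i z)).W.toJacobian.Nonsingular (J z) ∧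
      Jacobian.Point.toAffine (D.quart (fChart i z)).W (J z) = pt (fChart i z) (chartInv i z) := by
    filter_upwards [eT, eR, eG] with z h1 h2 h3
    have := hJ' z h1 h2
    rw [f_chartInv h1] at this
    have h4 := this h3
    unfold IsRep at h4
    rwa [f_chartInv h1] at h4
  have eJ' : ∀ᶠ z in 𝓝 z₀, (D.quart (fChart i z)).W.toJacobian.Nonsingular
      (D.jac (fChart i z) (σ (fChart i z))) := by
    filter_upwards [eS, eG] with z h1 h2 using h1.nonsingular h2
  -- The formula for the sum requires different summands; equal ones would have the same `x`,
  -- against `hx`.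
  have hptne : pt (D.f m₀) m₀ ≠ D.point (D.f m₀) (σ (D.f m₀)) := by
    intro h
    have h1 := eS.self_of_nhds
    rw [hf₀] at h1
    have h2 := pt_injective hb hm₀ (h1.regular hb) h1.2 (h.trans (pt_interior h1.1.1).symm)
    exact hx (congrArg stereoX h2)
  obtain ⟨k, ck, kz, hk⟩ := exists_sum (D := D) (b := fChart i) (J := J)
    (J' := fun z => D.jac (fChart i z) (σ (fChart i z))) hc (hJ ω)
    (contDiffAt_jac hc (hσ.comp z₀ hc)) eG.self_of_nhds (eJ.mono fun z h => h.1) eJ'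
    (by rw [eJ.self_of_nhds.2, toAffine_jac, hinv, hf₀]; exact hptne) hE (x := x) (w := w)
    (by rwa [hf₀]) (by rw [eJ.self_of_nhds.2, toAffine_jac, hinv, hf₀]; exact he)
  have ck0 := ck.continuousAt
  have cσ : ContinuousAt (fun z => σ (fChart i z)) z₀ := hσ.continuousAt.comp hc0
  have cX : ContinuousAt (fun z => stereoX (chartInv i z)) z₀ :=
    continuous_stereoX.continuousAt.comp hci
  have e1 : ∀ᶠ z in 𝓝 z₀, stereoX (chartInv i z) ≠ stereo (σ (fChart i z)).1 := by
    have h1 : ContinuousAt (fun z => (stereoX (chartInv i z), stereo (σ (fChart i z)).1)) z₀ :=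
      cX.prodMk (continuous_stereo.continuousAt.comp cσ.fst)
    refine h1.eventually_mem ((isOpen_ne_fun continuous_fst continuous_snd).mem_nhds ?_)
    change stereoX (chartInv i z₀) ≠ stereo (σ (fChart i z₀)).1
    rwa [hinv, hf₀]
  have e2 : ∀ᶠ z in 𝓝 z₀, stereoX (chartInv i z) ≠ stereo (k z).1 := by
    have h1 : ContinuousAt (fun z => (stereoX (chartInv i z), stereo (k z).1)) z₀ :=
      cX.prodMk (continuous_stereo.continuousAt.comp ck0.fst)
    refine h1.eventually_mem ((isOpen_ne_fun continuous_fst continuous_snd).mem_nhds ?_)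
    change stereoX (chartInv i z₀) ≠ stereo (k z₀).1
    rw [hinv, kz]
    exact fun h => hxw.notMem (hE' x h)
  have e3 : ∀ᶠ z in 𝓝 z₀, k z ≠ ((σ (fChart i z)).1, -(σ (fChart i z)).2) := by
    have h1 : ContinuousAt (fun z => (k z, (σ (fChart i z)).1, -(σ (fChart i z)).2)) z₀ :=
      ck0.prodMk (cσ.fst.prodMk cσ.snd.neg)
    refine h1.eventually_mem ((isOpen_ne_fun continuous_fst continuous_snd).mem_nhds ?_)
    change k z₀ ≠ ((σ (fChart i z₀)).1, -(σ (fChart i z₀)).2)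
    rwa [kz, hf₀]
  have eW := (((eT.and eR).and (eG.and eS)).and ((eσ.and eJ).and (hk.and (ck.eventually
    (by simp))))).and ((e1.and e2).and e3)
  obtain ⟨W, hW, hWo, hzW⟩ := mem_nhds_iff.1 eW
  have hW' : ∀ z ∈ W, z ∈ chartTarget i ∧ chartInv i z ∈ D.regular ∧
      (D.quart (fChart i z)).Good ∧ D.OnFibre (fChart i z) (σ (fChart i z)) ∧
      ContDiffAt ℂ ω σ (fChart i z) ∧ D.OnFibre (fChart i z) (k z) ∧
      D.point (fChart i z) (k z) = pt (fChart i z) (chartInv i z)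
        + D.point (fChart i z) (σ (fChart i z)) ∧ ContDiffAt ℂ ω k z ∧
      stereoX (chartInv i z) ≠ stereo (σ (fChart i z)).1 ∧
      stereoX (chartInv i z) ≠ stereo (k z).1 ∧
      k z ≠ ((σ (fChart i z)).1, -(σ (fChart i z)).2) := by
    intro z hz
    obtain ⟨⟨⟨⟨h1, h2⟩, h3, h4⟩, ⟨h5, h6⟩, ⟨h7, h8⟩, h9⟩, ⟨h10, h11⟩, h12⟩ := hW hz
    refine ⟨h1, h2, h3, h4, h5, h7, ?_, h9, h10, h11, h12⟩
    rw [h8, h6.2, toAffine_jac]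
  clear_value i z₀
  -- the derivative is symplectic at the general points, hence everywhere
  have hgen : ∀ z ∈ W, z ∈ innerTarget i → (innerInv i z).2 ≠ 0 →
      IsSymp (fderiv ℂ k z) := by
    intro z hz hzi hp
    obtain ⟨L, hL, hL'⟩ := hasSympDerivAt_innerInv hzi
    have hin : ∀ z' ∈ W, z' ∈ innerTarget i → (innerInv i z').2 ≠ 0 →
        D.OnFibre (fChart i z') (innerInv i z') ∧ pt (fChart i z') (chartInv i z') =
          D.point (fChart i z') (innerInv i z') ∧ (innerInv i z').1 ≠ (σ (fChart i z')).1 ∧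
          (innerInv i z').1 ≠ (k z').1 ∧ (σ (fChart i z')).1 ≠ (k z').1 := by
      intro z' hz' hzi' hp'
      obtain ⟨h1, h2, h3, h4, h5, h6, h7, h8, h9, h10, h11⟩ := hW' z' hz'
      have hbase := innerSource_subset i (innerInv_mem hzi')
      have hf' : D.f₀ (innerInv i z').1 (innerInv i z').2 = fChart i z' := by
        rw [← f_chartInv h1, chartInv_inner hzi']
        rfl
      have hpt : pt (fChart i z') (chartInv i z') = D.point (fChart i z') (innerInv i z') := by
        rw [chartInv_inner hzi', pt_interior]
      have hfib : D.OnFibre (fChart i z') (innerInv i z') := ⟨⟨hbase, hp'⟩, hf'⟩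
      rw [chartInv_inner hzi'] at h9 h10
      refine ⟨hfib, hpt, fun h => h9 (congrArg stereo h), fun h => h10 (congrArg stereo h),
        fun h => ?_⟩
      -- If the sum and the section have the same `x`, they are equal, and the first summand would
      -- be zero although it is a finite point, or they are conjugate, which is excluded on `W`.
      rcases h6.ext_or h4 h.symm with h' | h'
      · rw [h', hpt] at h7
        exact SquareQuartic.toPoint_ne_zero h3 hfib.onCurve hfib.smooth
          (right_eq_add.1 h7)
      · exact h11 h'
    have hnear : ∀ᶠ z' in 𝓝 z, z' ∈ W ∧ z' ∈ innerTarget i ∧ (innerInv i z').2 ≠ 0 :=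
      (hWo.eventually_mem hz).and (((isOpen_innerTarget i).eventually_mem hzi).and
        (hL.continuousAt.snd.eventually_ne hp))
    obtain ⟨h1, h2, h3, h4, h5, h6, h7, h8, h9, h10, h11⟩ := hW' z hz
    obtain ⟨g1, g2, g3, g4, g5⟩ := hin z hz hzi hp
    have dσ := (h5.differentiableAt (by simp)).hasFDerivAt.comp z
      ((contDiffAt_fChart (n := 1) h1).differentiableAt one_ne_zero).hasFDerivAt
    have dk := (h8.differentiableAt (by simp)).hasFDerivAt
    intro α β
    have key := isotropic_of_interpolates (D := D) hL dσ dk g1.1.1 h4.1.1 h6.1.1 hp h4.1.2 h6.1.2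
      g3 g4 g5
      (by
        filter_upwards [hnear] with z' hz'
        rw [(hin z' hz'.1 hz'.2.1 hz'.2.2).1.2]
        exact (hW' z' hz'.1).2.2.2.1.2)
      (by
        filter_upwards [hnear] with z' hz'
        rw [(hin z' hz'.1 hz'.2.1 hz'.2.2).1.2]
        exact (hW' z' hz'.1).2.2.2.2.2.1.2)
      (by
        filter_upwards [hnear] with z' hz'
        obtain ⟨f1, f2, f3, f4, f5⟩ := hin z' hz'.1 hz'.2.1 hz'.2.2
        obtain ⟨k1, k2, k3, k4, k5, k6, k7, k8, k9, k10, k11⟩ := hW' z' hz'.1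
        refine (OnFibre.add_iff k3 f1 k4 k6 f3 f4 f5).1 ?_
        rw [k7, f2])
      (by rw [g1.2]; exact (good_iff.1 h3).1) α β
    -- The section enters only through `f`, so its derivative has rank at most one and the form
    -- pulls back to zero. The isotropy of the triple then says that the translation is symplectic.
    have hrank : stdForm ((fderiv ℂ σ (fChart i z)).comp (fderiv ℂ (fChart i) z) α)
        ((fderiv ℂ σ (fChart i z)).comp (fderiv ℂ (fChart i) z) β) = 0 := by
      have h : ∀ c : ℂ, fderiv ℂ σ (fChart i z) c = c • fderiv ℂ σ (fChart i z) 1 := fun c => by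
        rw [← map_smul, smul_eq_mul, mul_one]
      rw [ContinuousLinearMap.comp_apply, ContinuousLinearMap.comp_apply, h, h (fderiv ℂ _ z β),
        stdForm_apply]
      simp only [Prod.smul_fst, Prod.smul_snd, smul_eq_mul]
      ring
    rw [hrank, hL' α β] at key
    linear_combination key
  have hsymp : ∀ z ∈ W, IsSymp (fderiv ℂ k z) := by
    intro z hz α β
    have hkc : ContinuousAt (fderiv ℂ k) z :=
      (((hW' z hz).2.2.2.2.2.2.2.1).fderiv_right (m := 0) (by simp)).continuousAt
    by_contra hne
    have hcont : ContinuousAt (fun z' => stdForm (fderiv ℂ k z' α) (fderiv ℂ k z' β)) z := by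
      simp only [stdForm_apply]
      have h1 : ContinuousAt (fun z' => fderiv ℂ k z' α) z := hkc.clm_apply continuousAt_const
      have h2 : ContinuousAt (fun z' => fderiv ℂ k z' β) z := hkc.clm_apply continuousAt_const
      exact (h1.fst.mul h2.snd).sub (h1.snd.mul h2.fst)
    obtain ⟨z', ⟨h1, h2⟩, h3, h4⟩ := ((frequently_inner (hW' z hz).1).and_eventually
      ((hcont.eventually_ne hne).and (hWo.eventually_mem hz))).exists
    exact h3 (hgen z' h4 h1 h2 α β)
  have hkd : ∀ z (hz : z ∈ W), HasFDerivAt k ((hsymp z hz).equiv : ℂ × ℂ →L[ℂ] ℂ × ℂ) z := by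
    intro z hz
    rw [IsSymp.coe_equiv]
    exact ((hW' z hz).2.2.2.2.2.2.2.1.differentiableAt (by simp)).hasFDerivAt
  set e := (ck.toOpenPartialHomeomorph k (hkd z₀ hzW) (by simp)).restrOpen W hWo with he'
  have hcoe : (e : ℂ × ℂ → ℂ × ℂ) = k := rfl
  have hsub : e.source ⊆ W := Set.inter_subset_right
  have hz₀e : z₀ ∈ e.source := ⟨ck.mem_toOpenPartialHomeomorph_source (hkd z₀ hzW) (by simp), hzW⟩
  have hsrc : ∀ m ∈ ((homeo i).trans e).source, chartSource i m ∧ chartMap i m ∈ W ∧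
      fChart i (chartMap i m) = D.f m ∧ chartInv i (chartMap i m) = m := by
    intro m hm
    exact ⟨hm.1, hsub hm.2, fChart_chartMap hm.1, chartInv_chartMap hm.1⟩
  refine ⟨(homeo i).trans e, ⟨hs, ?_⟩, ⟨?_, ?_, ?_, ?_, ?_, ?_⟩, ?_⟩
  · change chartMap i m₀ ∈ e.source
    rw [← hz₀]
    exact hz₀e
  · intro m hm
    obtain ⟨h1, h2, h3, h4⟩ := hsrc m hm
    have := (hW' _ h2).2.1
    rwa [h4] at this
  · intro m hm
    obtain ⟨h1, h2, h3, h4⟩ := hsrc m hm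
    have := (hW' _ h2).2.2.1
    rwa [h3] at this
  · intro m hm
    obtain ⟨h1, h2, h3, h4⟩ := hsrc m hm
    have := (hW' _ h2).2.2.2.1
    rwa [h3] at this
  · intro m hm
    obtain ⟨h1, h2, h3, h4⟩ := hsrc m hm
    have := (hW' _ h2).2.2.2.2.2.1
    rwa [h3] at this
  · intro m hm
    obtain ⟨h1, h2, h3, h4⟩ := hsrc m hm
    have := (hW' _ h2).2.2.2.2.2.2.1
    rwa [h3, h4] at this
  · intro y hy
    have hy1 : y ∈ e.target := hy.1
    have hyW := hsub (e.map_target hy1)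
    obtain ⟨L, hL, hL'⟩ := hasMFDerivAt_chartInv (hW' _ hyW).1
    have hsy := e.hasFDerivAt_symm hy1 (hkd _ hyW)
    exact ⟨_, hL.comp (hsymp _ hyW).symm, hL'.comp y hsy.hasMFDerivAt⟩
  · change k (chartMap i m₀) = _
    rw [← hz₀, kz]

end FourPointData

namespace FourPointData

open Filter Topology WeierstrassCurve

variable {D : FourPointData}

/-! ### The graph of the addition -/

/-- The point `P` of the Weierstrass curve is in general position with respect to `m₀`, so that the
translation by a section through `P` is defined near `m₀`. -/
def Admissible (m₀ : HitchinSurface D) (P : (D.quart (D.f m₀)).W.toAffine.Point) : Prop :=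
  ∃ z, D.OnFibre (D.f m₀) z ∧ D.point (D.f m₀) z = P ∧ stereoX m₀ ≠ stereo z.1 ∧
    ∃ x w, (D.quart (D.f m₀)).IsNice ({0, 1, D.t} ∪ {x | stereoX m₀ = stereo x}) x w ∧
      (D.quart (D.f m₀)).toPoint x w = pt (D.f m₀) m₀ + P ∧
      (x, (D.s * x ^ 2 - w) / D.cubic x) ≠ (z.1, -z.2)

/-- Each condition excludes finitely many points. If the translate of `m₀` is conjugate to `P`, then
`2 P` is the second point at infinity minus the point of `m₀`. -/
lemma eventually_admissible {m₀ : HitchinSurface D} (hb : (D.quart (D.f m₀)).Good) :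
    ∀ᶠ P in cofinite, Admissible m₀ P := by
  set E : Set ℂ := {0, 1, D.t} ∪ {x | stereoX m₀ = stereo x} with hE
  have hEf : E.Finite := (Set.toFinite _).union (Set.Subsingleton.finite fun x hx y hy =>
    stereo_injective (Eq.trans (Eq.symm hx) hy))
  have hn := SquareQuartic.eventually_isNice hb hEf
  filter_upwards [hn, (add_right_injective (pt (D.f m₀) m₀)).tendsto_cofinite.eventually hn,
    (SquareQuartic.finite_double_eq ((D.quart (D.f m₀)).inftyPoint - pt (D.f m₀) m₀)).compl_mem_cofinite]
    with P h1 h2 h3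
  obtain ⟨x₀, w₀, h4, h5⟩ := h1
  obtain ⟨x, w, h6, h7⟩ := h2
  obtain ⟨h8, h9⟩ := onFibre_of_isNice h4 Set.subset_union_left
  obtain ⟨h10, h11⟩ := onFibre_of_isNice h6 Set.subset_union_left
  refine ⟨_, h8, h9.trans h5, fun h => h4.notMem (.inr h), x, w, h6, h7, fun h => h3 ?_⟩
  obtain ⟨h12, h13⟩ := Prod.mk.inj h
  subst h12
  have hA := cubic_ne_zero h8.1.1
  have hw : w = 2 * (D.quart (D.f m₀)).s * x ^ 2 - w₀ := by
    change w = 2 * D.s * x ^ 2 - w₀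
    simp only at h13 hA
    field_simp at h13
    linear_combination -h13
  have h14 := SquareQuartic.toPoint_add_conj hb h4.onCurve h4.ne
  rw [← hw, h5, h7] at h14
  change P + P = _
  rw [← h14]
  abel

lemma Admissible.exists_isTranslation {m₀ : HitchinSurface D} (hm₀ : m₀ ∈ D.regular)
    (hb : (D.quart (D.f m₀)).Good) {σ : ℂ → ℂ × ℂ} (hσ : ContDiffAt ℂ ω σ (D.f m₀))
    (hσ' : ∀ᶠ β in 𝓝 (D.f m₀), D.OnFibre β (σ β))
    (h : Admissible m₀ (D.point (D.f m₀) (σ (D.f m₀)))) :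
    ∃ Θ : OpenPartialHomeomorph (HitchinSurface D) (ℂ × ℂ), m₀ ∈ Θ.source ∧
      IsTranslation σ Θ ∧ ∃ x w, (D.quart (D.f m₀)).IsNice {0, 1, D.t} x w ∧
        Θ m₀ = (x, (D.s * x ^ 2 - w) / D.cubic x) ∧ (D.quart (D.f m₀)).toPoint x w =
          pt (D.f m₀) m₀ + D.point (D.f m₀) (σ (D.f m₀)) := by
  obtain ⟨z, h1, h2, h3, x, w, h4, h5, h6⟩ := h
  obtain rfl := h1.point_inj hb hσ'.self_of_nhds h2
  obtain ⟨Θ, h7, h8, h9⟩ := FourPointData.exists_isTranslation hm₀ hb hσ hσ' h3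
    Set.subset_union_left (fun x hx => .inr hx) h4 h5 h6
  exact ⟨Θ, h7, h8, x, w, ⟨h4.onCurve, h4.ne, h4.delta, fun h => h4.notMem (.inl h)⟩, h9, h5⟩

variable (D) in
/-- The graph of the addition on the fibres. -/
def addGraph : Set (HitchinSurface D × HitchinSurface D × HitchinSurface D) :=
  {m | (m.1 ∈ D.regular ∧ m.2.1 ∈ D.regular ∧ m.2.2 ∈ D.regular) ∧
    D.f m.2.1 = D.f m.1 ∧ D.f m.2.2 = D.f m.1 ∧ (D.quart (D.f m.1)).Good ∧
    pt (D.f m.1) m.1 + pt (D.f m.1) m.2.1 = pt (D.f m.1) m.2.2}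

/-- Translations by sections `σ₁`, `σ₂` and `σ₁ + σ₂` which move a point of the graph of the
addition to general position. -/
structure IsTranslationTriple (m : HitchinSurface D × HitchinSurface D × HitchinSurface D)
    (σ₁ σ₂ σ₃ : ℂ → ℂ × ℂ)
    (Θ₁ Θ₂ Θ₃ : OpenPartialHomeomorph (HitchinSurface D) (ℂ × ℂ)) : Prop where
  trans₁ : IsTranslation σ₁ Θ₁
  trans₂ : IsTranslation σ₂ Θ₂
  trans₃ : IsTranslation σ₃ Θ₃
  mem₁ : m.1 ∈ Θ₁.source
  mem₂ : m.2.1 ∈ Θ₂.source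
  mem₃ : m.2.2 ∈ Θ₃.source
  sect : ∀ᶠ β in 𝓝 (D.f m.1), D.point β (σ₃ β) = D.point β (σ₁ β) + D.point β (σ₂ β)
  ne₁₂ : (Θ₁ m.1).1 ≠ (Θ₂ m.2.1).1
  ne₁₃ : (Θ₁ m.1).1 ≠ (Θ₃ m.2.2).1
  ne₂₃ : (Θ₂ m.2.1).1 ≠ (Θ₃ m.2.2).1
  nice : ∃ x w, (D.quart (D.f m.1)).IsNice {0, 1, D.t} x w ∧
    Θ₃ m.2.2 = (x, (D.s * x ^ 2 - w) / D.cubic x)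

theorem exists_isTranslationTriple
    {m : HitchinSurface D × HitchinSurface D × HitchinSurface D} (hm : m ∈ D.addGraph) :
    ∃ σ₁ σ₂ σ₃ Θ₁ Θ₂ Θ₃, IsTranslationTriple m σ₁ σ₂ σ₃ Θ₁ Θ₂ Θ₃ := by
  obtain ⟨u, v, w⟩ := m
  obtain ⟨⟨hu, hv, hw⟩, fv, fw, hb, hadd⟩ := hm
  simp only at hu hv hw fv fw hb hadd
  generalize hbdef : D.f u = b at *
  have hinf := SquareQuartic.infinite_point hb
  -- The equality of the values of `f` is part of the condition, so that all three conditions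
  -- concern one group.
  have Au : ∀ᶠ P : (D.quart b).W.toAffine.Point in cofinite,
      ∃ h : D.f u = b, Admissible u (h ▸ P) := by
    subst hbdef
    exact (eventually_admissible hb).mono fun P h => ⟨rfl, h⟩
  have Av : ∀ᶠ P : (D.quart b).W.toAffine.Point in cofinite,
      ∃ h : D.f v = b, Admissible v (h ▸ P) := by
    subst fv
    exact (eventually_admissible hb).mono fun P h => ⟨rfl, h⟩
  have Aw : ∀ᶠ P : (D.quart b).W.toAffine.Point in cofinite,
      ∃ h : D.f w = b, Admissible w (h ▸ P) := by
    subst fw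
    exact (eventually_admissible hb).mono fun P h => ⟨rfl, h⟩
  have hE : ({0, 1, D.t} : Set ℂ).Finite := Set.toFinite _
  have hn := SquareQuartic.eventually_isNice hb hE
  -- First `P₁` is chosen in general position with respect to `u`, then `P₂` with respect to `v` and
  -- `u + P₁`, so that `P₁ + P₂` is admissible for `w` and the three translates have different `x`.
  -- The condition `P₂ ≠ P₁` is for the formula for `σ₁ + σ₂`.
  obtain ⟨P₁, ⟨_, hP₁⟩, ⟨x₁, w₁, n₁, p₁⟩, ⟨y₁, v₁, m₁, q₁⟩⟩ := (Au.and (hn.and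
    ((add_right_injective (pt b u)).tendsto_cofinite.eventually hn))).exists
  obtain ⟨P₂, ⟨⟨_, hP₂⟩, ⟨_, hP₃⟩⟩, ⟨⟨x₂, w₂, n₂, p₂⟩, ⟨x₃, w₃, n₃, p₃⟩⟩,
    ⟨y₂, v₂, y₃, v₃, m₂, m₃, q₂, q₃, h12, h13, h23⟩, hne⟩ :=
    ((Av.and ((add_right_injective P₁).tendsto_cofinite.eventually Aw)).and
      ((hn.and ((add_right_injective P₁).tendsto_cofinite.eventually hn)).and
        (((add_right_injective (pt b v)).tendsto_cofinite.eventually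
          (SquareQuartic.eventually_generic hb hE m₁.onCurve m₁.smooth)).and
        (Set.finite_singleton P₁).compl_mem_cofinite))).exists
  have hne' : P₁ ≠ P₂ := fun h => hne h.symm
  obtain ⟨o₁, r₁⟩ := onFibre_of_isNice n₁ subset_rfl
  obtain ⟨o₂, r₂⟩ := onFibre_of_isNice n₂ subset_rfl
  obtain ⟨σ₁, c₁, s₁, t₁⟩ := exists_section o₁
  obtain ⟨σ₂, c₂, s₂, t₂⟩ := exists_section o₂
  have hP₁' : D.point b (σ₁ b) = P₁ := by rw [s₁, r₁, p₁]
  have hP₂' : D.point b (σ₂ b) = P₂ := by rw [s₂, r₂, p₂]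
  have eG : ∀ᶠ β in 𝓝 b, (D.quart β).Good := isOpen_setOf_good.mem_nhds hb
  obtain ⟨σ₃, c₃, s₃, t₃⟩ := exists_sum (D := D) (b := fun β : ℂ => β)
    (J := fun β => D.jac β (σ₁ β)) (J' := fun β => D.jac β (σ₂ β)) (v := b) contDiffAt_id
    (contDiffAt_jac contDiffAt_id c₁) (contDiffAt_jac contDiffAt_id c₂) hb
    (by filter_upwards [eG, t₁] with β h1 h2 using h2.nonsingular h1)
    (by filter_upwards [eG, t₂] with β h1 h2 using h2.nonsingular h1)
    (by rw [toAffine_jac, toAffine_jac, hP₁', hP₂']; exact hne') subset_rfl n₃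
    (by rw [toAffine_jac, toAffine_jac, hP₁', hP₂', p₃])
  have hP₃' : D.point b (σ₃ b) = P₁ + P₂ := by
    rw [t₃.self_of_nhds.2, toAffine_jac, toAffine_jac, hP₁', hP₂']
  have tr : ∀ (m : HitchinSurface D), m ∈ D.regular → D.f m = b → ∀ σ : ℂ → ℂ × ℂ,
      ContDiffAt ℂ ω σ b → (∀ᶠ β in 𝓝 b, D.OnFibre β (σ β)) →
      (∃ h : D.f m = b, Admissible m (h ▸ D.point b (σ b))) →
      ∃ Θ : OpenPartialHomeomorph (HitchinSurface D) (ℂ × ℂ), m ∈ Θ.source ∧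
      IsTranslation σ Θ ∧ ∃ x w, (D.quart b).IsNice {0, 1, D.t} x w ∧
        Θ m = (x, (D.s * x ^ 2 - w) / D.cubic x) ∧ (D.quart b).toPoint x w =
          pt b m + D.point b (σ b) := by
    rintro m hm rfl σ h1 h2 ⟨_, h3⟩
    exact h3.exists_isTranslation hm hb h1 h2
  obtain ⟨Θ₁, a₁, b₁, X₁, W₁, N₁, e₁, f₁⟩ := tr u hu hbdef σ₁ c₁ t₁ ⟨hbdef, by rw [hP₁']; exact hP₁⟩
  obtain ⟨Θ₂, a₂, b₂, X₂, W₂, N₂, e₂, f₂⟩ := tr v hv fv σ₂ c₂ t₂ ⟨fv, by rw [hP₂']; exact hP₂⟩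
  obtain ⟨Θ₃, a₃, b₃, X₃, W₃, N₃, e₃, f₃⟩ := tr w hw fw σ₃ c₃ (t₃.mono fun β h => h.1)
    ⟨fw, by rw [hP₃']; exact hP₃⟩
  rw [hP₁'] at f₁
  rw [hP₂'] at f₂
  rw [hP₃', ← hadd] at f₃
  -- The translates agree with the chosen points in the group, hence have the same coordinates;
  -- their `x` are therefore different.
  obtain ⟨rfl, rfl⟩ := SquareQuartic.toPoint_inj hb m₁.onCurve N₁.onCurve m₁.smooth N₁.smooth
    (q₁.trans f₁.symm)
  obtain ⟨rfl, rfl⟩ := SquareQuartic.toPoint_inj hb m₂.onCurve N₂.onCurve m₂.smooth N₂.smooth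
    (q₂.trans f₂.symm)
  obtain ⟨rfl, rfl⟩ := SquareQuartic.toPoint_inj hb m₃.onCurve N₃.onCurve m₃.smooth N₃.smooth
    (by rw [q₃, q₁, f₃]; abel)
  refine ⟨σ₁, σ₂, σ₃, Θ₁, Θ₂, Θ₃, b₁, b₂, b₃, a₁, a₂, a₃, ?_, ?_, ?_, ?_, y₃, v₃, ?_, e₃⟩
  · simp only [hbdef]
    exact t₃.mono fun β h => h.2
  · simp only [e₁, e₂]
    exact h12
  · simp only [e₁, e₃]
    exact h13
  · simp only [e₂, e₃]
    exact h23
  · simp only [hbdef]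
    exact N₃

end FourPointData

/-! ### Local parametrizations of the graph of the addition. -/

open Filter Topology in
lemma isEmbedding_domRestrict {X Y : Type*} [TopologicalSpace X] [TopologicalSpace Y] {V : Set X}
    {φ : X → Y} {ψ : Y → X} (hφ : ContinuousOn φ V) (hψ : ∀ v ∈ V, ContinuousAt ψ (φ v))
    (h : ∀ v ∈ V, ψ (φ v) = v) : Topology.IsEmbedding (V.domRestrict φ) := by
  refine ⟨isInducing_iff_nhds.2 fun x => le_antisymm ?_ ?_, fun x y hxy => Subtype.ext ?_⟩
  · exact ((continuousOn_iff_continuous_domRestrict.1 hφ).continuousAt (x := x)).tendsto.le_comap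
  · have h1 : comap (V.domRestrict φ) (𝓝 (φ x)) ≤
        comap (V.domRestrict φ) (comap ψ (𝓝 (ψ (φ x)))) :=
      comap_mono (hψ x x.2).tendsto.le_comap
    refine h1.trans ?_
    rw [comap_comap, h x x.2, nhds_subtype_eq_comap]
    refine le_of_eq (congrArg (fun g => comap g (𝓝 (x : X))) ?_)
    funext y
    exact h y y.2
  · rw [← h x x.2, ← h y y.2]
    exact congrArg ψ hxy

/-- By Cramer's rule, two vectors of `ℂ²` on which the form does not vanish span the plane. -/
lemma surjective_of_stdForm {V : Type*} [AddCommGroup V] [Module ℂ V] {L : V →ₗ[ℂ] ℂ × ℂ} {a b : V}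
    (h : stdForm (L a) (L b) ≠ 0) : Function.Surjective L := by
  intro y
  refine ⟨(stdForm y (L b) / stdForm (L a) (L b)) • a +
    (stdForm (L a) y / stdForm (L a) (L b)) • b, ?_⟩
  rw [map_add, map_smul, map_smul]
  rw [stdForm_apply] at h
  simp only [stdForm_apply]
  refine Prod.ext ?_ ?_
  · simp only [Prod.fst_add, Prod.smul_fst, smul_eq_mul]
    rw [div_mul_eq_mul_div, div_mul_eq_mul_div, ← add_div, div_eq_iff h]
    ring
  · simp only [Prod.snd_add, Prod.smul_snd, smul_eq_mul]
    rw [div_mul_eq_mul_div, div_mul_eq_mul_div, ← add_div, div_eq_iff h]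
    ring

namespace FourPointData

open Filter Topology WeierstrassCurve

variable {D : FourPointData}

/-- The point `(f, x)` of a family of points `(x, p)` with `f` and `x` given determines the
derivative. -/
lemma fderiv_fx {g : (Fin 3 → ℂ) → ℂ × ℂ} {g' : (Fin 3 → ℂ) →L[ℂ] ℂ × ℂ} {v : Fin 3 → ℂ} {j : Fin 3}
    (hg : HasFDerivAt g g' v) (hbase : g v ∈ D.base)
    (h : ∀ᶠ u in 𝓝 v, D.f₀ (g u).1 (g u).2 = u 0 ∧ (g u).1 = u j) (a : Fin 3 → ℂ) :
    (g' a).1 = a j ∧ fderiv ℂ (fun z : ℂ × ℂ => D.f₀ z.1 z.2) (g v) (g' a) = a 0 := by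
  constructor
  · have h1 : HasFDerivAt (fun u => (g u).1) _ v := hg.fst
    have h2 : HasFDerivAt (fun u : Fin 3 → ℂ => u j) _ v :=
      (ContinuousLinearMap.proj (R := ℂ) (φ := fun _ : Fin 3 => ℂ) j).hasFDerivAt
    have h3 := (h2.congr_of_eventuallyEq (h.mono fun u hu => hu.2)).unique h1
    exact (congrArg (fun L => L a) h3).symm
  · have h0 := ((contDiffAt_f₀ (n := 1) hbase).differentiableAt one_ne_zero).hasFDerivAt
    have h1 := h0.comp v hg
    have h2 : HasFDerivAt (fun u : Fin 3 → ℂ => u 0) _ v :=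
      (ContinuousLinearMap.proj (R := ℂ) (φ := fun _ : Fin 3 => ℂ) 0).hasFDerivAt
    have h3 := (h2.congr_of_eventuallyEq (h.mono fun u hu => hu.1)).unique h1
    exact (congrArg (fun L => L a) h3).symm

lemma eq_zero_of_fderiv_f₀ {z u : ℂ × ℂ} (hz : z ∈ D.baseNe) (h1 : u.1 = 0)
    (h2 : fderiv ℂ (fun z : ℂ × ℂ => D.f₀ z.1 z.2) z u = 0) : u = 0 := by
  have e3 : u = u.2 • ((0, 1) : ℂ × ℂ) := Prod.ext (by simp [h1]) (by simp)
  rw [e3, map_smul, fderiv_f₀_snd hz.1, smul_eq_mul] at h2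
  have e4 : 2 * D.cubic z.1 * z.2 ≠ 0 :=
    mul_ne_zero (mul_ne_zero two_ne_zero (cubic_ne_zero hz.1)) hz.2
  exact Prod.ext h1 ((mul_eq_zero.1 h2).resolve_right e4)

/-- The direction `0` moves `f` but not `x`, so its image is a nonzero multiple of `∂/∂p`. The
direction `j` moves `x`. -/
lemma stdForm_ne_zero_of_fx {L : (Fin 3 → ℂ) →L[ℂ] ℂ × ℂ} {z : ℂ × ℂ} {j : Fin 3} (hj : j ≠ 0)
    (hL : ∀ a, (L a).1 = a j ∧ fderiv ℂ (fun z : ℂ × ℂ => D.f₀ z.1 z.2) z (L a) = a 0) :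
    stdForm (L (Pi.single 0 1)) (L (Pi.single j 1)) ≠ 0 := by
  obtain ⟨h1, h2⟩ := hL (Pi.single 0 1)
  have h3 := (hL (Pi.single j 1)).1
  rw [Pi.single_eq_of_ne hj] at h1
  rw [Pi.single_eq_same] at h2 h3
  intro h
  rw [stdForm_apply, h1, h3, zero_mul, mul_one, zero_sub, neg_eq_zero] at h
  have h4 : L (Pi.single 0 1) = 0 := Prod.ext h1 h
  rw [h4, map_zero] at h2
  exact zero_ne_one h2

/-- The direction `i` changes neither `f` nor `x`, and these are coordinates where `p ≠ 0`. -/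
lemma apply_single_eq_zero {L : (Fin 3 → ℂ) →L[ℂ] ℂ × ℂ} {z : ℂ × ℂ} {i j : Fin 3}
    (hz : z ∈ D.baseNe) (hi : i ≠ 0) (hij : i ≠ j)
    (hL : ∀ a, (L a).1 = a j ∧ fderiv ℂ (fun z : ℂ × ℂ => D.f₀ z.1 z.2) z (L a) = a 0) :
    L (Pi.single i 1) = 0 := by
  obtain ⟨h1, h2⟩ := hL (Pi.single i 1)
  rw [Pi.single_eq_of_ne hij.symm] at h1
  rw [Pi.single_eq_of_ne hi.symm] at h2
  exact eq_zero_of_fderiv_f₀ hz h1 h2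

/-- A local parametrization of the graph of the addition by `f` and the coordinates `x` of
translates of the first two components. -/
structure IsAddParam (V : Set (Fin 3 → ℂ))
    (φ : (Fin 3 → ℂ) → HitchinSurface D × HitchinSurface D × HitchinSurface D) : Prop where
  localParam : IsLocalParam (𝓘(ℂ, ℂ × ℂ).prod (𝓘(ℂ, ℂ × ℂ).prod 𝓘(ℂ, ℂ × ℂ))) D.addGraph 3 V φ
  isotropic : ∀ v ∈ V, ∀ a b : Fin 3 → ℂ, tripleForm D.Ω (φ v)
    (mfderiv 𝓘(ℂ, Fin 3 → ℂ) (𝓘(ℂ, ℂ × ℂ).prod (𝓘(ℂ, ℂ × ℂ).prod 𝓘(ℂ, ℂ × ℂ))) φ v a)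
    (mfderiv 𝓘(ℂ, Fin 3 → ℂ) (𝓘(ℂ, ℂ × ℂ).prod (𝓘(ℂ, ℂ × ℂ).prod 𝓘(ℂ, ℂ × ℂ))) φ v b) = 0
  submersion₁ : ∀ v ∈ V, ∃ L : (Fin 3 → ℂ) →L[ℂ] ℂ × ℂ,
    HasMFDerivAt 𝓘(ℂ, Fin 3 → ℂ) 𝓘(ℂ, ℂ × ℂ) (fun v => (φ v).1) v L ∧ Function.Surjective L
  submersion₂ : ∀ v ∈ V, ∃ L : (Fin 3 → ℂ) →L[ℂ] ℂ × ℂ,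
    HasMFDerivAt 𝓘(ℂ, Fin 3 → ℂ) 𝓘(ℂ, ℂ × ℂ) (fun v => (φ v).2.1) v L ∧ Function.Surjective L
  submersion₃ : ∀ v ∈ V, ∃ L : (Fin 3 → ℂ) →L[ℂ] ℂ × ℂ,
    HasMFDerivAt 𝓘(ℂ, Fin 3 → ℂ) 𝓘(ℂ, ℂ × ℂ) (fun v => (φ v).2.2) v L ∧ Function.Surjective L
  f_eq : ∀ v ∈ V, D.f (φ v).1 = v 0
  fst_eq : ∀ v ∈ V, ∀ v' ∈ V, v 0 = v' 0 → v 1 = v' 1 → (φ v).1 = (φ v').1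
  inj₁ : ∀ v ∈ V, ∀ v' ∈ V, (φ v).1 = (φ v').1 → v 1 = v' 1
  inj₂ : ∀ v ∈ V, ∀ v' ∈ V, (φ v).2.1 = (φ v').2.1 → v 2 = v' 2
  exists_add : ∀ v ∈ V, ∃ μ : HitchinSurface D × HitchinSurface D → HitchinSurface D,
    ContinuousAt μ ((φ v).1, (φ v).2.1) ∧ ∀ᶠ q in 𝓝 ((φ v).1, (φ v).2.1), ∀ w,
      (q.1, q.2, w) ∈ D.addGraph → w = μ q

theorem exists_isAddParam {m : HitchinSurface D × HitchinSurface D × HitchinSurface D}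
    (hm : m ∈ D.addGraph) : ∃ V φ, IsAddParam (D := D) V φ ∧ ∃ v ∈ V, φ v = m := by
  obtain ⟨σ₁, σ₂, σ₃, Θ₁, Θ₂, Θ₃, T⟩ := exists_isTranslationTriple hm
  obtain ⟨u₀, v₀, w₀⟩ := m
  obtain ⟨⟨hu, hv, hw⟩, fv, fw, hb, hadd⟩ := hm
  simp only at hu hv hw fv fw hb hadd
  obtain ⟨T₁, T₂, T₃, m₁, m₂, m₃, hsect, h12, h13, h23, X, Y, hXY, hXY'⟩ := T
  simp only at m₁ m₂ m₃ h12 h13 h23 hsect hXY hXY'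
  have o₁ := T₁.onFibre _ m₁
  have o₂ := T₂.onFibre _ m₂
  have o₃ := T₃.onFibre _ m₃
  have p₁ := T₁.point_eq _ m₁
  have p₂ := T₂.point_eq _ m₂
  have p₃ := T₃.point_eq _ m₃
  rw [fv] at o₂ p₂
  rw [fw] at o₃ p₃
  -- Because `σ₃ = σ₁ + σ₂`, the translates satisfy the same relation as the original points.
  have hsum : D.point (D.f u₀) (Θ₁ u₀) + D.point (D.f u₀) (Θ₂ v₀) = D.point (D.f u₀) (Θ₃ w₀) := by
    rw [p₁, p₂, p₃, hsect.self_of_nhds, ← hadd]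
    abel
  obtain ⟨e₁, s₁, b₁, c₁, d₁⟩ := exists_fx o₁.1
  obtain ⟨e₂, s₂, b₂, c₂, d₂⟩ := exists_fx o₂.1
  -- The parameters are the value of `f` and the `x`-coordinates of the first two translates. The
  -- third translate is their sum.
  set vv : Fin 3 → ℂ := ![D.f u₀, (Θ₁ u₀).1, (Θ₂ v₀).1] with hvv
  have q₁ : e₁ (Θ₁ u₀) = (vv 0, vv 1) := by rw [c₁, o₁.2]; rfl
  have q₂ : e₂ (Θ₂ v₀) = (vv 0, vv 2) := by rw [c₂, o₂.2]; rfl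
  have t₁ : (vv 0, vv 1) ∈ e₁.target := q₁ ▸ e₁.map_source s₁
  have t₂ : (vv 0, vv 2) ∈ e₂.target := q₂ ▸ e₂.map_source s₂
  have cp : ∀ (i j : Fin 3) (z : Fin 3 → ℂ), ContDiffAt ℂ ω (fun z : Fin 3 → ℂ => (z i, z j)) z :=
    fun i j z => (contDiff_apply ℂ ℂ i).contDiffAt.prodMk (contDiff_apply ℂ ℂ j).contDiffAt
  set g : (Fin 3 → ℂ) → ℂ × ℂ := fun z => e₁.symm (z 0, z 1) with hg
  set h : (Fin 3 → ℂ) → ℂ × ℂ := fun z => e₂.symm (z 0, z 2) with hh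
  have cg : ContDiffAt ℂ ω g vv := (d₁ _ t₁).comp vv (cp 0 1 vv)
  have ch : ContDiffAt ℂ ω h vv := (d₂ _ t₂).comp vv (cp 0 2 vv)
  have gv : g vv = Θ₁ u₀ := by
    change e₁.symm (vv 0, vv 1) = _
    rw [← q₁, e₁.left_inv s₁]
  have hv' : h vv = Θ₂ v₀ := by
    change e₂.symm (vv 0, vv 2) = _
    rw [← q₂, e₂.left_inv s₂]
  have gspec : ∀ z : Fin 3 → ℂ, (z 0, z 1) ∈ e₁.target → D.OnFibre (z 0) (g z) ∧ (g z).1 = z 1 := by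
    intro z hz
    have h1 := e₁.right_inv hz
    rw [c₁] at h1
    exact ⟨⟨b₁ (e₁.map_target hz), congrArg Prod.fst h1⟩, congrArg Prod.snd h1⟩
  have hspec : ∀ z : Fin 3 → ℂ, (z 0, z 2) ∈ e₂.target → D.OnFibre (z 0) (h z) ∧ (h z).1 = z 2 := by
    intro z hz
    have h1 := e₂.right_inv hz
    rw [c₂] at h1
    exact ⟨⟨b₂ (e₂.map_target hz), congrArg Prod.fst h1⟩, congrArg Prod.snd h1⟩
  have c0 : ContDiffAt ℂ ω (fun z : Fin 3 → ℂ => z 0) vv := (contDiff_apply ℂ ℂ 0).contDiffAt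
  have E₁ : ∀ᶠ z in 𝓝 vv, (z 0, z 1) ∈ e₁.target :=
    (cp 0 1 vv).continuousAt.eventually_mem (e₁.open_target.mem_nhds t₁)
  have E₂ : ∀ᶠ z in 𝓝 vv, (z 0, z 2) ∈ e₂.target :=
    (cp 0 2 vv).continuousAt.eventually_mem (e₂.open_target.mem_nhds t₂)
  have EG : ∀ᶠ z in 𝓝 vv, (D.quart (z 0)).Good :=
    c0.continuousAt.eventually_mem (isOpen_setOf_good.mem_nhds hb)
  obtain ⟨hfib, hpt⟩ := onFibre_of_isNice hXY subset_rfl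
  obtain ⟨k, ck, kv, hk⟩ := exists_sum (D := D) (b := fun z : Fin 3 → ℂ => z 0)
    (J := fun z => D.jac (z 0) (g z)) (J' := fun z => D.jac (z 0) (h z)) (v := vv) c0
    (contDiffAt_jac c0 cg) (contDiffAt_jac c0 ch) hb
    (by filter_upwards [EG, E₁] with z z1 z2 using (gspec z z2).1.nonsingular z1)
    (by filter_upwards [EG, E₂] with z z1 z2 using (hspec z z2).1.nonsingular z1)
    (by
      rw [toAffine_jac, toAffine_jac, gv, hv']
      exact fun he => h12 (congrArg Prod.fst (o₁.point_inj hb o₂ he))) subset_rfl hXY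
    (by
      rw [toAffine_jac, toAffine_jac, gv, hv']
      refine Eq.trans ?_ hsum.symm
      rw [hXY']
      exact hpt.symm)
  rw [← hXY'] at kv
  have cgc := cg.continuousAt
  have chc := ch.continuousAt
  have ckc := ck.continuousAt
  have EΘ₁ : ∀ᶠ z in 𝓝 vv, g z ∈ Θ₁.target :=
    cgc.eventually_mem (Θ₁.open_target.mem_nhds (gv ▸ Θ₁.map_source m₁))
  have EΘ₂ : ∀ᶠ z in 𝓝 vv, h z ∈ Θ₂.target :=
    chc.eventually_mem (Θ₂.open_target.mem_nhds (hv' ▸ Θ₂.map_source m₂))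
  have EΘ₃ : ∀ᶠ z in 𝓝 vv, k z ∈ Θ₃.target :=
    ckc.eventually_mem (Θ₃.open_target.mem_nhds (kv ▸ Θ₃.map_source m₃))
  have N : ∀ {p q : (Fin 3 → ℂ) → ℂ × ℂ}, ContinuousAt p vv → ContinuousAt q vv →
      (p vv).1 ≠ (q vv).1 → ∀ᶠ z in 𝓝 vv, (p z).1 ≠ (q z).1 := fun hp hq hpq =>
    (hp.fst.prodMk hq.fst).eventually_mem
      ((isOpen_ne_fun continuous_fst continuous_snd).mem_nhds hpq)
  have N₁₂ := N cgc chc (by rwa [gv, hv'])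
  have N₁₃ := N cgc ckc (by rwa [gv, kv])
  have N₂₃ := N chc ckc (by rwa [hv', kv])
  have Es : ∀ᶠ z in 𝓝 vv, D.point (z 0) (σ₃ (z 0)) =
      D.point (z 0) (σ₁ (z 0)) + D.point (z 0) (σ₂ (z 0)) := c0.continuousAt.eventually hsect
  obtain ⟨V, hV, hVo, hvV⟩ := mem_nhds_iff.1 (((E₁.and E₂).and ((EΘ₁.and EΘ₂).and EΘ₃)).and
    (((N₁₂.and N₁₃).and N₂₃).and ((hk.and Es).and (ck.eventually (by simp)))))
  have hV' : ∀ z ∈ V, ((z 0, z 1) ∈ e₁.target ∧ (z 0, z 2) ∈ e₂.target) ∧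
      (g z ∈ Θ₁.target ∧ h z ∈ Θ₂.target ∧ k z ∈ Θ₃.target) ∧
      ((g z).1 ≠ (h z).1 ∧ (g z).1 ≠ (k z).1 ∧ (h z).1 ≠ (k z).1) ∧
      D.OnFibre (z 0) (k z) ∧ D.point (z 0) (g z) + D.point (z 0) (h z) = D.point (z 0) (k z) ∧
      D.point (z 0) (σ₃ (z 0)) = D.point (z 0) (σ₁ (z 0)) + D.point (z 0) (σ₂ (z 0)) ∧
      ContDiffAt ℂ ω k z := by
    intro z hz
    obtain ⟨⟨z1, ⟨z2, z3⟩, z4⟩, ⟨⟨z5, z6⟩, z7⟩, ⟨⟨z8, z9⟩, z10⟩, z11⟩ := hV hz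
    exact ⟨z1, ⟨z2, z3, z4⟩, ⟨z5, z6, z7⟩, z8, z9.symm, z10, z11⟩
  set φ : (Fin 3 → ℂ) → HitchinSurface D × HitchinSurface D × HitchinSurface D := fun z =>
    (Θ₁.symm (g z), Θ₂.symm (h z), Θ₃.symm (k z)) with hφ
  have φv : φ vv = (u₀, v₀, w₀) := by
    simp only [hφ, gv, hv', kv, Θ₁.left_inv m₁, Θ₂.left_inv m₂, Θ₃.left_inv m₃]
  -- the values of `f`
  have F₁ : ∀ z ∈ V, D.f (φ z).1 = z 0 := fun z hz => by
    have h1 := (T₁.onFibre _ (Θ₁.map_target (hV' z hz).2.1.1)).2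
    rw [Θ₁.right_inv (hV' z hz).2.1.1, (gspec z (hV' z hz).1.1).1.2] at h1
    exact h1.symm
  have F₂ : ∀ z ∈ V, D.f (φ z).2.1 = z 0 := fun z hz => by
    have h1 := (T₂.onFibre _ (Θ₂.map_target (hV' z hz).2.1.2.1)).2
    rw [Θ₂.right_inv (hV' z hz).2.1.2.1, (hspec z (hV' z hz).1.2).1.2] at h1
    exact h1.symm
  have F₃ : ∀ z ∈ V, D.f (φ z).2.2 = z 0 := fun z hz => by
    have h1 := (T₃.onFibre _ (Θ₃.map_target (hV' z hz).2.1.2.2)).2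
    rw [Θ₃.right_inv (hV' z hz).2.1.2.2, (hV' z hz).2.2.2.1.2] at h1
    exact h1.symm
  have hG : ∀ z ∈ V, φ z ∈ D.addGraph := by
    intro z hz
    obtain ⟨-, ⟨z1, z2, z3⟩, -, -, z4, z5, -⟩ := hV' z hz
    have r₁ := T₁.point_eq _ (Θ₁.map_target z1)
    have r₂ := T₂.point_eq _ (Θ₂.map_target z2)
    have r₃ := T₃.point_eq _ (Θ₃.map_target z3)
    have a₁ := F₁ z hz
    have a₂ := F₂ z hz
    have a₃ := F₃ z hz
    simp only [hφ] at a₁ a₂ a₃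
    rw [a₁, Θ₁.right_inv z1] at r₁
    rw [a₂, Θ₂.right_inv z2] at r₂
    rw [a₃, Θ₃.right_inv z3] at r₃
    refine ⟨⟨T₁.regular _ (Θ₁.map_target z1), T₂.regular _ (Θ₂.map_target z2),
      T₃.regular _ (Θ₃.map_target z3)⟩, (a₂.trans a₁.symm), (a₃.trans a₁.symm),
      T₁.good _ (Θ₁.map_target z1), ?_⟩
    change pt (D.f (Θ₁.symm (g z))) (Θ₁.symm (g z)) + pt (D.f (Θ₁.symm (g z))) (Θ₂.symm (h z)) =
      pt (D.f (Θ₁.symm (g z))) (Θ₃.symm (k z))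
    rw [a₁]
    rw [r₁, r₂, r₃, z5] at z4
    rw [← sub_eq_zero] at z4 ⊢
    rw [← z4]
    abel
  -- the left inverse
  set ψ : HitchinSurface D × HitchinSurface D → Fin 3 → ℂ := fun q =>
    ![D.f q.1, (Θ₁ q.1).1, (Θ₂ q.2).1] with hψ
  have ψφ : ∀ z ∈ V, ψ ((φ z).1, (φ z).2.1) = z := by
    intro z hz
    have a₁ := F₁ z hz
    have a₂ := (gspec z (hV' z hz).1.1).2
    have a₃ := (hspec z (hV' z hz).1.2).2
    rw [← Θ₁.right_inv (hV' z hz).2.1.1] at a₂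
    rw [← Θ₂.right_inv (hV' z hz).2.1.2.1] at a₃
    funext j
    fin_cases j
    exacts [a₁, a₂, a₃]
  -- Only the first two components are restricted: they determine the third in the graph, because
  -- `pt` is injective on the regular points of a fibre.
  set U : Set (HitchinSurface D × HitchinSurface D) :=
    (Θ₁.source ×ˢ Θ₂.source) ∩ {q | Θ₁ q.1 ∈ e₁.source ∧ Θ₂ q.2 ∈ e₂.source ∧ ψ q ∈ V} with hU
  have cψ : ∀ q ∈ Θ₁.source ×ˢ Θ₂.source, ContinuousAt ψ q := by
    rintro q ⟨r1, r2⟩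
    have k1 : ContinuousAt (fun q : HitchinSurface D × HitchinSurface D => Θ₁ q.1) q :=
      (Θ₁.continuousAt r1).comp continuousAt_fst
    have k2 : ContinuousAt (fun q : HitchinSurface D × HitchinSurface D => Θ₂ q.2) q :=
      (Θ₂.continuousAt r2).comp continuousAt_snd
    refine continuousAt_pi.2 fun j => ?_
    fin_cases j
    exacts [continuous_f.continuousAt.comp continuousAt_fst, k1.fst, k2.fst]
  have hUo : IsOpen U := by
    refine isOpen_iff_mem_nhds.2 ?_
    rintro q ⟨r, r1, r2, r3⟩
    filter_upwards [(Θ₁.open_source.prod Θ₂.open_source).mem_nhds r,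
      ((Θ₁.continuousAt r.1).comp continuousAt_fst).eventually_mem (e₁.open_source.mem_nhds r1),
      ((Θ₂.continuousAt r.2).comp continuousAt_snd).eventually_mem (e₂.open_source.mem_nhds r2),
      (cψ q r).eventually_mem (hVo.mem_nhds r3)] with q' y1 y2 y3 y4
    exact ⟨y1, y2, y3, y4⟩
  have hUφ : ∀ z ∈ V, ((φ z).1, (φ z).2.1) ∈ U := by
    intro z hz
    obtain ⟨⟨z1, z2⟩, ⟨z3, z4, z5⟩, -⟩ := hV' z hz
    refine ⟨⟨Θ₁.map_target z3, Θ₂.map_target z4⟩, ?_, ?_, ?_⟩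
    · change Θ₁ (Θ₁.symm (g z)) ∈ _
      rw [Θ₁.right_inv z3]
      exact e₁.map_target z1
    · change Θ₂ (Θ₂.symm (h z)) ∈ _
      rw [Θ₂.right_inv z4]
      exact e₂.map_target z2
    · rw [ψφ z hz]
      exact hz
  have hUG : ∀ q ∈ U, ∀ w, (q.1, q.2, w) ∈ D.addGraph → φ (ψ q) = (q.1, q.2, w) := by
    rintro ⟨u, v⟩ ⟨⟨r1, r2⟩, r3, r4, r5⟩ w hw
    have k1 : (φ (ψ (u, v))).1 = u := by
      change Θ₁.symm (e₁.symm (D.f u, (Θ₁ u).1)) = u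
      have : e₁ (Θ₁ u) = (D.f u, (Θ₁ u).1) := by rw [c₁, (T₁.onFibre _ r1).2]
      rw [← this, e₁.left_inv r3, Θ₁.left_inv r1]
    have k2 : (φ (ψ (u, v))).2.1 = v := by
      change Θ₂.symm (e₂.symm (D.f u, (Θ₂ v).1)) = v
      have : e₂ (Θ₂ v) = (D.f u, (Θ₂ v).1) := by
        rw [c₂, (T₂.onFibre _ r2).2]
        exact congrArg (fun y => (y, (Θ₂ v).1)) hw.2.1
      rw [← this, e₂.left_inv r4, Θ₂.left_inv r2]
    have hG' := hG _ r5
    refine Prod.ext k1 (Prod.ext k2 ?_)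
    obtain ⟨⟨_, _, i1⟩, _, i2, i3, i4⟩ := hG'
    obtain ⟨⟨_, _, j1⟩, _, j2, j3, j4⟩ := hw
    rw [k1] at i2 i3 i4
    rw [k2, j4] at i4
    simp only at j1 j2 j3 i4
    refine pt_injective (by rwa [i2]) i1 j1 (j2.trans i2.symm) ?_
    rw [i2]
    exact i4.symm
  -- derivatives
  have dφ : ∀ z ∈ V, ∃ L₁ L₂ L₃ : ℂ × ℂ →L[ℂ] ℂ × ℂ, ∃ g' h' k' : (Fin 3 → ℂ) →L[ℂ] ℂ × ℂ,
      IsSymp L₁ ∧ IsSymp L₂ ∧ IsSymp L₃ ∧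
      HasMFDerivAt 𝓘(ℂ, Fin 3 → ℂ) 𝓘(ℂ, ℂ × ℂ) (fun z => (φ z).1) z (L₁.comp g') ∧
      HasMFDerivAt 𝓘(ℂ, Fin 3 → ℂ) 𝓘(ℂ, ℂ × ℂ) (fun z => (φ z).2.1) z (L₂.comp h') ∧
      HasMFDerivAt 𝓘(ℂ, Fin 3 → ℂ) 𝓘(ℂ, ℂ × ℂ) (fun z => (φ z).2.2) z (L₃.comp k') ∧
      (∀ a, (g' a).1 = a 1 ∧ fderiv ℂ (fun z : ℂ × ℂ => D.f₀ z.1 z.2) (g z) (g' a) = a 0) ∧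
      (∀ a, (h' a).1 = a 2 ∧ fderiv ℂ (fun z : ℂ × ℂ => D.f₀ z.1 z.2) (h z) (h' a) = a 0) ∧
      ∀ a b, -stdForm (g' a) (g' b) - stdForm (h' a) (h' b) + stdForm (k' a) (k' b) = 0 := by
    intro z hz
    obtain ⟨⟨z1, z2⟩, ⟨z3, z4, z5⟩, ⟨z6, z7, z8⟩, z9, z10, z11, z12⟩ := hV' z hz
    obtain ⟨L₁, l₁, n₁⟩ := T₁.symm _ z3
    obtain ⟨L₂, l₂, n₂⟩ := T₂.symm _ z4
    obtain ⟨L₃, l₃, n₃⟩ := T₃.symm _ z5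
    have dg : HasFDerivAt g (fderiv ℂ g z) z := ((((d₁ _ z1).comp z (cp 0 1 z) : ContDiffAt ℂ ω g z)).differentiableAt
      (by simp)).hasFDerivAt
    have dh : HasFDerivAt h (fderiv ℂ h z) z := ((((d₂ _ z2).comp z (cp 0 2 z) : ContDiffAt ℂ ω h z)).differentiableAt
      (by simp)).hasFDerivAt
    have dk := (z12.differentiableAt (by simp)).hasFDerivAt
    have EV := hVo.eventually_mem hz
    have og := (gspec z z1).1
    have oh := (hspec z z2).1
    refine ⟨L₁, L₂, L₃, _, _, _, l₁, l₂, l₃, n₁.comp z dg.hasMFDerivAt, n₂.comp z dh.hasMFDerivAt,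
      n₃.comp z dk.hasMFDerivAt, ?_, ?_, ?_⟩
    · exact fderiv_fx dg og.1.1 (EV.mono fun z' hz' =>
        ⟨(gspec z' (hV' z' hz').1.1).1.2, (gspec z' (hV' z' hz').1.1).2⟩)
    · exact fderiv_fx dh oh.1.1 (EV.mono fun z' hz' =>
        ⟨(hspec z' (hV' z' hz').1.2).1.2, (hspec z' (hV' z' hz').1.2).2⟩)
    · refine isotropic_of_interpolates dg dh dk og.1.1 oh.1.1 z9.1.1 og.1.2 oh.1.2 z9.1.2 z6 z7 z8
        (EV.mono fun z' hz' => ?_) (EV.mono fun z' hz' => ?_) (EV.mono fun z' hz' => ?_) ?_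
      · rw [(gspec z' (hV' z' hz').1.1).1.2, (hspec z' (hV' z' hz').1.2).1.2]
      · rw [(gspec z' (hV' z' hz').1.1).1.2, (hV' z' hz').2.2.2.1.2]
      · obtain ⟨⟨y1, y2⟩, -, ⟨y3, y4, y5⟩, y6, y7, -⟩ := hV' z' hz'
        have y8 := T₁.good _ (Θ₁.map_target (hV' z' hz').2.1.1)
        have y9 := F₁ z' hz'
        simp only [hφ] at y9
        rw [y9] at y8
        exact (OnFibre.add_iff y8 (gspec z' y1).1 (hspec z' y2).1 y6 y3 y4 y5).1 y7
      · have y8 := T₁.good _ (Θ₁.map_target z3)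
        have y9 := F₁ z hz
        simp only [hφ] at y9
        rw [y9] at y8
        rw [og.2]
        exact (good_iff.1 y8).1
  have Dφ : ∀ z ∈ V, ∃ L : (Fin 3 → ℂ) →L[ℂ] (ℂ × ℂ) × (ℂ × ℂ) × (ℂ × ℂ),
      HasMFDerivAt 𝓘(ℂ, Fin 3 → ℂ) (𝓘(ℂ, ℂ × ℂ).prod (𝓘(ℂ, ℂ × ℂ).prod 𝓘(ℂ, ℂ × ℂ))) φ z L ∧
      Function.Injective L ∧ ∀ a b, -stdForm (L a).1 (L b).1 - stdForm (L a).2.1 (L b).2.1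
        + stdForm (L a).2.2 (L b).2.2 = 0 := by
    intro z hz
    obtain ⟨L₁, L₂, L₃, g', h', k', l₁, l₂, l₃, n₁, n₂, n₃, G', H', I⟩ := dφ z hz
    refine ⟨(L₁.comp g').prod ((L₂.comp h').prod (L₃.comp k')), n₁.prodMk (n₂.prodMk n₃),
      (injective_iff_map_eq_zero _).2 fun a ha => ?_, fun a b => ?_⟩
    · have a₁ : g' a = 0 := l₁.injective ((congrArg Prod.fst ha).trans (map_zero L₁).symm)
      have a₂ : h' a = 0 := l₂.injective
        ((congrArg (fun y => y.2.1) ha).trans (map_zero L₂).symm)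
      obtain ⟨a₃, a₄⟩ := G' a
      obtain ⟨a₅, -⟩ := H' a
      rw [a₁] at a₃ a₄
      rw [a₂] at a₅
      rw [map_zero] at a₄
      funext j
      fin_cases j
      exacts [a₄.symm, a₃.symm, a₅.symm]
    · rw [← I a b, ← l₁ (g' a), ← l₂ (h' a), ← l₃ (k' a)]
      rfl
  have hcont : ContinuousOn φ V := fun z hz => by
    obtain ⟨L, hL, -⟩ := Dφ z hz
    exact hL.1.continuousWithinAt
  refine ⟨V, φ, ⟨⟨hVo, ?_, ?_, ?_, ?_⟩, ?_, ?_, ?_, ?_, F₁, ?_, ?_, ?_, ?_⟩, vv, hvV, φv⟩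
  · intro z hz
    obtain ⟨L, hL, -⟩ := Dφ z hz
    exact hL.mdifferentiableAt.mdifferentiableWithinAt
  · intro z hz
    obtain ⟨L, hL, hL', -⟩ := Dφ z hz
    rw [hL.mfderiv]
    exact hL'
  · refine isEmbedding_domRestrict (ψ := fun y => ψ (y.1, y.2.1)) hcont (fun z hz => ?_) ψφ
    refine ContinuousAt.comp (g := ψ) (cψ _ (hUφ z hz).1) ?_
    exact (continuous_fst.prodMk (continuous_fst.comp continuous_snd)).continuousAt
  · refine ⟨{y | (y.1, y.2.1) ∈ U},
      hUo.preimage (continuous_fst.prodMk (continuous_fst.comp continuous_snd)), ?_⟩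
    ext y
    constructor
    · rintro ⟨z, hz, rfl⟩
      exact ⟨hG z hz, hUφ z hz⟩
    · rintro ⟨hy, hyU⟩
      exact ⟨ψ (y.1, y.2.1), hyU.2.2.2, hUG _ hyU _ hy⟩
  · intro z hz a b
    obtain ⟨L, hL, -, hL'⟩ := Dφ z hz
    rw [hL.mfderiv]
    exact hL' a b
  · intro z hz
    obtain ⟨L₁, L₂, L₃, g', h', k', l₁, l₂, l₃, n₁, n₂, n₃, G', H', I⟩ := dφ z hz
    refine ⟨_, n₁, l₁.surjective.comp (surjective_of_stdForm
      (L := (g' : (Fin 3 → ℂ) →ₗ[ℂ] ℂ × ℂ)) (stdForm_ne_zero_of_fx one_ne_zero G'))⟩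
  · intro z hz
    obtain ⟨L₁, L₂, L₃, g', h', k', l₁, l₂, l₃, n₁, n₂, n₃, G', H', I⟩ := dφ z hz
    refine ⟨_, n₂, l₂.surjective.comp (surjective_of_stdForm
      (L := (h' : (Fin 3 → ℂ) →ₗ[ℂ] ℂ × ℂ)) (stdForm_ne_zero_of_fx (by decide) H'))⟩
  · intro z hz
    obtain ⟨L₁, L₂, L₃, g', h', k', l₁, l₂, l₃, n₁, n₂, n₃, G', H', I⟩ := dφ z hz
    -- The direction `1` fixes the second point. Isotropy therefore carries the nonzero value of the
    -- form on the first point over to the third.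
    have i₁ := I (Pi.single 0 1) (Pi.single 1 1)
    rw [apply_single_eq_zero (hspec z (hV' z hz).1.2).1.1 one_ne_zero (by decide) H', map_zero,
      sub_zero] at i₁
    refine ⟨_, n₃, l₃.surjective.comp (surjective_of_stdForm
      (L := (k' : (Fin 3 → ℂ) →ₗ[ℂ] ℂ × ℂ)) (a := Pi.single 0 1) (b := Pi.single 1 1) ?_)⟩
    intro i₂
    exact stdForm_ne_zero_of_fx one_ne_zero G' (by linear_combination i₂ - i₁)
  · intro z hz z' hz' h0 h1
    change Θ₁.symm (e₁.symm (z 0, z 1)) = Θ₁.symm (e₁.symm (z' 0, z' 1))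
    rw [h0, h1]
  · intro z hz z' hz' he
    rw [← ψφ z hz, ← ψφ z' hz']
    change (Θ₁ (φ z).1).1 = (Θ₁ (φ z').1).1
    rw [he]
  · intro z hz z' hz' he
    rw [← ψφ z hz, ← ψφ z' hz']
    change (Θ₂ (φ z).2.1).1 = (Θ₂ (φ z').2.1).1
    rw [he]
  · intro z hz
    refine ⟨fun q => (φ (ψ q)).2.2, ?_, ?_⟩
    · refine ContinuousAt.comp (g := fun z => (φ z).2.2) ?_ (cψ _ (hUφ z hz).1)
      rw [ψφ z hz]
      exact (hcont.continuousAt (hVo.mem_nhds hz)).snd.snd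
    · filter_upwards [hUo.mem_nhds (hUφ z hz)] with q hq w hw
      rw [hUG q hq w hw]

end FourPointData

namespace FourPointData

open Filter Topology WeierstrassCurve

variable {D : FourPointData}

/-! ### The correspondence is the graph of the addition -/

lemma mem_addGraph_of_equations {m : HitchinSurface D × HitchinSurface D × HitchinSurface D}
    (hm : m ∈ D.equations) (h₁ : m.1 ∈ D.regular) (h₂ : m.2.1 ∈ D.regular)
    (h₃ : m.2.2 ∈ D.regular) (hb : (D.quart (D.f m.1)).Good) : m ∈ D.addGraph := by
  obtain ⟨x₁, p₁, x₂, p₂, x₃, p₃, b₁, b₂, b₃, rfl, h12, h13, h23, f12, f23, hI⟩ := hm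
  have e₂ : D.f (.interior (x₂, p₂) b₂) = D.f (.interior (x₁, p₁) b₁) := f12.symm
  have e₃ : D.f (.interior (x₃, p₃) b₃) = D.f (.interior (x₁, p₁) b₁) := (f12.trans f23).symm
  refine ⟨⟨h₁, h₂, h₃⟩, e₂, e₃, hb, ?_⟩
  simp only at h₁ h₂ h₃ hb ⊢
  have c₁ := onCurve_of_finite (m := .interior (x₁, p₁) b₁) trivial
  have c₂ := onCurve_of_finite (m := .interior (x₂, p₂) b₂) trivial
  have c₃ := onCurve_of_finite (m := .interior (x₃, p₃) b₃) trivial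
  have s₁ := smooth_of_finite (m := .interior (x₁, p₁) b₁) trivial h₁
  have s₂ := smooth_of_finite (m := .interior (x₂, p₂) b₂) trivial h₂
  have s₃ := smooth_of_finite (m := .interior (x₃, p₃) b₃) trivial h₃
  rw [e₂] at c₂ s₂
  rw [e₃] at c₃ s₃
  rw [pt_of_finite (show IsFinite (.interior (x₁, p₁) b₁) from trivial),
    pt_of_finite (show IsFinite (.interior (x₂, p₂) b₂) from trivial),
    pt_of_finite (show IsFinite (.interior (x₃, p₃) b₃) from trivial),
    SquareQuartic.toPoint_add_iff hb c₁ c₂ c₃ s₁ s₂ s₃ h12 h13 h23]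
  simp only [show ∀ b, (D.quart b).s = D.s from fun _ => rfl, wCoord, xCoord, yCoord,
    sub_sub_cancel, cubic]
  rw [← hI]
  ring

lemma continuousAt_xCoord {m : HitchinSurface D} (h : IsFinite m) : ContinuousAt xCoord m := by
  have hs := chartSource_chartIndexAt m
  have hp : chartPuncture (chartIndexAt m) ≠ some .infty := by
    rcases m with ⟨z, hz⟩ | ⟨a, v, b, hv, hs⟩
    · simp [chartIndexAt, chartPuncture]
    · have ha : a ≠ .infty := h
      by_cases h0 : v = 0 <;> simp [chartIndexAt, chartPuncture, h0, ha]
  rw [continuousAt_iff_chart hs]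
  refine (contDiff_xChart (D := D) (n := 0) (chartIndexAt m)).continuous.continuousAt.congr ?_
  filter_upwards [(isOpen_chartTarget _).mem_nhds (chartMap_mem hs)] with z hz
  exact (chartInv_finite hp hz).2.1.symm

/-- The discriminant of `Q_b (x) - b (x - x₁) (x - x₂) (x - x₃)`. -/
def discr (D : FourPointData) (b x₁ x₂ x₃ : ℂ) : ℂ :=
  ((D.quart b).d - b * (x₁ * x₂ + x₁ * x₃ + x₂ * x₃)) ^ 2 -
    4 * ((D.quart b).c + b * (x₁ + x₂ + x₃)) * ((D.quart b).e + b * (x₁ * x₂ * x₃))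

/-- For `s = 0` the interpolating polynomial is `c₁ x + c₀`, and `Q_b (x) - b (x - x₁) (x - x₂) (x -
x₃)` is its square. -/
lemma discr_eq_zero (hs : D.s = 0) {m : HitchinSurface D × HitchinSurface D × HitchinSurface D}
    (hm : m ∈ D.equations) :
    D.discr (D.f m.1) (xCoord m.1) (xCoord m.2.1) (xCoord m.2.2) = 0 := by
  obtain ⟨x₁, p₁, x₂, p₂, x₃, p₃, b₁, b₂, b₃, rfl, h12, h13, h23, f12, f23, hI⟩ := hm
  simp only [xCoord, f]
  have q₁ := (f₀_eq_iff b₁).1 rfl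
  have q₂ := (f₀_eq_iff b₂).1 f12.symm
  have q₃ := (f₀_eq_iff b₃).1 (f12.trans f23).symm
  simp only at q₁ q₂ q₃
  set b := D.f₀ x₁ p₁ with hb
  set c₁ := (D.cubic x₁ * p₁ - D.cubic x₂ * p₂) / (x₁ - x₂) with hc₁
  set c₀ := D.cubic x₁ * p₁ - c₁ * x₁ with hc₀
  have d12 := sub_ne_zero.2 h12
  have d13 := sub_ne_zero.2 h13
  have d23 := sub_ne_zero.2 h23
  have y₁ : D.cubic x₁ * p₁ = D.s * x₁ ^ 2 + c₁ * x₁ + c₀ := by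
    rw [hs, hc₀]
    ring
  have y₂ : D.cubic x₂ * p₂ = D.s * x₂ ^ 2 + c₁ * x₂ + c₀ := by
    rw [hs, hc₀, hc₁]
    field_simp
    ring
  have y₃ : -(D.cubic x₃ * p₃) = D.s * x₃ ^ 2 + c₁ * x₃ + c₀ := by
    rw [hs, hc₀, hc₁]
    rw [← neg_sub x₁ x₂, ← neg_sub x₁ x₃, ← neg_sub x₂ x₃, hs] at hI
    unfold cubic
    field_simp at hI ⊢
    linear_combination hI
  have hfac := eval_sub_sq_eq (c₁ := c₁) (c₀ := c₀) h12 h13 h23 (by rw [← q₁, y₁])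
    (by rw [← q₂, y₂]) (by rw [← q₃, ← y₃, neg_sq])
  have ha : (D.quart b).a = b := by simp [quart, hs]
  have hss : (D.quart b).s = 0 := hs
  have g0 := hfac 0
  have g1 := hfac 1
  have g2 := hfac (-1)
  unfold SquareQuartic.eval at g0 g1 g2
  rw [ha, hs, hss] at g0 g1 g2
  have i1 : c₁ ^ 2 = (D.quart b).c + b * (x₁ + x₂ + x₃) := by
    linear_combination -(g1 + g2) / 2 + g0
  have i2 : 2 * c₁ * c₀ = (D.quart b).d - b * (x₁ * x₂ + x₁ * x₃ + x₂ * x₃) := by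
    linear_combination -(g1 - g2) / 2
  have i3 : c₀ ^ 2 = (D.quart b).e + b * (x₁ * x₂ * x₃) := by
    linear_combination -g0
  unfold discr
  rw [← i1, ← i2, ← i3]
  ring

/-- For `s = b = 0` the quartic has degree at most two, and vanishing discriminant makes it a
square. -/
lemma isReducible_of_discr (hs : D.s = 0) {x₁ x₂ x₃ : ℂ} (h : D.discr 0 x₁ x₂ x₃ = 0) :
    D.IsReducible 0 := by
  have ha : (D.quart 0).a = 0 := by simp [quart, hs]
  have hss : (D.quart 0).s = 0 := hs
  have hev : ∀ x, D.quartic 0 x = (D.quart 0).c * x ^ 2 + (D.quart 0).d * x + (D.quart 0).e := by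
    intro x
    rw [← quart_eval, SquareQuartic.eval, ha, hss]
    ring
  simp only [discr, zero_mul, sub_zero, add_zero] at h
  obtain ⟨γ, hγ⟩ := IsAlgClosed.exists_pow_nat_eq (D.quart 0).c two_pos
  obtain ⟨ε, hε⟩ := IsAlgClosed.exists_pow_nat_eq (D.quart 0).e two_pos
  have h2 : (D.quart 0).d = 2 * γ * ε ∨ (D.quart 0).d = -(2 * γ * ε) := by
    refine sq_eq_sq_iff_eq_or_eq_neg.1 ?_
    rw [← hγ, ← hε] at h
    linear_combination h
  rcases h2 with h2 | h2
  · refine ⟨ε, γ, 0, fun x => ?_⟩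
    rw [hev, h2, ← hγ, ← hε]
    ring
  · refine ⟨-ε, γ, 0, fun x => ?_⟩
    rw [hev, h2, ← hγ, ← hε]
    ring

/-- The value `b = 0` is the one omitted at infinity when `s = 0`. -/
lemma isFinite_of_eq_zero (hs : D.s = 0) {m : HitchinSurface D} (h : D.f m = 0) : IsFinite m := by
  rcases m with ⟨z, hz⟩ | ⟨a, v, b, hv, hs'⟩
  · trivial
  · intro ha
    subst ha
    have hb : b = 0 := h
    have hv0 : v = 0 := by simpa [κ, hs] using hv
    simp [β, hs, hb, hv0] at hs'

theorem P_subset_addGraph : D.P ⊆ D.addGraph := by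
  rintro m ⟨hm, h₁, h₂, h₃⟩
  have cf := continuous_f (D := D)
  have hf : D.f m.2.1 = D.f m.1 ∧ D.f m.2.2 = D.f m.1 := by
    have hcl : IsClosed {m : HitchinSurface D × HitchinSurface D × HitchinSurface D |
        D.f m.2.1 = D.f m.1 ∧ D.f m.2.2 = D.f m.1} :=
      (isClosed_eq (cf.comp (by fun_prop)) (cf.comp (by fun_prop))).and
        (isClosed_eq (cf.comp (by fun_prop)) (cf.comp (by fun_prop)))
    refine hcl.closure_subset_iff.2 ?_ hm
    rintro _ ⟨x₁, p₁, x₂, p₂, x₃, p₃, b₁, b₂, b₃, rfl, h12, h13, h23, f12, f23, hI⟩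
    exact ⟨f12.symm, (f12.trans f23).symm⟩
  have hne : (𝓝[D.equations] m).NeBot := mem_closure_iff_nhdsWithin_neBot.1 hm
  -- Only `s = b = 0` has to be excluded. There all points are finite, so the vanishing of `discr`
  -- passes to the limit and the fibre would be reducible.
  have hb : (D.quart (D.f m.1)).Good := by
    refine good_iff.2 ⟨h₁.2, ?_⟩
    by_contra! hc
    obtain ⟨hs, hb0⟩ := hc
    refine h₁.2 ?_
    rw [hb0]
    refine isReducible_of_discr hs (x₁ := xCoord m.1) (x₂ := xCoord m.2.1) (x₃ := xCoord m.2.2) ?_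
    have k1 : ContinuousAt (fun m : HitchinSurface D × HitchinSurface D × HitchinSurface D =>
        xCoord m.1) m := (continuousAt_xCoord (isFinite_of_eq_zero hs hb0)).comp continuousAt_fst
    have k2 : ContinuousAt (fun m : HitchinSurface D × HitchinSurface D × HitchinSurface D =>
        xCoord m.2.1) m := ContinuousAt.comp (g := xCoord)
          (f := fun m : HitchinSurface D × HitchinSurface D × HitchinSurface D => m.2.1)
          (continuousAt_xCoord (isFinite_of_eq_zero hs (hf.1.trans hb0)))
          (continuous_fst.comp continuous_snd).continuousAt
    have k3 : ContinuousAt (fun m : HitchinSurface D × HitchinSurface D × HitchinSurface D =>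
        xCoord m.2.2) m := ContinuousAt.comp (g := xCoord)
          (f := fun m : HitchinSurface D × HitchinSurface D × HitchinSurface D => m.2.2)
          (continuousAt_xCoord (isFinite_of_eq_zero hs (hf.2.trans hb0)))
          (continuous_snd.comp continuous_snd).continuousAt
    have k0 : ContinuousAt (fun m : HitchinSurface D × HitchinSurface D × HitchinSurface D =>
        D.f m.1) m := (cf.comp continuous_fst).continuousAt
    have kd : ContinuousAt (fun m : HitchinSurface D × HitchinSurface D × HitchinSurface D =>
        D.discr (D.f m.1) (xCoord m.1) (xCoord m.2.1) (xCoord m.2.2)) m := by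
      unfold discr
      simp only [quart]
      fun_prop
    have key : D.discr (D.f m.1) (xCoord m.1) (xCoord m.2.1) (xCoord m.2.2) = 0 := by
      refine tendsto_nhds_unique (l := 𝓝[D.equations] m)
        (kd.tendsto.mono_left nhdsWithin_le_nhds) (tendsto_const_nhds.congr' ?_)
      filter_upwards [self_mem_nhdsWithin] with m' hm' using (discr_eq_zero hs hm').symm
    rwa [hb0] at key
  -- With `w` the true sum of the first two components, solutions of the equations near `m` have
  -- third component `μ` of the first two. By continuity of `μ` it tends to `w`, and limits are
  -- unique.
  obtain ⟨w, hw, fw, pw⟩ := pt_surjective hb (pt (D.f m.1) m.1 + pt (D.f m.1) m.2.1)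
  have hG : (m.1, m.2.1, w) ∈ D.addGraph := ⟨⟨h₁, h₂, hw⟩, hf.1, fw, hb, pw.symm⟩
  obtain ⟨V, φ, hφ, v, hv, hv'⟩ := exists_isAddParam hG
  obtain ⟨μ, hμ, hμ'⟩ := hφ.exists_add v hv
  rw [hv'] at hμ hμ'
  simp only at hμ hμ'
  have c12 : Tendsto (fun m : HitchinSurface D × HitchinSurface D × HitchinSurface D =>
      (m.1, m.2.1)) (𝓝 m) (𝓝 (m.1, m.2.1)) :=
    (continuous_fst.prodMk (continuous_fst.comp continuous_snd)).tendsto m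
  have e1 : ∀ᶠ m' in 𝓝[D.equations] m, m'.2.2 = μ (m'.1, m'.2.1) := by
    have r1 : ∀ᶠ m' in 𝓝 m, m'.1 ∈ D.regular ∧ m'.2.1 ∈ D.regular ∧ m'.2.2 ∈ D.regular :=
      (continuousAt_fst.eventually_mem (isOpen_regular.mem_nhds h₁)).and
        (((continuous_fst.comp continuous_snd).continuousAt.eventually_mem
          (isOpen_regular.mem_nhds h₂)).and
        ((continuous_snd.comp continuous_snd).continuousAt.eventually_mem
          (isOpen_regular.mem_nhds h₃)))
    have r2 : ∀ᶠ m' : HitchinSurface D × HitchinSurface D × HitchinSurface D in 𝓝 m,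
        (D.quart (D.f m'.1)).Good :=
      (cf.comp continuous_fst).continuousAt.eventually_mem (isOpen_setOf_good.mem_nhds hb)
    filter_upwards [self_mem_nhdsWithin, nhdsWithin_le_nhds r1, nhdsWithin_le_nhds r2,
      nhdsWithin_le_nhds (c12.eventually hμ')] with m' a1 a2 a3 a4
    exact a4 _ (mem_addGraph_of_equations a1 a2.1 a2.2.1 a2.2.2 a3)
  have e2 : m.2.2 = w := by
    rw [hμ'.self_of_nhds w hG]
    refine tendsto_nhds_unique (l := 𝓝[D.equations] m)
      (((continuous_snd.comp continuous_snd).tendsto m).mono_left nhdsWithin_le_nhds) ?_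
    refine Tendsto.congr' (e1.mono fun m' h => h.symm) ?_
    exact (hμ.tendsto.comp c12).mono_left nhdsWithin_le_nhds
  rw [show m = (m.1, m.2.1, w) from Prod.ext rfl (Prod.ext rfl e2)]
  exact hG

/-- An injective map pulls the finite set of exceptions back to a finite set, which a punctured
neighbourhood avoids. -/
lemma eventually_of_cofinite {α : Type*} {g : ℂ → α} {N : Set ℂ} {x : ℂ} (hN : N ∈ 𝓝 x)
    (hg : Set.InjOn g N) {p : α → Prop} (hp : ∀ᶠ a in cofinite, p a) :
    ∀ᶠ z in 𝓝[≠] x, p (g z) := by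
  have h1 : (N ∩ g ⁻¹' {a | ¬ p a}).Finite :=
    Set.Finite.of_finite_image ((show {a | ¬ p a}.Finite from hp).subset (by
      rintro _ ⟨z, hz, rfl⟩
      exact hz.2)) (hg.mono Set.inter_subset_left)
  have h2 : ((N ∩ g ⁻¹' {a | ¬ p a}) ∩ {x}ᶜ)ᶜ ∈ 𝓝 x :=
    (h1.subset Set.inter_subset_left).isClosed.isOpen_compl.mem_nhds fun h => h.2 rfl
  filter_upwards [nhdsWithin_le_nhds hN, nhdsWithin_le_nhds h2, self_mem_nhdsWithin] with z z1 z2 z3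
  by_contra h
  exact z2 ⟨⟨z1, h⟩, z3⟩

/-- A regular point which corresponds to a point in general position lies in the cotangent bundle. -/
lemma exists_interior {b x w : ℂ} {E : Set ℂ} (hb : (D.quart b).Good) {m : HitchinSurface D}
    (hm : m ∈ D.regular) (hf : D.f m = b) (h : (D.quart b).IsNice E x w) (hE : {0, 1, D.t} ⊆ E)
    (he : (D.quart b).toPoint x w = pt b m) :
    ∃ z hz, m = .interior z hz ∧ z.1 = x ∧ D.OnFibre b z := by
  obtain ⟨h1, h2⟩ := onFibre_of_isNice h hE
  refine ⟨_, h1.1.1, ?_, rfl, h1⟩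
  subst hf
  refine pt_injective hb hm (h1.regular hb) h1.2 ?_
  rw [pt_interior, h2, he]

theorem addGraph_subset_closure : D.addGraph ⊆ closure D.equations := by
  intro m hm
  obtain ⟨V, φ, hφ, v, hv, rfl⟩ := exists_isAddParam hm
  have hV := hφ.localParam.isOpen
  have hc : ContinuousAt φ v :=
    (hφ.localParam.holomorphic.continuousOn).continuousAt (hV.mem_nhds hv)
  have hG : ∀ z ∈ V, φ z ∈ D.addGraph := fun z hz => by
    obtain ⟨U, -, hU⟩ := hφ.localParam.image
    exact (hU.subset (Set.mem_image_of_mem φ hz)).1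
  have hb : (D.quart (v 0)).Good := by
    have := (hG v hv).2.2.2.1
    rwa [hφ.f_eq v hv] at this
  rw [mem_closure_iff_nhds]
  intro O hO
  set b := v 0 with hb0
  have hl : Tendsto (fun y : ℂ × ℂ => (![b, y.1, y.2] : Fin 3 → ℂ)) (𝓝 (v 1, v 2)) (𝓝 v) := by
    have h1 : Continuous fun y : ℂ × ℂ => (![b, y.1, y.2] : Fin 3 → ℂ) := by
      refine continuous_pi fun j => ?_
      fin_cases j
      exacts [continuous_const, continuous_fst, continuous_snd]
    have h2 : (![b, v 1, v 2] : Fin 3 → ℂ) = v := by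
      funext j
      fin_cases j <;> rfl
    simpa [h2] using h1.tendsto (v 1, v 2)
  -- The approximation takes place within one fibre: `b` is fixed and only the other two parameters
  -- vary.
  obtain ⟨N₁, hN₁, N₂, hN₂, hN⟩ := mem_nhds_prod_iff.1 (hl (Filter.inter_mem (hV.mem_nhds hv) (hc hO)))
  have hN' : ∀ y₁ ∈ N₁, ∀ y₂ ∈ N₂, ![b, y₁, y₂] ∈ V ∧ φ ![b, y₁, y₂] ∈ O := fun y₁ h₁ y₂ h₂ =>
    hN (Set.mk_mem_prod h₁ h₂)
  have hfb : ∀ y₁ ∈ N₁, ∀ y₂ ∈ N₂, D.f (φ ![b, y₁, y₂]).1 = b ∧ D.f (φ ![b, y₁, y₂]).2.1 = b ∧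
      D.f (φ ![b, y₁, y₂]).2.2 = b ∧ pt b (φ ![b, y₁, y₂]).1 + pt b (φ ![b, y₁, y₂]).2.1 =
        pt b (φ ![b, y₁, y₂]).2.2 := by
    intro y₁ h₁ y₂ h₂
    have hv' := (hN' y₁ h₁ y₂ h₂).1
    have h3 : D.f (φ ![b, y₁, y₂]).1 = b := hφ.f_eq _ hv'
    obtain ⟨-, h4, h5, -, h6⟩ := hG _ hv'
    rw [h3] at h4 h5 h6
    exact ⟨h3, h4, h5, h6⟩
  have hE : ({0, 1, D.t} : Set ℂ).Finite := Set.toFinite _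
  have hv2 : v 2 ∈ N₂ := mem_of_mem_nhds hN₂
  have inj₁ : Set.InjOn (fun y₁ => pt b (φ ![b, y₁, v 2]).1) N₁ := by
    intro y₁ h₁ y₁' h₁' he
    have r := (hG _ (hN' y₁ h₁ _ hv2).1).1.1
    have r' := (hG _ (hN' y₁' h₁' _ hv2).1).1.1
    have s := (hfb y₁ h₁ _ hv2).1
    have s' := (hfb y₁' h₁' _ hv2).1
    exact hφ.inj₁ _ (hN' y₁ h₁ _ hv2).1 _ (hN' y₁' h₁' _ hv2).1
      (pt_injective (by rwa [s]) r r' (s'.trans s.symm) (by rw [s]; exact he))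
  -- The choice of `y₁` puts the first point in general position. It does not depend on the last
  -- parameter (`fst_eq`), so `y₂` can then be chosen generic with respect to it.
  obtain ⟨y₁, ⟨x₁, w₁, n₁, q₁⟩, hy₁⟩ := ((eventually_of_cofinite hN₁ inj₁
    (SquareQuartic.eventually_isNice hb hE)).and (nhdsWithin_le_nhds hN₁)).exists
  have inj₂ : Set.InjOn (fun y₂ => pt b (φ ![b, y₁, y₂]).2.1) N₂ := by
    intro y₂ h₂ y₂' h₂' he
    have r := (hG _ (hN' y₁ hy₁ _ h₂).1).1.2.1
    have r' := (hG _ (hN' y₁ hy₁ _ h₂').1).1.2.1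
    have s := (hfb y₁ hy₁ _ h₂).2.1
    have s' := (hfb y₁ hy₁ _ h₂').2.1
    exact hφ.inj₂ _ (hN' y₁ hy₁ _ h₂).1 _ (hN' y₁ hy₁ _ h₂').1
      (pt_injective (by rwa [s]) r r' (s'.trans s.symm) (by rw [s]; exact he))
  obtain ⟨y₂, ⟨x₂, w₂, x₃, w₃, n₂, n₃, q₂, q₃, h12, h13, h23⟩, hy₂⟩ :=
    ((eventually_of_cofinite hN₂ inj₂ (SquareQuartic.eventually_generic hb hE n₁.onCurve
      n₁.smooth)).and (nhdsWithin_le_nhds hN₂)).exists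
  obtain ⟨hz, hzO⟩ := hN' y₁ hy₁ y₂ hy₂
  refine ⟨_, hzO, ?_⟩
  obtain ⟨f₁, f₂, f₃, hadd⟩ := hfb y₁ hy₁ y₂ hy₂
  rw [hφ.fst_eq _ (hN' y₁ hy₁ _ hv2).1 _ hz rfl rfl] at q₁
  rw [q₁, hadd] at q₃
  obtain ⟨⟨r₁, r₂, r₃⟩, -⟩ := hG _ hz
  obtain ⟨z₁, b₁, i₁, rfl, o₁⟩ := exists_interior hb r₁ f₁ n₁ subset_rfl q₁
  obtain ⟨z₂, b₂, i₂, rfl, o₂⟩ := exists_interior hb r₂ f₂ n₂ subset_rfl q₂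
  obtain ⟨z₃, b₃, i₃, rfl, o₃⟩ := exists_interior hb r₃ f₃ n₃ subset_rfl q₃
  rw [i₁, i₂, i₃, pt_interior, pt_interior, pt_interior, o₁.add_iff hb o₂ o₃ h12 h13 h23] at hadd
  refine ⟨z₁.1, z₁.2, z₂.1, z₂.2, z₃.1, z₃.2, b₁, b₂, b₃,
    Prod.ext i₁ (Prod.ext i₂ i₃), h12, h13, h23, o₁.2.trans o₂.2.symm, o₂.2.trans o₃.2.symm, ?_⟩
  unfold Interpolates cubic at hadd
  rw [← hadd]
  ring

theorem P_eq_addGraph : D.P = D.addGraph :=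
  P_subset_addGraph.antisymm fun _ hm => ⟨addGraph_subset_closure hm, hm.1⟩

end FourPointData

namespace FourPointData

open Filter Topology WeierstrassCurve

variable {D : FourPointData}

/-! ### The section at infinity -/

/-- A chart around the section `N`, in which it is the line where the first coordinate vanishes, and
is parametrized by `f`. -/
lemma exists_chart_N (D : FourPointData) : ∃ (i : D.ChartIndex) (c : ℂ → ℂ), Continuous c ∧
    (∀ m ∈ D.N, chartSource i m ∧ chartMap i m = (0, c (D.f m))) ∧
    ∀ m, chartSource i m → (chartMap i m).1 = 0 → m ∈ D.N := by
  by_cases hs : D.s = 0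
  · refine ⟨.branch .infty hs, fun b => (b - D.β .infty) / D.C .infty 0, by fun_prop, ?_, ?_⟩
    · rintro _ ⟨b, hv, hb, rfl⟩
      exact ⟨rfl, rfl⟩
    · rintro (⟨z, hz⟩ | ⟨a, v, b, hv, hb⟩) h1 h2
      · exact absurd h2 (innerMap_mem (i := .branch .infty hs) h1).1
      · obtain rfl : a = .infty := h1
        have h3 : D.κ .infty = 0 := hs
        rw [h3, zero_pow two_ne_zero, sq_eq_zero_iff] at hv
        exact (mem_N_iff _ _).2 ⟨rfl, hv.trans hs.symm⟩
  · refine ⟨.pole .infty D.s rfl hs, fun b => (b - D.β .infty) / (2 * D.s * D.C .infty 0),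
      by fun_prop, ?_, ?_⟩
    · rintro _ ⟨b, hv, hb, rfl⟩
      exact ⟨⟨rfl, rfl⟩, rfl⟩
    · rintro (⟨z, hz⟩ | ⟨a, v, b, hv, hb⟩) h1 h2
      · exact absurd h2 (innerMap_mem (i := .pole .infty D.s rfl hs) h1).1
      · exact (mem_N_iff _ _).2 h1

/-- The section `N` as a function of `f`. -/
lemma exists_section_N (D : FourPointData) : ∃ o : ℂ → HitchinSurface D, ∀ m ∈ D.N,
    o (D.f m) = m ∧ ContinuousAt o (D.f m) := by
  obtain ⟨i, c, hc, h1, -⟩ := exists_chart_N D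
  refine ⟨fun b => chartInv i (0, c b), fun m hm => ?_⟩
  obtain ⟨h2, h3⟩ := h1 m hm
  refine ⟨by simp only [← h3, chartInv_chartMap h2], ?_⟩
  refine ContinuousAt.comp (g := chartInv i) (f := fun b => ((0 : ℂ), c b)) ?_ (by fun_prop)
  rw [← h3]
  exact continuousAt_chartInv (chartMap_mem h2)

theorem isLagrangian_N (D : FourPointData) : IsLagrangian 𝓘(ℂ, ℂ × ℂ) D.Ω D.N := by
  obtain ⟨i, c, -, h1, h2⟩ := exists_chart_N D
  refine ⟨1, by simp, fun m hm => ?_⟩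
  -- In the chart `N` is the axis where the first coordinate vanishes, and the form vanishes on a
  -- line.
  set Λ : (Fin 1 → ℂ) →L[ℂ] ℂ × ℂ := (ContinuousLinearMap.inr ℂ ℂ ℂ).comp
    (ContinuousLinearMap.proj (R := ℂ) (φ := fun _ : Fin 1 => ℂ) 0) with hΛ
  set V : Set (Fin 1 → ℂ) := Λ ⁻¹' chartTarget i with hV
  have hder : ∀ v ∈ V, ∃ L, IsSymp L ∧ HasMFDerivAt 𝓘(ℂ, Fin 1 → ℂ) 𝓘(ℂ, ℂ × ℂ)
      (chartInv i ∘ Λ) v (L.comp Λ) := by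
    intro v hv
    obtain ⟨L, hL, hL'⟩ := hasMFDerivAt_chartInv (D := D) hv
    exact ⟨L, hL, hL'.comp v Λ.hasFDerivAt.hasMFDerivAt⟩
  have hψ : ∀ v ∈ V, (fun _ => (chartMap i (chartInv i (Λ v))).2) = v := by
    intro v hv
    rw [chartMap_chartInv hv]
    funext j
    rw [Subsingleton.elim j 0]
    rfl
  refine ⟨V, chartInv i ∘ Λ, ⟨?_, ?_, ?_, ?_, ?_⟩, ?_, ?_⟩
  · exact (isOpen_chartTarget i).preimage Λ.continuous
  · intro v hv
    obtain ⟨L, -, hL⟩ := hder v hv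
    exact hL.mdifferentiableAt.mdifferentiableWithinAt
  · intro v hv
    obtain ⟨L, hL, hL'⟩ := hder v hv
    rw [hL'.mfderiv]
    refine hL.injective.comp fun a b hab => ?_
    funext j
    rw [Subsingleton.elim j 0]
    exact congrArg Prod.snd hab
  · refine isEmbedding_domRestrict (ψ := fun m _ => (chartMap i m).2) ?_ ?_ hψ
    · intro v hv
      obtain ⟨L, -, hL⟩ := hder v hv
      exact hL.continuousAt.continuousWithinAt
    · intro v hv
      exact continuousAt_pi.2 fun _ => (continuousAt_chartMap (chartSource_chartInv hv)).snd
  · refine ⟨_, isOpen_chartSource i, Set.Subset.antisymm ?_ ?_⟩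
    · rintro _ ⟨v, hv, rfl⟩
      refine ⟨h2 _ (chartSource_chartInv hv) ?_, chartSource_chartInv hv⟩
      simp only [Function.comp_apply]
      rw [chartMap_chartInv hv]
      rfl
    · rintro n ⟨hn, hn'⟩
      have h3 : Λ (fun _ => c (D.f n)) = chartMap i n := (h1 n hn).2.symm
      refine ⟨fun _ => c (D.f n), ?_, ?_⟩
      · rw [hV, Set.mem_preimage, h3]
        exact chartMap_mem hn'
      · rw [Function.comp_apply, h3, chartInv_chartMap hn']
  · obtain ⟨h3, h4⟩ := h1 m hm
    have h5 : Λ (fun _ => c (D.f m)) = chartMap i m := h4.symm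
    refine ⟨fun _ => c (D.f m), ?_, ?_⟩
    · rw [hV, Set.mem_preimage, h5]
      exact chartMap_mem h3
    · rw [Function.comp_apply, h5, chartInv_chartMap h3]
  · intro v hv a b
    obtain ⟨L, hL, hL'⟩ := hder v hv
    rw [hL'.mfderiv]
    refine (hL (Λ a) (Λ b)).trans ?_
    have h0 : ∀ a, (Λ a).1 = 0 := fun a => rfl
    rw [stdForm_apply, h0 a, h0 b, zero_mul, mul_zero, sub_zero]

lemma good_of_mem_N {m : HitchinSurface D} (hm : m ∈ D.N) (h : ¬ D.IsReducible (D.f m)) :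
    (D.quart (D.f m)).Good := by
  obtain ⟨b, hv, hb, rfl⟩ := hm
  refine good_iff.2 ⟨h, ?_⟩
  by_cases hs : D.s = 0
  · exact .inr (by simpa [β, hs, f] using hb)
  · exact .inl hs

/-! ### The correspondence -/

/-- A separate variable `b` puts all points of an argument into the same group; the group-theoretic
assertions below use only this form. -/
lemma mem_P_iff {u v w : HitchinSurface D} : (u, v, w) ∈ D.P ↔
    ∃ b, (D.quart b).Good ∧ (u ∈ D.regular ∧ D.f u = b) ∧ (v ∈ D.regular ∧ D.f v = b) ∧
      (w ∈ D.regular ∧ D.f w = b) ∧ pt b u + pt b v = pt b w := by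
  rw [P_eq_addGraph]
  constructor
  · rintro ⟨⟨h1, h2, h3⟩, h4, h5, h6, h7⟩
    exact ⟨_, h6, ⟨h1, rfl⟩, ⟨h2, h4⟩, ⟨h3, h5⟩, h7⟩
  · rintro ⟨_, h6, ⟨h1, rfl⟩, ⟨h2, h4⟩, ⟨h3, h5⟩, h7⟩
    exact ⟨⟨h1, h2, h3⟩, h4, h5, h6, h7⟩

theorem isLagrangian_P (D : FourPointData) :
    IsLagrangian (𝓘(ℂ, ℂ × ℂ).prod (𝓘(ℂ, ℂ × ℂ).prod 𝓘(ℂ, ℂ × ℂ))) (tripleForm D.Ω) D.P := by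
  rw [P_eq_addGraph]
  refine ⟨3, by simp, fun m hm => ?_⟩
  obtain ⟨V, φ, hφ, hm⟩ := exists_isAddParam hm
  exact ⟨V, φ, hφ.localParam, hm, hφ.isotropic⟩

theorem isSubmersionOn_fst (D : FourPointData) :
    IsSubmersionOn (𝓘(ℂ, ℂ × ℂ).prod (𝓘(ℂ, ℂ × ℂ).prod 𝓘(ℂ, ℂ × ℂ))) 𝓘(ℂ, ℂ × ℂ) D.P
      (fun z => z.1) := by
  rw [P_eq_addGraph]
  intro m hm
  obtain ⟨V, φ, hφ, v, hv, rfl⟩ := exists_isAddParam hm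
  obtain ⟨L, hL, hL'⟩ := hφ.submersion₁ v hv
  exact ⟨3, V, φ, hφ.localParam, v, hv, rfl, hL.mdifferentiableAt,
    (congrArg (fun L : (Fin 3 → ℂ) →L[ℂ] ℂ × ℂ => Function.Surjective L) hL.mfderiv).mpr hL'⟩

theorem isSubmersionOn_snd_fst (D : FourPointData) :
    IsSubmersionOn (𝓘(ℂ, ℂ × ℂ).prod (𝓘(ℂ, ℂ × ℂ).prod 𝓘(ℂ, ℂ × ℂ))) 𝓘(ℂ, ℂ × ℂ) D.P
      (fun z => z.2.1) := by
  rw [P_eq_addGraph]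
  intro m hm
  obtain ⟨V, φ, hφ, v, hv, rfl⟩ := exists_isAddParam hm
  obtain ⟨L, hL, hL'⟩ := hφ.submersion₂ v hv
  exact ⟨3, V, φ, hφ.localParam, v, hv, rfl, hL.mdifferentiableAt,
    (congrArg (fun L : (Fin 3 → ℂ) →L[ℂ] ℂ × ℂ => Function.Surjective L) hL.mfderiv).mpr hL'⟩

theorem isSubmersionOn_snd_snd (D : FourPointData) :
    IsSubmersionOn (𝓘(ℂ, ℂ × ℂ).prod (𝓘(ℂ, ℂ × ℂ).prod 𝓘(ℂ, ℂ × ℂ))) 𝓘(ℂ, ℂ × ℂ) D.P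
      (fun z => z.2.2) := by
  rw [P_eq_addGraph]
  intro m hm
  obtain ⟨V, φ, hφ, v, hv, rfl⟩ := exists_isAddParam hm
  obtain ⟨L, hL, hL'⟩ := hφ.submersion₃ v hv
  exact ⟨3, V, φ, hφ.localParam, v, hv, rfl, hL.mdifferentiableAt,
    (congrArg (fun L : (Fin 3 → ℂ) →L[ℂ] ℂ × ℂ => Function.Surjective L) hL.mfderiv).mpr hL'⟩

lemma P_symm {u v w : HitchinSurface D} (h : (u, v, w) ∈ D.P) : (v, u, w) ∈ D.P := by
  obtain ⟨b, h1, h2, h3, h4, h5⟩ := mem_P_iff.1 h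
  exact mem_P_iff.2 ⟨b, h1, h3, h2, h4, (add_comm _ _).trans h5⟩

/-- The intermediate product exists because every point of the Weierstrass curve comes from a
regular point of the fibre. -/
lemma P_assoc {m₁ m₂ m₃ m₄ : HitchinSurface D} (h : ∃ m, (m₁, m₂, m) ∈ D.P ∧ (m, m₃, m₄) ∈ D.P) :
    ∃ m, (m₂, m₃, m) ∈ D.P ∧ (m₁, m, m₄) ∈ D.P := by
  obtain ⟨m, h, h'⟩ := h
  obtain ⟨b, hb, a₁, a₂, a, e⟩ := mem_P_iff.1 h
  obtain ⟨b', -, a', a₃, a₄, e'⟩ := mem_P_iff.1 h'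
  obtain rfl : b = b' := a.2.symm.trans a'.2
  obtain ⟨n, n1, n2, n3⟩ := pt_surjective hb (pt b m₂ + pt b m₃)
  refine ⟨n, mem_P_iff.2 ⟨b, hb, a₂, a₃, ⟨n1, n2⟩, n3.symm⟩,
    mem_P_iff.2 ⟨b, hb, a₁, ⟨n1, n2⟩, a₄, ?_⟩⟩
  rw [n3, ← add_assoc, e, e']

/-- Commutativity turns the converse into `P_assoc` for the reversed order of factors. -/
lemma P_assoc_iff {m₁ m₂ m₃ m₄ : HitchinSurface D} :
    (∃ m, (m₁, m₂, m) ∈ D.P ∧ (m, m₃, m₄) ∈ D.P) ↔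
      ∃ m, (m₂, m₃, m) ∈ D.P ∧ (m₁, m, m₄) ∈ D.P := by
  refine ⟨P_assoc, fun ⟨m, h, h'⟩ => ?_⟩
  obtain ⟨n, hn, hn'⟩ := P_assoc ⟨m, P_symm h, P_symm h'⟩
  exact ⟨n, P_symm hn, P_symm hn'⟩

/-! ### The unit -/

lemma mem_P_of_mem_N {n v w : HitchinSurface D} (hn : n ∈ D.N) (h : (n, v, w) ∈ D.P) :
    D.f n = D.f v ∧ v = w ∧ v ∈ D.regular ∧ (D.quart (D.f v)).Good := by
  obtain ⟨b, hb, h1, ⟨h2, rfl⟩, h3, h4⟩ := mem_P_iff.1 h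
  rw [pt_of_mem_N hn, zero_add] at h4
  exact ⟨h1.2, pt_injective hb h2 h3.1 h3.2 h4, h2, hb⟩

lemma exists_mem_N_mem_P {v : HitchinSurface D} (hv : v ∈ D.regular)
    (hb : (D.quart (D.f v)).Good) : ∃ n ∈ D.N, (n, v, v) ∈ D.P := by
  obtain ⟨n, h1, h2, h3⟩ := exists_mem_N hb
  refine ⟨n, h1, mem_P_iff.2 ⟨_, hb, ⟨h2, h3⟩, ⟨hv, rfl⟩, ⟨hv, rfl⟩, ?_⟩⟩
  rw [pt_of_mem_N h1, zero_add]

lemma range_unit (D : FourPointData) :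
    Set.range (fun z : {z : HitchinSurface D × HitchinSurface D × HitchinSurface D //
      z ∈ D.P ∧ z.1 ∈ D.N} => z.1.2) =
    {q | q.1 ∈ D.regular ∧ (D.quart (D.f q.1)).Good} ∩ Set.diagonal (HitchinSurface D) := by
  ext ⟨v, w⟩
  constructor
  · rintro ⟨⟨⟨n, v', w'⟩, h1, h2⟩, h⟩
    cases h
    obtain ⟨-, h3, h4, h5⟩ := mem_P_of_mem_N h2 h1
    exact ⟨⟨h4, h5⟩, h3⟩
  · rintro ⟨⟨h1, h2⟩, h3⟩
    obtain rfl : v = w := h3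
    obtain ⟨n, h4, h5⟩ := exists_mem_N_mem_P h1 h2
    exact ⟨⟨(n, v, v), h5, h4⟩, rfl⟩

/-- The point of `N` is determined by the fibre, so `q ↦ (o (f q), q)` is a left inverse, continuous
at the image points. -/
lemma isEmbedding_unit (D : FourPointData) : Topology.IsEmbedding
    (fun z : {z : HitchinSurface D × HitchinSurface D × HitchinSurface D //
      z ∈ D.P ∧ z.1 ∈ D.N} => z.1.2) := by
  obtain ⟨o, ho⟩ := exists_section_N D
  refine isEmbedding_domRestrict (V := {z | z ∈ D.P ∧ z.1 ∈ D.N}) (φ := Prod.snd)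
    (ψ := fun q => (o (D.f q.1), q)) continuous_snd.continuousOn ?_ ?_
  · rintro ⟨n, v, w⟩ ⟨h1, h2⟩
    have h3 := (mem_P_of_mem_N h2 h1).1
    refine ContinuousAt.prodMk ?_ continuousAt_id
    refine ContinuousAt.comp (g := o)
      (f := fun q : HitchinSurface D × HitchinSurface D => D.f q.1) ?_
      (continuous_f.comp continuous_fst).continuousAt
    simp only
    rw [← h3]
    exact (ho n h2).2
  · rintro ⟨n, v, w⟩ ⟨h1, h2⟩
    have h3 := (mem_P_of_mem_N h2 h1).1
    simp only
    rw [← h3, (ho n h2).1]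

lemma finite_not_good : {b | ¬ (D.quart b).Good}.Finite := by
  refine ((finite_isReducible (D := D)).union (Set.finite_singleton 0)).subset fun b hb => ?_
  by_contra h
  rw [Set.mem_union, not_or] at h
  exact hb (good_iff.2 ⟨h.1, .inr h.2⟩)

/-- Interior points are dense. For fixed `x` the function `f` is quadratic in `p` with nonzero
leading coefficient, so only finitely many `p` lead to `p = 0` or to an excluded fibre. -/
lemma dense_good (D : FourPointData) :
    Dense {m : HitchinSurface D | m ∈ D.regular ∧ (D.quart (D.f m)).Good} := by
  intro m
  rw [mem_closure_iff]
  intro O hO hm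
  have hs := chartSource_chartIndexAt m
  set i := chartIndexAt m
  have hc : ContinuousAt (chartInv i) (chartMap i m) := continuousAt_chartInv (chartMap_mem hs)
  obtain ⟨z', ⟨h1, -⟩, h2⟩ := ((frequently_inner (chartMap_mem hs)).and_eventually
    (hc.eventually_mem (hO.mem_nhds (by rwa [chartInv_chartMap hs])))).exists
  rw [chartInv_inner h1] at h2
  obtain ⟨z, h0, h2⟩ : ∃ z, ∃ hz : z ∈ D.base, HitchinSurface.interior z hz ∈ O := ⟨_, _, h2⟩
  have e : ∀ p, chartInv .main (z.1, p) = .interior (z.1, p) h0 := fun p => chartInv_inner h0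
  have hA := cubic_ne_zero h0
  have hfin : ({p | ¬ (D.quart (D.f₀ z.1 p)).Good} ∪ {0}).Finite := by
    refine Set.Finite.union ?_ (Set.finite_singleton 0)
    refine Set.Finite.preimage' (f := fun p => D.f₀ z.1 p) finite_not_good fun b _ => ?_
    by_cases hb : ∃ p₀, D.f₀ z.1 p₀ = b
    · obtain ⟨p₀, rfl⟩ := hb
      refine (Set.toFinite {p₀, -p₀}).subset fun p hp => ?_
      have hp : D.f₀ z.1 p = D.f₀ z.1 p₀ := hp
      have h3 : D.cubic z.1 * p ^ 2 = D.cubic z.1 * p₀ ^ 2 := by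
        unfold f₀ at hp
        unfold cubic
        linear_combination hp
      exact sq_eq_sq_iff_eq_or_eq_neg.1 (mul_left_cancel₀ hA h3)
    · exact Set.Finite.subset Set.finite_empty fun p hp => hb ⟨p, hp⟩
  have hcp : ContinuousAt (fun p => chartInv (D := D) .main (z.1, p)) z.2 :=
    ContinuousAt.comp (g := chartInv (D := D) .main) (f := fun p => (z.1, p))
      (continuousAt_chartInv (i := .main) h0) (by fun_prop)
  obtain ⟨p, h3, h4⟩ := (mem_closure_iff_nhds.1 ((hfin.countable.dense_compl ℂ) z.2) _
    (hcp.preimage_mem_nhds (hO.mem_nhds (by rw [e]; exact h2))))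
  rw [Set.mem_preimage, e] at h3
  rw [Set.mem_compl_iff, Set.mem_union, not_or] at h4
  have h5 : (D.quart (D.f₀ z.1 p)).Good := not_not.1 h4.1
  exact ⟨_, h3, interior_mem_regular_of_ne _ h4.2 (good_iff.1 h5).1, h5⟩

lemma diagonal_subset_closure_unit (D : FourPointData) :
    Set.diagonal (HitchinSurface D) ⊆ closure (Set.range
      (fun z : {z : HitchinSurface D × HitchinSurface D × HitchinSurface D //
        z ∈ D.P ∧ z.1 ∈ D.N} => z.1.2)) := by
  rintro ⟨m, m'⟩ h
  obtain rfl : m = m' := h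
  rw [range_unit]
  have h1 : Continuous fun m : HitchinSurface D => (m, m) := continuous_id.prodMk continuous_id
  refine closure_mono ?_ (image_closure_subset_closure_image h1 ⟨m, dense_good D m, rfl⟩)
  rintro _ ⟨v, hv, rfl⟩
  exact ⟨hv, rfl⟩

theorem isSemiclassicalKernel (D : FourPointData) : IsSemiclassicalKernel D.Ω D.N D.P where
  symplectic := isSymplectic
  lagrangian_N := isLagrangian_N D
  lagrangian_P := isLagrangian_P D
  submersion₁ := isSubmersionOn_fst D
  submersion₂ := isSubmersionOn_snd_fst D
  submersion₃ := isSubmersionOn_snd_snd D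
  symm _ _ _ := P_symm
  assoc _ _ _ _ := P_assoc_iff
  unit_embedding := isEmbedding_unit D
  unit_open := ⟨_, (isOpen_regular.inter (isOpen_setOf_good.preimage continuous_f)).preimage
    continuous_fst, range_unit D⟩
  unit_dense := diagonal_subset_closure_unit D

/-! ### The group structure on the fibres -/

/-- The regular points of a fibre are the points of a Weierstrass curve. -/
def fibreEquiv {b : ℂ} (hb : (D.quart b).Good) :
    {m : HitchinSurface D // m ∈ D.regular ∧ D.f m = b} ≃ (D.quart b).W.toAffine.Point :=
  Equiv.ofBijective (fun m => pt b m) <| by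
    constructor
    · rintro ⟨m, hm, rfl⟩ ⟨m', hm', hf⟩ h
      exact Subtype.ext (pt_injective hb hm hm' hf h)
    · intro P
      obtain ⟨m, h1, h2, h3⟩ := pt_surjective hb P
      exact ⟨⟨m, h1, h2⟩, h3⟩

end FourPointData

theorem theorem3p3p1 (D : FourPointData) :
    IsSemiclassicalKernel D.Ω D.N D.P ∧
    ∀ b : ℂ, ¬ D.IsReducible b → ∀ o ∈ D.N, D.f o = b →
      ∃ G : AddCommGroup {m : HitchinSurface D // m ∈ D.regular ∧ D.f m = b},
        (letI := G; ((0 : {m : HitchinSurface D // m ∈ D.regular ∧ D.f m = b}) :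
          HitchinSurface D) = o) ∧
        ∀ u v w : {m : HitchinSurface D // m ∈ D.regular ∧ D.f m = b},
          ((u : HitchinSurface D), (v : HitchinSurface D), (w : HitchinSurface D)) ∈ D.P ↔
            (letI := G; u + v = w) := by
  refine ⟨D.isSemiclassicalKernel, ?_⟩
  rintro b hb o ho rfl
  have hG := FourPointData.good_of_mem_N ho hb
  have hr : o ∈ D.regular := by
    obtain ⟨b, hv, hs, rfl⟩ := ho
    exact (FourPointData.added_mem_regular hv hs).2 hb
  -- The group structure is transported from the Weierstrass curve, where the point of `N`
  -- corresponds to zero.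
  let e := FourPointData.fibreEquiv hG
  refine ⟨e.addCommGroup, ?_, fun u v w => ?_⟩
  · have h : e.symm 0 = ⟨o, hr, rfl⟩ := by
      rw [Equiv.symm_apply_eq]
      exact (FourPointData.pt_of_mem_N ho _).symm
    exact congrArg Subtype.val h
  · have h1 : e u + e v = e w ↔ e.symm (e u + e v) = w := by
      rw [Equiv.symm_apply_eq]
    refine Iff.trans ?_ h1
    rw [FourPointData.mem_P_iff]
    constructor
    · rintro ⟨b, -, -, -, ⟨-, h⟩, h'⟩
      obtain rfl : b = D.f o := h.symm.trans w.2.2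
      exact h'
    · exact fun h => ⟨_, hG, u.2, v.2, w.2, h⟩
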